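/- **Setting.** Write $(x,t)\in\mathbb R^2\times\mathbb R$ and $(\xi,\tau)$ for the dual variables (space-time Fourier transform with kernel $e^{-i(x\cdot\xi+t\tau)}$), $|(\xi,\tau)|=(|\tau|+|\xi|^2)^{1/2}$, $\langle r\rangle=(1+r^2)^{1/2}$. Fix a nonnegative smooth $\varphi_0$ on $[0,\infty)$ with $\varphi_0=1$ on $[0,1]$, $\varphi_0=0$ on $[2,\infty)$; put $\varphi_i(r)=\varphi_0(2^{-i}r)-\varphi_0(2^{-i+1}r)$ for $i\ge1$. For $i\in\mathbb N=\{0,1,2,\dots\}$ and $d\in I_i=\{2^{-i},2^{-i+1},\dots,2^{i+2}\}$ let $A_{i,d}$ be the support of $\varphi_i(|(\xi,\tau)|)\,\varphi_{i+\log_2 d}(|\tau-|\xi|^2|)$. For $u\in L^2(\mathbb R^3;\mathbb C)$ with $\hat u$ supported in $A_{i,d}$ set $\|u\|_{X^{0,1/2}_{i,d}}=\|\langle\tau-|\xi|^2\rangle^{1/2}\hat u\|_{L^2}$ and $$\|u\|_{\mathcal DX^{0,1/2}_{i,d}}=(2^id)^{1/2}\big(\|u\|_{\mathcal D_iL^2}+\|u\|_{L^2}\big),\qquad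 \|u\|_{\mathcal D_iL^2}=\sup_{L}\sup_{k\in\mathbb Z}\sum_{m:\,Q_i^m\cap L_i^k\neq\emptyset}\|u\|_{L^2(Q_i^m\times\mathbb R)},$$ where $Q_i^m$ ($m\in\mathbb Z^2$) is the partition of $\mathbb R^2$ into axis-parallel cubes of side $2^i$ centered at $2^im$, $L$ runs over the lines through the origin, and $L_i^k$ is $L$ translated by $k2^i$ times its unit normal. For $g\in L^1(\mathbb R^3)$, $\|g\|_{X^{0,-1/2}_{k,d}}:=\|\mathbf 1_{A_{k,d}}\langle\tau-|\xi|^2\rangle^{-1/2}\hat g\|_{L^2}$ measures the part of $g$ with Fourier transform in $A_{k,d}$. Let $B(u,v)=\sum_{a,b\in\{1,2\}}c_{ab}\,\partial_{x_a}u\,\partial_{x_b}v$ with complex constants $c_{ab}$. **Proposition.** There is a constant $C>0$, depending only on $\varphi_0$ and $(c_{ab})$, such that the following holds for all $i,j,k\in\mathbb N$, all $d_1\in I_i$, $d_2\in I_j$, and all $u,v\in L^2(\mathbb R^3;\mathbb C)$ with $\hat u$ supported in $A_{i,d_1}$ and $\hat v$ supported in $A_{j,d_2}$. a) If $i\le j-5$,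 $d_1\le 2^{i-2}$, $d_3\in I_j$ and $d_2,d_3\le 2^{i-5}$, then $B(u,v)\in L^1$ and $$\|B(u,v)\|_{X^{0,-1/2}_{j,d_3}}\le C\,2^{2i}\,\|u\|_{\mathcal DX^{0,1/2}_{i,d_1}}\|v\|_{X^{0,1/2}_{j,d_2}}.$$ b) If $i\le j-5$, $d_1\ge 2^{i-2}$ and $d_3\in I_j$, the same conclusion holds. c) If $|i-j|\le1$, $k\le j-5$, $d_3\in I_k$ and $d_3\ge 2^{k-2}$, then $B(u,v)\in L^1$ and $$\|B(u,v)\|_{X^{0,-1/2}_{k,d_3}}\le C\,2^{k+j}\,2^{\frac{j-k}2}\,\|u\|_{\mathcal DX^{0,1/2}_{i,d_1}}\|v\|_{X^{0,1/2}_{j,d_2}}.$$ In a), b) and c) the statements also hold with $B(u,v)$ replaced by $B(\bar u,v)$ or by $B(u,\bar v)$. -/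

import Mathlib

open MeasureTheory FourierTransform LineDeriv
open scoped ENNReal NNReal SchwartzMap ContDiff

noncomputable section

namespace DNLS

/-- Space-time `ℝ² × ℝ`: coordinates `0, 1` are the space variables (`x`, or `ξ` on the Fourier
side) and coordinate `2` is the time variable (`t`, or `τ` on the Fourier side). -/
abbrev SpaceTime : Type := EuclideanSpace ℝ (Fin 3)

/-- Complex-valued square integrable functions on space-time. -/
abbrev L2 : Type := Lp ℂ 2 (volume : Measure SpaceTime)

/-- The spatial coordinate with index `a`, as an index of a space-time coordinate. -/
abbrev sp (a : Fin 2) : Fin 3 := a.castSucc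

/-- The space component of a point of space-time. -/
def space (z : SpaceTime) : EuclideanSpace ℝ (Fin 2) := WithLp.toLp 2 fun a => z (sp a)

/-- The time component of a point of space-time. -/
def time (z : SpaceTime) : ℝ := z 2

/-! ### Fourier transforms, in angular frequencies -/

/-- The unitary Fourier transform of an `L²` function in angular frequency: the extension to `L²`
of `û(ζ) = (2π)^(-3/2) ∫ exp(-i z·ζ) u(z) dz` (Mathlib's `𝓕` has the kernel
`exp(-2πi z·ζ)`). -/
def hatL2 (u : L2) (ζ : SpaceTime) : ℂ :=
  (((2 * Real.pi) ^ (-(3 / 2) : ℝ) : ℝ) : ℂ) * (𝓕 u : L2) ((2 * Real.pi)⁻¹ • ζ)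

/-- The same Fourier transform for an integrable function, given by the integral. -/
def hatL1 (g : SpaceTime → ℂ) (ζ : SpaceTime) : ℂ :=
  (((2 * Real.pi) ^ (-(3 / 2) : ℝ) : ℝ) : ℂ) * 𝓕 g ((2 * Real.pi)⁻¹ • ζ)

/-! ### Frequency and modulation localization -/

/-- The parabolic norm `|(ξ,τ)| = (|τ| + ξ²)^(1/2)`. -/
def pnorm (ζ : SpaceTime) : ℝ := √(|time ζ| + ‖space ζ‖ ^ 2)

/-- The modulation `τ - ξ²`. -/
def modulation (ζ : SpaceTime) : ℝ := time ζ - ‖space ζ‖ ^ 2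

/-- The Japanese bracket `⟨r⟩ = (1 + r²)^(1/2)`. -/
def bracket (r : ℝ) : ℝ := √(1 + r ^ 2)

/-- The admissible initial cutoffs `φ₀ : [0,∞) → [0,∞)` (values at negative numbers are
irrelevant). -/
structure IsCutoff (φ₀ : ℝ → ℝ) : Prop where
  smooth : ContDiffOn ℝ ∞ φ₀ (Set.Ici 0)
  nonneg : ∀ x, 0 ≤ x → 0 ≤ φ₀ x
  eq_one : ∀ x, 0 ≤ x → x ≤ 1 → φ₀ x = 1
  eq_zero : ∀ x, 2 ≤ x → φ₀ x = 0

/-- The dyadic pieces: `φ_0`, and `φ_i(x) = φ₀(2^(-i) x) - φ₀(2^(-i+1) x)` for `i ≥ 1`. -/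
def dyadicCutoff (φ₀ : ℝ → ℝ) (i : ℕ) (x : ℝ) : ℝ :=
  if i = 0 then φ₀ x else φ₀ (2 ^ (-(i : ℤ)) * x) - φ₀ (2 ^ (-(i : ℤ) + 1) * x)

/-- The set `I_i = {2^(-i), 2^(-i+1), …, 2^(i+2)}` of admissible distances `d`. -/
def distances (i : ℕ) : Set ℝ :=
  {d | ∃ l : ℤ, -(i : ℤ) ≤ l ∧ l ≤ (i : ℤ) + 2 ∧ d = (2 : ℝ) ^ l}

/-- `φ_{i,d}(ξ,τ) = φ_i(|(ξ,τ)|) φ_{i + log₂ d}(|τ - ξ²|)`, for `d ∈ I_i`. -/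
def localizer (φ₀ : ℝ → ℝ) (i : ℕ) (d : ℝ) (ζ : SpaceTime) : ℝ :=
  dyadicCutoff φ₀ i (pnorm ζ) *
    dyadicCutoff φ₀ ((i : ℤ) + Int.log 2 d).toNat |modulation ζ|

/-- The region `A_{i,d}`: the support of `φ_{i,d}`. -/
def region (φ₀ : ℝ → ℝ) (i : ℕ) (d : ℝ) : Set SpaceTime := tsupport (localizer φ₀ i d)

/-- The Fourier transform of `u` is supported in `A`. -/
def FourierSupportedIn (u : L2) (A : Set SpaceTime) : Prop := ∀ᵐ ζ, ζ ∉ A → hatL2 u ζ = 0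

/-! ### The norms -/

/-- The weight `⟨(ξ,τ)⟩^s ⟨τ - ξ²⟩^b` of the Bourgain space `X^{s,b}`. -/
def weight (s b : ℝ) (ζ : SpaceTime) : ℝ := bracket (pnorm ζ) ^ s * bracket (modulation ζ) ^ b

/-- The norm of `X^{s,b}`. -/
def xNorm (s b : ℝ) (u : L2) : ℝ≥0∞ :=
  eLpNorm (fun ζ => (weight s b ζ : ℂ) * hatL2 u ζ) 2 volume

/-- The norm in `X^{s,b}` of the part of an integrable function `g` whose Fourier transform lies in
the region `A`, i.e. of `𝓕⁻¹ (χ_A 𝓕 g)`. -/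
def xNormOn (s b : ℝ) (A : Set SpaceTime) (g : SpaceTime → ℂ) : ℝ≥0∞ :=
  eLpNorm (A.indicator fun ζ => (weight s b ζ : ℂ) * hatL1 g ζ) 2 volume

/-- The cube `Q_i^m` of size `2^i` centered at `2^i m`. -/
def cube (i : ℕ) (m : Fin 2 → ℤ) : Set (EuclideanSpace ℝ (Fin 2)) :=
  {x | ∀ a, 2 ^ i * ((m a : ℝ) - 1 / 2) ≤ x a ∧ x a < 2 ^ i * ((m a : ℝ) + 1 / 2)}

/-- The line `L_i^k`: the translate by `k 2^i n` of the line `L` through the origin with unit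
normal `n`. -/
def line (i : ℕ) (n : EuclideanSpace ℝ (Fin 2)) (k : ℤ) : Set (EuclideanSpace ℝ (Fin 2)) :=
  {x | inner ℝ n x = (k : ℝ) * 2 ^ i}

/-- The decay norm `𝒟_i L²`: the supremum over all lines `L` through the origin and all `k ∈ ℤ` of
the `ℓ¹` sum of `‖u‖_{L²(Q_i^m × ℝ)}` over the cubes `Q_i^m` which meet `L_i^k`. -/
def decayNorm (i : ℕ) (u : L2) : ℝ≥0∞ :=
  ⨆ n : {n : EuclideanSpace ℝ (Fin 2) // ‖n‖ = 1}, ⨆ k : ℤ,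
    ∑' m : {m : Fin 2 → ℤ // (cube i m ∩ line i n k).Nonempty},
      eLpNorm u 2 (volume.restrict (space ⁻¹' cube i m))

/-- The norm of `𝒟X^{s,1/2}_{i,d}` of a function with Fourier transform supported in `A_{i,d}`. -/
def decayXNorm (s : ℝ) (i : ℕ) (d : ℝ) (u : L2) : ℝ≥0∞ :=
  ENNReal.ofReal (2 ^ ((i : ℝ) * s) * (2 ^ i * d) ^ (1 / 2 : ℝ)) *
    (decayNorm i u + eLpNorm u 2 volume)

/-! ### The bilinear form -/

open Classical in
/-- The distributional derivative `∂u/∂x_a`, as an `L²` function, whenever it is one (and `0`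
otherwise). See `partialDeriv_spec`: no default value occurs if `û` has bounded support. -/
def partialDeriv (a : Fin 2) (u : L2) : L2 :=
  if h : ∃ w : L2, (w : 𝓢'(SpaceTime, ℂ)) =
      ∂_{EuclideanSpace.single (sp a) (1 : ℝ)} (u : 𝓢'(SpaceTime, ℂ))
  then h.choose else 0

/-- If `û` has bounded support, then `∂u/∂x_a` is an `L²` function, so `partialDeriv a u` is the
distributional derivative of `u`. -/
theorem partialDeriv_spec (a : Fin 2) (u : L2) (A : Set SpaceTime) (hA : Bornology.IsBounded A)
    (hu : FourierSupportedIn u A) :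
    (partialDeriv a u : 𝓢'(SpaceTime, ℂ)) =
      ∂_{EuclideanSpace.single (sp a) (1 : ℝ)} (u : 𝓢'(SpaceTime, ℂ)) := by
  set e : SpaceTime := EuclideanSpace.single (sp a) (1 : ℝ) with he
  suffices h : ∃ w : L2, (w : 𝓢'(SpaceTime, ℂ)) = ∂_{e} (u : 𝓢'(SpaceTime, ℂ)) by
    unfold partialDeriv
    rw [dif_pos h]
    exact h.choose_spec
  obtain ⟨R, hR⟩ := hA.exists_norm_le
  have hpi : (0 : ℝ) < 2 * Real.pi := by positivity
  have hscale : Measure.QuasiMeasurePreserving (fun ζ : SpaceTime => (2 * Real.pi) • ζ)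
      volume volume := by
    refine ⟨by fun_prop, ?_⟩
    rw [Measure.map_addHaar_smul volume hpi.ne']
    exact Measure.smul_absolutelyContinuous
  have hsupp : ∀ᵐ ζ : SpaceTime, R < ‖(2 * Real.pi) • ζ‖ → (𝓕 u : L2) ζ = 0 := by
    filter_upwards [hscale.ae hu] with ζ hζ hlt
    have h0 := hζ fun hmem => absurd (hR _ hmem) (not_le.mpr hlt)
    unfold hatL2 at h0
    rw [inv_smul_smul₀ hpi.ne'] at h0
    refine (mul_eq_zero.mp h0).resolve_left ?_
    have : (0 : ℝ) < (2 * Real.pi) ^ (-(3 / 2) : ℝ) := Real.rpow_pos_of_pos hpi _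
    exact_mod_cast this.ne'
  set g : SpaceTime → ℂ := fun ζ => ((inner ℝ ζ e : ℝ) : ℂ) with hg
  have hgt : g.HasTemperateGrowth := by rw [hg]; fun_prop
  have hmem : MemLp (fun ζ => g ζ * (𝓕 u : L2) ζ) 2 volume := by
    refine MemLp.of_le_mul (c := R * (2 * Real.pi)⁻¹ * ‖e‖) (Lp.memLp (𝓕 u : L2))
      (hgt.1.continuous.aestronglyMeasurable.mul (Lp.aestronglyMeasurable _)) ?_
    filter_upwards [hsupp] with ζ hζ
    by_cases hlt : R < ‖(2 * Real.pi) • ζ‖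
    · simp [hζ hlt]
    · rw [norm_mul]
      refine mul_le_mul_of_nonneg_right ?_ (norm_nonneg _)
      rw [not_lt, norm_smul, Real.norm_of_nonneg hpi.le] at hlt
      have h1 : ‖ζ‖ ≤ R * (2 * Real.pi)⁻¹ := by
        rw [← div_eq_mul_inv, le_div_iff₀ hpi]; linarith
      calc ‖g ζ‖ = |inner ℝ ζ e| := by simp [hg]
        _ ≤ ‖ζ‖ * ‖e‖ := abs_real_inner_le_norm _ _
        _ ≤ _ := mul_le_mul_of_nonneg_right h1 (norm_nonneg _)
  refine ⟨𝓕⁻ ((2 * Real.pi * Complex.I) • hmem.toLp _), ?_⟩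
  have hinj : Function.Injective (𝓕 : 𝓢'(SpaceTime, ℂ) → 𝓢'(SpaceTime, ℂ)) :=
    Function.LeftInverse.injective (g := 𝓕⁻) fun f => fourierInv_fourier_eq f
  apply hinj
  rw [Lp.fourier_toTemperedDistribution_eq, fourier_fourierInv_eq,
    TemperedDistribution.fourier_lineDerivOp_eq, Lp.fourier_toTemperedDistribution_eq]
  ext φ
  rw [show TemperedDistribution.smulLeftCLM ℂ (fun x : SpaceTime => ((inner ℝ x e : ℝ) : ℂ)) =
    TemperedDistribution.smulLeftCLM ℂ g from rfl]
  rw [Lp.toTemperedDistribution_apply, smul_apply,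
    TemperedDistribution.smulLeftCLM_apply_apply, Lp.toTemperedDistribution_apply,
    ← integral_smul]
  refine integral_congr_ae ?_
  filter_upwards [Lp.coeFn_smul (2 * Real.pi * Complex.I) (hmem.toLp _), hmem.coeFn_toLp]
    with ζ h1 h2
  rw [h1, Pi.smul_apply, h2, SchwartzMap.smulLeftCLM_apply_apply hgt]
  simp only [smul_eq_mul]
  ring

/-- The bilinear form `B(u,v) = ∑ c_{ab} ∂_a u ∂_b v`. -/
def bilin (c : Fin 2 → Fin 2 → ℂ) (u v : L2) (z : SpaceTime) : ℂ :=
  ∑ a, ∑ b, c a b * partialDeriv a u z * partialDeriv b v z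

/-- The estimate `‖B(u,v)‖_{X^{0,-1/2}_{k,d₃}} ≤ K ‖u‖_{𝒟X^{0,1/2}_{i,d₁}} ‖v‖_{X^{0,1/2}_{j,d₂}}`,
for `B(u,v)` and for its variants `B(ū,v)` and `B(u,v̄)`. On the left only the part of the bilinear
form with Fourier transform in `A_{k,d₃}` is measured. Products of two `L²` functions are
integrable, so their Fourier transforms are given by the integral; this is part of the claim. -/
def BilinearEstimate (φ₀ : ℝ → ℝ) (c : Fin 2 → Fin 2 → ℂ) (i : ℕ) (d₁ : ℝ) (j : ℕ) (d₂ : ℝ)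
    (k : ℕ) (d₃ : ℝ) (K : ℝ) : Prop :=
  ∀ u v : L2, FourierSupportedIn u (region φ₀ i d₁) → FourierSupportedIn v (region φ₀ j d₂) →
    ∀ g ∈ ({bilin c u v, bilin c (star u) v, bilin c u (star v)} : Set (SpaceTime → ℂ)),
      Integrable g ∧
        xNormOn 0 (-(1 / 2)) (region φ₀ k d₃) g ≤
          ENNReal.ofReal K * decayXNorm 0 i d₁ u * xNorm 0 (1 / 2) v

end DNLS

end

noncomputable section

namespace DNLS

/-! ### The Fourier transform on `L¹ ∩ L²` -/

/-! Write `N = 2^i`, `J = 2^j` and `M₁`, `M₂`, `M₃` for the modulation sizes `2^i d₁`, `2^j d₂` and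
`2^j d₃` (`2^k d₃` in c)). On the regions the weights are powers of these numbers, so everything
reduces to unweighted `L²` bounds with the factor `√(M₁ M₂ M₃)` (`bilinearEstimate_of_localized`).
Conjugating a factor only replaces the paraboloid `τ = |ξ|²` by `τ = -|ξ|²`. All bounds are
therefore proved for arbitrary signs `σ₁`, `σ₂`, and the three variants of `B` are treated together.

Low-high interactions with output near the paraboloid. The output frequencies are cut into squares
of side `N`. Since `u` has frequencies `≲ N`, each square only sees the part of `v` near it, so the
pieces are almost orthogonal (`exists_low_high_estimate`). For one square, let `e` be its direction
from the origin: all high frequencies involved are `≳ J` along `e` and `≲ N` across it. By duality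
it suffices to bound a trilinear integral over `u`, `v` and a test function `h`
(`exists_core_estimate`). Cut-offs at the physical scale `N`, along `e` (parameter `y₁`) and across
`e` (parameter `y₂`), are inserted in this integral. Their Fourier transforms live at frequencies `≤
1/N`, which disturbs the modulation of `u`, and for the transverse cut-off also those of `v` and
`h`, only by `O(1)`. Two gains are available: - transversality: the product of `u` and `v` gains `(N
M₁ M₂ / J)^{1/2}` (`volume_low_high_le`); - local smoothing: cutting `h` off along `e` gains `(N M₃
/ J)^{1/2}` (`volume_line_high_le`). With the derivative `N` on `u` and `J` on `v` the total is `N²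
√(M₁ M₂ M₃)`. For fixed `y₂` only `u` depends on `y₁`, and its integral in `y₁` is an `ℓ¹` sum over
squares along a line, that is, the decay norm (`lintegral_eLpNorm_cutoff_le`). The integral in `y₂`
is closed by Cauchy–Schwarz between `v` and `h`.

If the output is far from the paraboloid then `M₃ ≳ J²`, and in b) also `M₁ ≳ N²`. Cauchy–Schwarz
with the volume `≲ N⁴` of the support of `û` is then enough (`exists_low_high_bound`).

High-high interactions use no decay (`high_high_bound`). With `K = 2^k` and `M₃ ≳ K²`,
Cauchy–Schwarz over the small output region suffices, using that the translated support of `v̂`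
meets that region in volume `≲ K³ M₂ / J`, or simply that the region has volume `≲ K⁴` when `M₂ ≳
J²`. -/

theorem integral_fourier_mul_eq (f g : SpaceTime → ℂ) (hf : Integrable f) (hg : Integrable g) :
    ∫ x, 𝓕 f x * g x = ∫ x, f x * 𝓕 g x := by
  simpa using! VectorFourier.integral_fourierIntegral_smul_eq_flip (L := innerₗ SpaceTime)
    (μ := volume) (ν := volume) Real.continuous_fourierChar continuous_inner hf hg

theorem integral_fourierInv_mul_eq (f g : SpaceTime → ℂ) (hf : Integrable f) (hg : Integrable g) :
    ∫ x, 𝓕⁻ f x * g x = ∫ x, f x * 𝓕⁻ g x := by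
  rw [← integral_neg_eq_self (fun x => f x * _)]
  have := integral_fourier_mul_eq (fun x => f (-x)) g hf.comp_neg hg
  rw [Real.fourierInv_eq_fourier_comp_neg f]
  simpa only [Real.fourierInv_eq_fourier_neg, neg_neg] using this

/-- On `L²` the transform is characterized through tempered distributions. Testing against smooth
compactly supported functions and moving the integral transform onto the test function identifies
the two. -/
theorem fourier_toLp_ae {f : SpaceTime → ℂ} (h1 : Integrable f) (h2 : MemLp f 2) :
    (𝓕 (h2.toLp f) : L2) =ᵐ[volume] 𝓕 f := by
  have hcont : Continuous (𝓕 f) :=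
    VectorFourier.fourierIntegral_continuous Real.continuous_fourierChar
      (by exact continuous_inner) h1
  refine ae_eq_of_integral_contDiff_smul_eq
    ((Lp.memLp _).locallyIntegrable one_le_two) hcont.locallyIntegrable ?_
  intro g hg hgc
  have hg₁ : HasCompactSupport (Complex.ofRealCLM ∘ g) := hgc.comp_left rfl
  have hg₂ : ContDiff ℝ ∞ (Complex.ofRealCLM ∘ g) := by fun_prop
  set φ : 𝓢(SpaceTime, ℂ) := hg₁.toSchwartzMap hg₂ with hφ
  have hφg : ∀ x, φ x = (g x : ℂ) := fun x => rfl
  have key := congrArg (fun T : 𝓢'(SpaceTime, ℂ) => T φ)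
    (Lp.fourier_toTemperedDistribution_eq (h2.toLp f))
  simp only [TemperedDistribution.fourier_apply, Lp.toTemperedDistribution_apply] at key
  have hs : ∀ F : SpaceTime → ℂ, ∫ x, g x • F x = ∫ x, φ x • F x := fun F => by
    refine integral_congr_ae (.of_forall fun x => ?_)
    simp [hφg]
  rw [hs, ← key, hs]
  have h3 : ∫ x, (𝓕 φ) x • (h2.toLp f) x = ∫ x, 𝓕 (φ : SpaceTime → ℂ) x * f x := by
    refine integral_congr_ae ?_
    filter_upwards [h2.coeFn_toLp] with x hx
    rw [hx, SchwartzMap.fourier_coe, smul_eq_mul]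
  rw [h3, integral_fourier_mul_eq _ _ φ.integrable h1]
  rfl

theorem fourierInv_toLp_ae {f : SpaceTime → ℂ} (h1 : Integrable f) (h2 : MemLp f 2) :
    (𝓕⁻ (h2.toLp f) : L2) =ᵐ[volume] 𝓕⁻ f := by
  have hcont : Continuous (𝓕⁻ f) := by
    have : Continuous (𝓕 f) :=
      VectorFourier.fourierIntegral_continuous Real.continuous_fourierChar
        (by exact continuous_inner) h1
    have h := this.comp continuous_neg
    refine h.congr fun x => ?_
    simp [Real.fourierInv_eq_fourier_neg]
  refine ae_eq_of_integral_contDiff_smul_eq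
    ((Lp.memLp _).locallyIntegrable one_le_two) hcont.locallyIntegrable ?_
  intro g hg hgc
  have hg₁ : HasCompactSupport (Complex.ofRealCLM ∘ g) := hgc.comp_left rfl
  have hg₂ : ContDiff ℝ ∞ (Complex.ofRealCLM ∘ g) := by fun_prop
  set φ : 𝓢(SpaceTime, ℂ) := hg₁.toSchwartzMap hg₂ with hφ
  have hφg : ∀ x, φ x = (g x : ℂ) := fun x => rfl
  have key := congrArg (fun T : 𝓢'(SpaceTime, ℂ) => T φ)
    (Lp.fourierInv_toTemperedDistribution_eq (h2.toLp f))
  simp only [TemperedDistribution.fourierInv_apply, Lp.toTemperedDistribution_apply] at key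
  have hs : ∀ F : SpaceTime → ℂ, ∫ x, g x • F x = ∫ x, φ x • F x := fun F => by
    refine integral_congr_ae (.of_forall fun x => ?_)
    simp [hφg]
  rw [hs, ← key, hs]
  have h3 : ∫ x, (𝓕⁻ φ) x • (h2.toLp f) x = ∫ x, 𝓕⁻ (φ : SpaceTime → ℂ) x * f x := by
    refine integral_congr_ae ?_
    filter_upwards [h2.coeFn_toLp] with x hx
    rw [hx, SchwartzMap.fourierInv_coe, smul_eq_mul]
  rw [h3, integral_fourierInv_mul_eq _ _ φ.integrable h1]
  rfl

/-! ### The angular-frequency transform -/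

/-- The normalizing constant `(2π)^(-3/2)`. -/
def angularConst : ℝ := (2 * Real.pi) ^ (-(3 / 2) : ℝ)

theorem angularConst_pos : 0 < angularConst := Real.rpow_pos_of_pos (by positivity) _

theorem angularConst_sq : angularConst ^ 2 = ((2 * Real.pi) ^ 3)⁻¹ := by
  have h : (0 : ℝ) ≤ 2 * Real.pi := by positivity
  rw [angularConst, ← Real.rpow_natCast, ← Real.rpow_mul h, ← Real.rpow_natCast (2 * Real.pi) 3,
    ← Real.rpow_neg h]
  norm_num

theorem angularConst_le_one : angularConst ≤ 1 := by
  refine Real.rpow_le_one_of_one_le_of_nonpos ?_ (by norm_num)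
  linarith [Real.pi_gt_three]

theorem hatL1_eq_integral (g : SpaceTime → ℂ) (ζ : SpaceTime) :
    hatL1 g ζ = angularConst * ∫ z, Complex.exp (-(inner ℝ z ζ : ℝ) * Complex.I) * g z := by
  unfold hatL1
  rw [Real.fourier_eq']
  congr 1
  refine integral_congr_ae (.of_forall fun z => ?_)
  simp only [smul_eq_mul]
  congr 2
  rw [inner_smul_right]
  push_cast
  have : (Real.pi : ℂ) ≠ 0 := by exact_mod_cast Real.pi_ne_zero
  field_simp

theorem hatL1_congr {f g : SpaceTime → ℂ} (h : f =ᵐ[volume] g) : hatL1 f = hatL1 g := by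
  ext ζ
  rw [hatL1_eq_integral, hatL1_eq_integral]
  congr 1
  refine integral_congr_ae ?_
  filter_upwards [h] with z hz
  rw [hz]

/-- The inverse of `hatL1`: `(2π)^(-3/2) ∫ exp(i z·ζ) f(ζ) dζ`. -/
def synth (f : SpaceTime → ℂ) (z : SpaceTime) : ℂ := hatL1 f (-z)

theorem synth_eq_integral (f : SpaceTime → ℂ) (z : SpaceTime) :
    synth f z = angularConst * ∫ ζ, Complex.exp ((inner ℝ z ζ : ℝ) * Complex.I) * f ζ := by
  unfold synth
  rw [hatL1_eq_integral]
  simp [real_inner_comm]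

theorem continuous_hatL1 {g : SpaceTime → ℂ} (hg : Integrable g) : Continuous (hatL1 g) := by
  have : Continuous (𝓕 g) :=
    VectorFourier.fourierIntegral_continuous Real.continuous_fourierChar
      (by exact continuous_inner) hg
  unfold hatL1
  fun_prop

theorem continuous_synth {g : SpaceTime → ℂ} (hg : Integrable g) : Continuous (synth g) :=
  (continuous_hatL1 hg).comp continuous_neg

theorem finrank_spaceTime : Module.finrank ℝ SpaceTime = 3 := by simp

theorem hatL1_memLp {f : SpaceTime → ℂ} (h1 : Integrable f) (h2 : MemLp f 2) :
    MemLp (hatL1 f) 2 := by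
  have hF : MemLp (𝓕 f) 2 := (memLp_congr_ae (fourier_toLp_ae h1 h2)).1 (Lp.memLp _)
  have hpi : (2 * Real.pi)⁻¹ ≠ 0 := by positivity
  refine MemLp.const_mul (f := fun ζ => 𝓕 f ((2 * Real.pi)⁻¹ • ζ)) ?_ _
  have hm : Measurable fun ζ : SpaceTime => (2 * Real.pi)⁻¹ • ζ := by fun_prop
  refine MemLp.comp_of_map (g := 𝓕 f) ?_ hm.aemeasurable
  rw [Measure.map_addHaar_smul volume hpi]
  exact hF.smul_measure ENNReal.ofReal_ne_top

/-- Parseval's identity. -/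
theorem integral_hatL1_mul_conj {f g : SpaceTime → ℂ} (hf1 : Integrable f) (hf2 : MemLp f 2)
    (hg1 : Integrable g) (hg2 : MemLp g 2) :
    ∫ ζ, hatL1 f ζ * star (hatL1 g ζ) = ∫ z, f z * star (g z) := by
  have h0 : ∫ ζ, 𝓕 f ζ * star (𝓕 g ζ) = ∫ z, f z * star (g z) := by
    have := Lp.inner_fourier_eq (hg2.toLp g) (hf2.toLp f)
    rw [L2.inner_def, L2.inner_def] at this
    refine Eq.trans (integral_congr_ae ?_) (this.trans (integral_congr_ae ?_))
    · filter_upwards [fourier_toLp_ae hf1 hf2, fourier_toLp_ae hg1 hg2] with x h1 h2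
      rw [h1, h2]; simp
    · filter_upwards [hf2.coeFn_toLp, hg2.coeFn_toLp] with x h1 h2
      rw [h1, h2]; simp
  have hpi : (0:ℝ) < 2 * Real.pi := by positivity
  have h1 : ∀ ζ, hatL1 f ζ * star (hatL1 g ζ) = ((angularConst ^ 2 : ℝ) : ℂ) *
      (fun η => 𝓕 f η * star (𝓕 g η)) ((2 * Real.pi)⁻¹ • ζ) := fun ζ => by
    simp only [hatL1, angularConst, star_mul', Complex.star_def, Complex.conj_ofReal]
    push_cast
    ring
  simp_rw [h1]
  rw [integral_const_mul, Measure.integral_comp_inv_smul_of_nonneg volume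
    (fun η => 𝓕 f η * star (𝓕 g η)) hpi.le, h0,
    finrank_spaceTime, angularConst_sq, Complex.real_smul, ← mul_assoc, ← Complex.ofReal_mul,
    inv_mul_cancel₀ (by positivity), Complex.ofReal_one, one_mul]

/-- Plancherel's identity. -/
theorem eLpNorm_hatL1 {f : SpaceTime → ℂ} (h1 : Integrable f) (h2 : MemLp f 2) :
    eLpNorm (hatL1 f) 2 volume = eLpNorm f 2 volume := by
  have hn : ∀ F : SpaceTime → ℂ, MemLp F 2 → ∫ z, F z * star (F z) =
      (((eLpNorm F 2 volume).toReal ^ 2 : ℝ) : ℂ) := fun F hF => by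
    have := L2.inner_def (𝕜 := ℂ) (hF.toLp F) (hF.toLp F)
    rw [inner_self_eq_norm_sq_to_K, Lp.norm_toLp] at this
    push_cast
    refine Eq.trans (integral_congr_ae ?_) this.symm
    filter_upwards [hF.coeFn_toLp] with x h1
    rw [h1, RCLike.inner_apply, Complex.star_def]
  have h3 := hatL1_memLp h1 h2
  have := integral_hatL1_mul_conj h1 h2 h1 h2
  rw [hn _ h3, hn _ h2] at this
  have h4 : (eLpNorm (hatL1 f) 2 volume).toReal ^ 2 = (eLpNorm f 2 volume).toReal ^ 2 := by
    exact_mod_cast this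
  rw [sq_eq_sq₀ ENNReal.toReal_nonneg ENNReal.toReal_nonneg,
    ENNReal.toReal_eq_toReal_iff' h3.2.ne h2.2.ne] at h4
  exact h4

end DNLS

end

noncomputable section

namespace DNLS

/-! ### Band-limited functions -/

/-- Square integrable functions of bounded support (used as Fourier transforms). -/
structure Band (f : SpaceTime → ℂ) : Prop where
  measurable : Measurable f
  memLp : MemLp f 2
  bounded : ∃ R, ∀ ζ, f ζ ≠ 0 → ‖ζ‖ ≤ R

theorem Band.integrable {f : SpaceTime → ℂ} (hf : Band f) : Integrable f := by
  obtain ⟨R, hR⟩ := hf.bounded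
  rw [← integrableOn_iff_integrable_of_support_subset (s := Metric.closedBall 0 R)
    fun ζ hζ => by simpa using hR ζ hζ]
  have : IsFiniteMeasure (volume.restrict (Metric.closedBall (0 : SpaceTime) R)) :=
    ⟨by
      rw [Measure.restrict_apply_univ]
      exact measure_closedBall_lt_top⟩
  exact (hf.memLp.restrict _).integrable one_le_two

theorem Band.synth_memLp {f : SpaceTime → ℂ} (hf : Band f) : MemLp (synth f) 2 :=
  (hatL1_memLp hf.integrable hf.memLp).comp_measurePreserving
    (Measure.measurePreserving_neg (volume : Measure SpaceTime))

theorem Band.eLpNorm_synth {f : SpaceTime → ℂ} (hf : Band f) :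
    eLpNorm (synth f) 2 volume = eLpNorm f 2 volume := by
  rw [← eLpNorm_hatL1 hf.integrable hf.memLp]
  exact eLpNorm_comp_measurePreserving
    (hatL1_memLp hf.integrable hf.memLp).1 (Measure.measurePreserving_neg _)

theorem Band.continuous_synth {f : SpaceTime → ℂ} (hf : Band f) : Continuous (synth f) :=
  DNLS.continuous_synth hf.integrable

theorem norm_hatL1_le {f : SpaceTime → ℂ} (z : SpaceTime) : ‖hatL1 f z‖ ≤ ∫ ζ, ‖f ζ‖ := by
  rw [hatL1_eq_integral, norm_mul, Complex.norm_real, Real.norm_of_nonneg angularConst_pos.le]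
  have h : ‖∫ ζ, Complex.exp (-(inner ℝ ζ z : ℝ) * Complex.I) * f ζ‖ ≤ ∫ ζ, ‖f ζ‖ := by
    refine (norm_integral_le_integral_norm _).trans_eq (integral_congr_ae (.of_forall fun ζ => ?_))
    simp only [norm_mul]
    rw [← Complex.ofReal_neg, Complex.norm_exp_ofReal_mul_I, one_mul]
  calc _ ≤ 1 * ∫ ζ, ‖f ζ‖ :=
        mul_le_mul angularConst_le_one h (norm_nonneg _) zero_le_one
    _ = _ := one_mul _

theorem Band.synth_mul_memLp {f g : SpaceTime → ℂ} (hf : Band f) (hg : Band g) :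
    MemLp (fun z => synth f z * synth g z) 2 := by
  refine MemLp.of_le_mul (c := ∫ ζ, ‖f ζ‖) hg.synth_memLp
    (hf.continuous_synth.mul hg.continuous_synth).aestronglyMeasurable (.of_forall fun z => ?_)
  rw [norm_mul]
  exact mul_le_mul_of_nonneg_right (norm_hatL1_le _) (norm_nonneg _)

theorem Band.synth_mul_integrable {f g : SpaceTime → ℂ} (hf : Band f) (hg : Band g) :
    Integrable (fun z => synth f z * synth g z) :=
  hf.synth_memLp.integrable_mul hg.synth_memLp

theorem Band.conj_reflect {g : SpaceTime → ℂ} (hg : Band g) (ζ : SpaceTime) :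
    Band (fun η => star (g (ζ - η))) := by
  refine ⟨?_, ?_, ?_⟩
  · exact continuous_star.measurable.comp
      (hg.measurable.comp (measurable_const.sub measurable_id))
  · exact (hg.memLp.comp_measurePreserving
      (Measure.measurePreserving_sub_left (volume : Measure SpaceTime) ζ)).star
  · obtain ⟨R, hR⟩ := hg.bounded
    refine ⟨‖ζ‖ + R, fun η hη => ?_⟩
    have := hR (ζ - η) fun h => hη (by simp [h])
    calc ‖η‖ = ‖ζ - (ζ - η)‖ := by simp
      _ ≤ ‖ζ‖ + ‖ζ - η‖ := norm_sub_le _ _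
      _ ≤ _ := by gcongr

/-- Turns the convolution `∫ f(η) g(ζ - η) dη` into an `L²` pairing of `f` with a band-limited
function, to which Parseval's identity applies. At `ζ = 0` it gives the Fourier side of complex
conjugation. -/
theorem synth_conj_reflect (g : SpaceTime → ℂ) (ζ z : SpaceTime) :
    synth (fun η => star (g (ζ - η))) z =
      Complex.exp ((inner ℝ z ζ : ℝ) * Complex.I) * star (synth g z) := by
  rw [synth_eq_integral, synth_eq_integral]
  rw [← integral_sub_left_eq_self (fun η => Complex.exp ((inner ℝ z η : ℝ) * Complex.I) *
    star (g (ζ - η))) volume ζ]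
  simp only [sub_sub_cancel, star_mul', Complex.star_def, Complex.conj_ofReal]
  have hc := integral_conj (μ := (volume : Measure SpaceTime))
    (f := fun η => Complex.exp ((inner ℝ z η : ℝ) * Complex.I) * g η)
  rw [← hc, mul_left_comm (Complex.exp _)]
  refine congrArg _ ?_
  rw [← integral_const_mul]
  refine integral_congr_ae (.of_forall fun η => ?_)
  simp only [map_mul, ← Complex.exp_conj, Complex.conj_ofReal, Complex.conj_I]
  rw [← mul_assoc, ← Complex.exp_add, inner_sub_right]
  congr 2
  push_cast
  ring

/-- The Fourier transform of a product of band-limited functions is a convolution. -/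
theorem hatL1_synth_mul {f g : SpaceTime → ℂ} (hf : Band f) (hg : Band g) (ζ : SpaceTime) :
    hatL1 (fun z => synth f z * synth g z) ζ = angularConst * ∫ η, f η * g (ζ - η) := by
  rw [hatL1_eq_integral]
  congr 1
  -- Parseval for `f` and `η ↦ conj (g (ζ - η))`; the reflection `z ↦ -z` turns `hatL1` into
  -- `synth`.
  have hG := hg.conj_reflect ζ
  have := integral_hatL1_mul_conj hf.integrable hf.memLp hG.integrable hG.memLp
  rw [← integral_neg_eq_self] at this
  simp only [star_star] at this
  rw [← this]
  refine integral_congr_ae (.of_forall fun z => ?_)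
  change _ = synth f z * star (synth (fun η => star (g (ζ - η))) z)
  rw [synth_conj_reflect]
  simp only [star_mul', star_star]
  simp only [Complex.star_def, ← Complex.exp_conj, map_mul, Complex.conj_ofReal, Complex.conj_I]
  rw [neg_mul, mul_neg]
  ring

theorem eLpNorm_hatL1_synth_mul {f g : SpaceTime → ℂ} (hf : Band f) (hg : Band g) :
    eLpNorm (hatL1 fun z => synth f z * synth g z) 2 volume =
      eLpNorm (fun z => synth f z * synth g z) 2 volume :=
  eLpNorm_hatL1 (hf.synth_mul_integrable hg) (hf.synth_mul_memLp hg)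

/-! ### Functions in `L²` with bounded Fourier support -/

/-- The rescaling which turns `synth` into Mathlib's inverse Fourier transform. -/
def unscale (f : SpaceTime → ℂ) (η : SpaceTime) : ℂ :=
  (angularConst⁻¹ : ℝ) * f ((2 * Real.pi) • η)

theorem Band.unscale_integrable {f : SpaceTime → ℂ} (hf : Band f) : Integrable (unscale f) :=
  (hf.integrable.comp_smul (by positivity)).const_mul _

theorem quasiMeasurePreserving_smul {r : ℝ} (hr : r ≠ 0) :
    Measure.QuasiMeasurePreserving (fun ζ : SpaceTime => r • ζ) volume volume := by
  refine ⟨by fun_prop, ?_⟩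
  rw [Measure.map_addHaar_smul volume hr]
  exact Measure.smul_absolutelyContinuous

theorem Band.unscale_memLp {f : SpaceTime → ℂ} (hf : Band f) : MemLp (unscale f) 2 := by
  have hpi : 2 * Real.pi ≠ 0 := by positivity
  refine MemLp.const_mul (f := fun ζ => f ((2 * Real.pi) • ζ)) ?_ _
  refine MemLp.comp_of_map (g := f) ?_ (by fun_prop)
  rw [Measure.map_addHaar_smul volume hpi]
  exact hf.memLp.smul_measure ENNReal.ofReal_ne_top

theorem fourierInv_unscale (f : SpaceTime → ℂ) : 𝓕⁻ (unscale f) = synth f := by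
  ext z
  have hpi : (0 : ℝ) < 2 * Real.pi := by positivity
  rw [synth_eq_integral, Real.fourierInv_eq']
  have h : ∀ η : SpaceTime, Complex.exp (↑(2 * Real.pi * inner ℝ η z) * Complex.I) • unscale f η =
      (angularConst⁻¹ : ℝ) * (fun ζ => Complex.exp ((inner ℝ z ζ : ℝ) * Complex.I) * f ζ)
        ((2 * Real.pi) • η) := fun η => by
    simp only [unscale, smul_eq_mul]
    rw [inner_smul_right, real_inner_comm]
    ring
  simp_rw [h]
  rw [integral_const_mul, Measure.integral_comp_smul_of_nonneg volume
    (fun ζ => Complex.exp ((inner ℝ z ζ : ℝ) * Complex.I) * f ζ) _ (hR := hpi.le),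
    finrank_spaceTime, ← angularConst_sq, Complex.real_smul, ← mul_assoc, ← Complex.ofReal_mul]
  congr 2
  have := angularConst_pos.ne'
  field_simp

theorem Band.eq_fourierInv {u : L2} {f : SpaceTime → ℂ} (hf : Band f)
    (hu : u =ᵐ[volume] synth f) : u = 𝓕⁻ (hf.unscale_memLp.toLp (unscale f)) := by
  refine Lp.ext (hu.trans ?_)
  rw [← fourierInv_unscale]
  exact (fourierInv_toLp_ae hf.unscale_integrable hf.unscale_memLp).symm

theorem Band.hatL2_ae {u : L2} {f : SpaceTime → ℂ} (hf : Band f) (hu : u =ᵐ[volume] synth f) :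
    hatL2 u =ᵐ[volume] f := by
  have h : (𝓕 u : L2) = hf.unscale_memLp.toLp (unscale f) := by
    rw [hf.eq_fourierInv hu, fourier_fourierInv_eq]
  have hpi : (2 * Real.pi) ≠ 0 := by positivity
  have h2 := (quasiMeasurePreserving_smul (inv_ne_zero hpi)).ae hf.unscale_memLp.coeFn_toLp
  filter_upwards [h2] with ζ hζ
  rw [hatL2, h, hζ, unscale, smul_inv_smul₀ hpi, ← mul_assoc]
  change ((angularConst : ℝ) : ℂ) * _ * _ = _
  rw [← Complex.ofReal_mul, mul_inv_cancel₀ angularConst_pos.ne', Complex.ofReal_one, one_mul]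

theorem measurable_hatL2 (u : L2) : Measurable (hatL2 u) := by
  have := (Lp.stronglyMeasurable (𝓕 u : L2)).measurable
  unfold hatL2
  fun_prop

/-- A function with Fourier support in a bounded set is the inverse Fourier transform of a
band-limited function. -/
theorem exists_band {u : L2} {A : Set SpaceTime} (hA : MeasurableSet A)
    (hb : Bornology.IsBounded A) (hu : FourierSupportedIn u A) :
    Band (A.indicator (hatL2 u)) ∧ u =ᵐ[volume] synth (A.indicator (hatL2 u)) ∧
      A.indicator (hatL2 u) =ᵐ[volume] hatL2 u := by
  have hpi : (2 * Real.pi) ≠ 0 := by positivity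
  have hae : A.indicator (hatL2 u) =ᵐ[volume] hatL2 u := by
    filter_upwards [hu] with ζ hζ
    by_cases h : ζ ∈ A
    · simp [h]
    · simp [h, hζ h]
  have hmem : MemLp (hatL2 u) 2 := by
    refine MemLp.const_mul (f := fun ζ => (𝓕 u : L2) ((2 * Real.pi)⁻¹ • ζ)) ?_ _
    refine MemLp.comp_of_map (g := (𝓕 u : L2)) ?_ (by fun_prop)
    rw [Measure.map_addHaar_smul volume (inv_ne_zero hpi)]
    exact (Lp.memLp _).smul_measure ENNReal.ofReal_ne_top
  have hband : Band (A.indicator (hatL2 u)) := by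
    refine ⟨(measurable_hatL2 u).indicator hA, hmem.indicator hA, ?_⟩
    obtain ⟨R, hR⟩ := hb.exists_norm_le
    exact ⟨R, fun ζ hζ => hR _ (Set.mem_of_indicator_ne_zero hζ)⟩
  refine ⟨hband, ?_, hae⟩
  have h2 : (𝓕 u : L2) = hband.unscale_memLp.toLp _ := by
    refine Lp.ext ?_
    filter_upwards [(quasiMeasurePreserving_smul hpi).ae hae, hband.unscale_memLp.coeFn_toLp]
      with η h1 h2
    rw [h2, unscale, h1, hatL2, inv_smul_smul₀ hpi, ← mul_assoc]
    change _ = _ * ((angularConst : ℝ) : ℂ) * _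
    rw [← Complex.ofReal_mul, inv_mul_cancel₀ angularConst_pos.ne', Complex.ofReal_one, one_mul]
  have h3 : u = 𝓕⁻ (hband.unscale_memLp.toLp _) := by rw [← h2, fourierInv_fourier_eq]
  have h4 := fourierInv_toLp_ae hband.unscale_integrable hband.unscale_memLp
  rw [fourierInv_unscale, ← h3] at h4
  exact h4

/-- Multiplication by the Fourier symbol of `∂_a`. -/
def symb (a : Fin 2) (f : SpaceTime → ℂ) (ζ : SpaceTime) : ℂ := Complex.I * (ζ (sp a) : ℝ) * f ζ

theorem norm_coord_le (ζ : SpaceTime) (a : Fin 3) : |ζ a| ≤ ‖ζ‖ := PiLp.norm_apply_le ζ a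

theorem Band.symb {f : SpaceTime → ℂ} (hf : Band f) (a : Fin 2) : Band (symb a f) := by
  obtain ⟨R, hR⟩ := hf.bounded
  have hm : Measurable (DNLS.symb a f) := by
    have := hf.measurable
    unfold DNLS.symb
    fun_prop
  refine ⟨hm, ?_, ?_⟩
  · refine MemLp.of_le_mul (c := R) hf.memLp hm.aestronglyMeasurable (.of_forall fun ζ => ?_)
    by_cases h : f ζ = 0
    · simp [DNLS.symb, h]
    · simp only [DNLS.symb, norm_mul, Complex.norm_I, one_mul, Complex.norm_real, Real.norm_eq_abs]
      exact mul_le_mul_of_nonneg_right ((norm_coord_le ζ _).trans (hR ζ h)) (norm_nonneg _)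
  · exact ⟨R, fun ζ hζ => hR ζ fun h => hζ (by simp [DNLS.symb, h])⟩

theorem Lp_toTemperedDistribution_injective {u v : L2}
    (h : (u : 𝓢'(SpaceTime, ℂ)) = (v : 𝓢'(SpaceTime, ℂ))) : u = v := by
  have hk := Lp.ker_toTemperedDistributionCLM_eq_bot (E := SpaceTime) (F := ℂ) (μ := volume)
    (p := 2)
  exact LinearMap.ker_eq_bot.1 hk h

/-- On the Fourier side `∂_a` is multiplication by `iξ_a`. -/
theorem Band.partialDeriv_ae {u : L2} {f : SpaceTime → ℂ} (hf : Band f)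
    (hu : u =ᵐ[volume] synth f) (a : Fin 2) :
    partialDeriv a u =ᵐ[volume] synth (DNLS.symb a f) := by
  obtain ⟨R, hR⟩ := hf.bounded
  have hsupp : FourierSupportedIn u (Metric.closedBall 0 R) := by
    filter_upwards [hf.hatL2_ae hu] with ζ hζ hn
    by_contra h
    rw [hζ] at h
    exact hn (by simpa using hR ζ h)
  have hspec := partialDeriv_spec a u _ Metric.isBounded_closedBall hsupp
  set e : SpaceTime := EuclideanSpace.single (sp a) (1 : ℝ) with he
  set g : SpaceTime → ℂ := fun ζ => ((inner ℝ ζ e : ℝ) : ℂ) with hg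
  have hgt : g.HasTemperateGrowth := by rw [hg]; fun_prop
  have hge : ∀ ζ, g ζ = (ζ (sp a) : ℝ) := fun ζ => by simp [hg, he, EuclideanSpace.inner_single_right]
  have hs := hf.symb a
  have hU : (𝓕 u : L2) = hf.unscale_memLp.toLp (unscale f) := by
    rw [hf.eq_fourierInv hu, fourier_fourierInv_eq]
  have hw : partialDeriv a u = 𝓕⁻ (hs.unscale_memLp.toLp (unscale (DNLS.symb a f))) := by
    apply Lp_toTemperedDistribution_injective
    rw [hspec]
    have hinj : Function.Injective (𝓕 : 𝓢'(SpaceTime, ℂ) → 𝓢'(SpaceTime, ℂ)) :=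
      Function.LeftInverse.injective (g := 𝓕⁻) fun f => fourierInv_fourier_eq f
    apply hinj
    symm
    rw [Lp.fourier_toTemperedDistribution_eq, fourier_fourierInv_eq,
      TemperedDistribution.fourier_lineDerivOp_eq, Lp.fourier_toTemperedDistribution_eq]
    ext φ
    rw [show TemperedDistribution.smulLeftCLM ℂ (fun x : SpaceTime => ((inner ℝ x e : ℝ) : ℂ)) =
      TemperedDistribution.smulLeftCLM ℂ g from rfl]
    rw [Lp.toTemperedDistribution_apply, smul_apply,
      TemperedDistribution.smulLeftCLM_apply_apply, Lp.toTemperedDistribution_apply,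
      ← integral_smul, hU]
    refine integral_congr_ae ?_
    filter_upwards [hs.unscale_memLp.coeFn_toLp, hf.unscale_memLp.coeFn_toLp] with ζ h1 h2
    rw [h1, h2, SchwartzMap.smulLeftCLM_apply_apply hgt, hge]
    simp only [smul_eq_mul, unscale, DNLS.symb, PiLp.smul_apply]
    push_cast
    ring
  rw [hw, ← fourierInv_unscale]
  exact fourierInv_toLp_ae hs.unscale_integrable hs.unscale_memLp

theorem star_ae {u : L2} {f : SpaceTime → ℂ} (hu : u =ᵐ[volume] synth f) :
    (star u : L2) =ᵐ[volume] synth (fun ζ => star (f (-ζ))) := by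
  filter_upwards [Lp.coeFn_star u, hu] with z h1 h2
  have := synth_conj_reflect f 0 z
  simp only [zero_sub, inner_zero_right, Complex.ofReal_zero, zero_mul, Complex.exp_zero,
    one_mul] at this
  rw [h1, Pi.star_apply, h2, this]

end DNLS

end

noncomputable section

namespace DNLS

/-! ### Cauchy–Schwarz estimates for convolutions -/

/-- The square of the `L²` norm. -/
def nsq (f : SpaceTime → ℂ) : ℝ≥0∞ := ∫⁻ ζ, ‖f ζ‖ₑ ^ 2

theorem eLpNorm_two_sq {X : Type*} [MeasurableSpace X] (μ : Measure X) (f : X → ℂ) :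
    eLpNorm f 2 μ ^ 2 = ∫⁻ ζ, ‖f ζ‖ₑ ^ 2 ∂μ := by
  have := eLpNorm_nnreal_pow_eq_lintegral (f := f) (μ := μ) (p := 2) (by norm_num)
  simpa using this

theorem nsq_eq (f : SpaceTime → ℂ) : nsq f = eLpNorm f 2 volume ^ 2 :=
  (eLpNorm_two_sq volume f).symm

theorem lintegral_mul_sq_le {X : Type*} [MeasurableSpace X] (μ : Measure X) {f g : X → ℝ≥0∞}
    (hf : AEMeasurable f μ) (hg : AEMeasurable g μ) :
    (∫⁻ x, f x * g x ∂μ) ^ 2 ≤ (∫⁻ x, f x ^ 2 ∂μ) * ∫⁻ x, g x ^ 2 ∂μ := by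
  have := ENNReal.lintegral_mul_le_Lp_mul_Lq μ Real.HolderConjugate.two_two hf hg
  calc _ ≤ _ := pow_le_pow_left₀ zero_le this 2
    _ = _ := by
      rw [mul_pow, ← ENNReal.rpow_natCast, ← ENNReal.rpow_natCast, ← ENNReal.rpow_mul,
        ← ENNReal.rpow_mul]
      simp

/-- Cauchy–Schwarz for a function which vanishes off `T`. -/
theorem lintegral_sq_le_measure_mul {X : Type*} [MeasurableSpace X] (μ : Measure X)
    {h : X → ℝ≥0∞} (hh : Measurable h) {S : ℝ≥0∞} (hS : μ {x | h x ≠ 0} ≤ S) :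
    (∫⁻ x, h x ∂μ) ^ 2 ≤ S * ∫⁻ x, h x ^ 2 ∂μ := by
  have hT : MeasurableSet {x | h x ≠ 0} := hh (measurableSet_singleton 0).compl
  have := lintegral_mul_sq_le μ (f := {x | h x ≠ 0}.indicator 1) (g := h)
    (measurable_one.indicator hT).aemeasurable hh.aemeasurable
  have h1 : ∀ x, {x | h x ≠ 0}.indicator 1 x * h x = h x := fun x => by
    by_cases hx : h x = 0 <;> simp [hx]
  have h2 : ∫⁻ x, {x | h x ≠ 0}.indicator (1 : X → ℝ≥0∞) x ^ 2 ∂μ = μ {x | h x ≠ 0} := by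
    rw [← lintegral_indicator_one hT]
    congr 1
    ext x
    by_cases hx : h x = 0 <;> simp [hx]
  simp only [h1] at this
  rw [h2] at this
  exact this.trans (by gcongr)

/-- Closes duality arguments, where a quantity is tested against itself. Finiteness is essential:
for `X = ⊤` the hypothesis holds with every nonzero `K`. -/
theorem le_of_sq_le_mul_self {X K : ℝ≥0∞} (h : X ^ 2 ≤ K * X) (hX : X ≠ ⊤) : X ≤ K := by
  by_cases h0 : X = 0
  · simp [h0]
  · rw [sq] at h
    exact (ENNReal.mul_le_mul_iff_left h0 hX).1 h

theorem le_of_sq_le_sq {X Y : ℝ≥0∞} (h : X ^ 2 ≤ Y ^ 2) : X ≤ Y :=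
  (ENNReal.pow_le_pow_left_iff two_ne_zero).1 h

/-- The convolution of the absolute values. -/
def absConv (f g : SpaceTime → ℂ) (ζ : SpaceTime) : ℝ≥0∞ := ∫⁻ η, ‖f η‖ₑ * ‖g (ζ - η)‖ₑ

theorem measurable_absConv {f g : SpaceTime → ℂ} (hf : Measurable f) (hg : Measurable g) :
    Measurable (absConv f g) := by
  have : Measurable fun p : SpaceTime × SpaceTime => ‖f p.2‖ₑ * ‖g (p.1 - p.2)‖ₑ := by fun_prop
  exact this.lintegral_prod_right'

theorem enorm_hatL1_synth_mul_le {f g : SpaceTime → ℂ} (hf : Band f) (hg : Band g)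
    (ζ : SpaceTime) : ‖hatL1 (fun z => synth f z * synth g z) ζ‖ₑ ≤ absConv f g ζ := by
  rw [hatL1_synth_mul hf hg, enorm_mul]
  calc _ ≤ 1 * ∫⁻ η, ‖f η * g (ζ - η)‖ₑ := by
        refine mul_le_mul' ?_ (enorm_integral_le_lintegral_enorm _)
        rw [← ofReal_norm, Complex.norm_real, Real.norm_of_nonneg angularConst_pos.le]
        exact ENNReal.ofReal_le_one.2 angularConst_le_one
    _ = _ := by simp only [one_mul, enorm_mul, absConv]

theorem lintegral_absConv_sq {f g : SpaceTime → ℂ} (hf : Measurable f) (hg : Measurable g) :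
    ∫⁻ ζ, ∫⁻ η, (‖f η‖ₑ * ‖g (ζ - η)‖ₑ) ^ 2 = nsq f * nsq g := by
  have hm : Measurable fun p : SpaceTime × SpaceTime => (‖f p.2‖ₑ * ‖g (p.1 - p.2)‖ₑ) ^ 2 := by
    fun_prop
  rw [lintegral_lintegral_swap hm.aemeasurable]
  simp only [mul_pow]
  have : ∀ η, ∫⁻ ζ, ‖f η‖ₑ ^ 2 * ‖g (ζ - η)‖ₑ ^ 2 = ‖f η‖ₑ ^ 2 * nsq g := fun η => by
    rw [lintegral_const_mul _ (by fun_prop)]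
    congr 1
    exact lintegral_sub_right_eq_self (fun ζ => ‖g ζ‖ₑ ^ 2) η
  simp only [this]
  rw [lintegral_mul_const _ (by fun_prop)]
  rfl

/-- For each output `ζ` the convolution integral runs over a set of measure at most `S`, so
Cauchy–Schwarz costs a factor `S`; Fubini then separates `f` and `g`. -/
theorem nsq_hatL1_synth_mul_le {f g : SpaceTime → ℂ} (hf : Band f) (hg : Band g) {S : ℝ≥0∞}
    (hS : ∀ ζ, volume {η | f η ≠ 0 ∧ g (ζ - η) ≠ 0} ≤ S) :
    nsq (hatL1 fun z => synth f z * synth g z) ≤ S * (nsq f * nsq g) := by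
  have hfm := hf.measurable
  have hgm := hg.measurable
  calc _ ≤ ∫⁻ ζ, S * ∫⁻ η, (‖f η‖ₑ * ‖g (ζ - η)‖ₑ) ^ 2 := by
        refine lintegral_mono fun ζ => ?_
        refine (pow_le_pow_left₀ zero_le (enorm_hatL1_synth_mul_le hf hg ζ) 2).trans ?_
        refine lintegral_sq_le_measure_mul volume (by fun_prop) ?_
        simpa using hS ζ
    _ = _ := by
        have hm : Measurable fun p : SpaceTime × SpaceTime =>
            (‖f p.2‖ₑ * ‖g (p.1 - p.2)‖ₑ) ^ 2 := by fun_prop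
        rw [lintegral_const_mul _ hm.lintegral_prod_right', lintegral_absConv_sq hfm hgm]

theorem nsq_synth_mul_le {f g : SpaceTime → ℂ} (hf : Band f) (hg : Band g) {S : ℝ≥0∞}
    (hS : ∀ ζ, volume {η | f η ≠ 0 ∧ g (ζ - η) ≠ 0} ≤ S) :
    nsq (fun z => synth f z * synth g z) ≤ S * (nsq f * nsq g) := by
  rw [nsq_eq, ← eLpNorm_hatL1_synth_mul hf hg, ← nsq_eq]
  exact nsq_hatL1_synth_mul_le hf hg hS

/-- The dual form of the previous bound: now the outputs `ζ ∈ A` compatible with one input `η` are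
what is small. With `X` the integral of `absConv f g ^ 2` over `A`, Fubini and Cauchy–Schwarz, first
in `η` and then in `ζ`, give `X² ≤ S · nsq f · nsq g · X`. -/
theorem lintegral_hatL1_synth_mul_le {f g : SpaceTime → ℂ} (hf : Band f) (hg : Band g)
    {A : Set SpaceTime} (hA : MeasurableSet A) (hAv : volume A ≠ ⊤) {S : ℝ≥0∞}
    (hS : ∀ η, volume {ζ | ζ ∈ A ∧ g (ζ - η) ≠ 0} ≤ S) :
    ∫⁻ ζ in A, ‖hatL1 (fun z => synth f z * synth g z) ζ‖ₑ ^ 2 ≤ S * (nsq f * nsq g) := by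
  have hfm := hf.measurable
  have hgm := hg.measurable
  have hCm := measurable_absConv hfm hgm
  refine (lintegral_mono fun ζ =>
    pow_le_pow_left₀ zero_le (enorm_hatL1_synth_mul_le hf hg ζ) 2).trans ?_
  -- Needed to divide by `X`: the convolution is bounded by Cauchy–Schwarz, and `A` has finite
  -- volume.
  have hfin : ∫⁻ ζ in A, absConv f g ζ ^ 2 ≠ ⊤ := by
    refine ne_top_of_le_ne_top ?_ (lintegral_mono (g := fun _ => nsq f * nsq g) fun ζ => ?_)
    · rw [setLIntegral_const]
      refine ENNReal.mul_ne_top ?_ hAv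
      rw [nsq_eq, nsq_eq]
      exact ENNReal.mul_ne_top (ENNReal.pow_ne_top hf.memLp.2.ne)
        (ENNReal.pow_ne_top hg.memLp.2.ne)
    · refine (lintegral_mul_sq_le volume (by fun_prop) (by fun_prop)).trans_eq ?_
      congr 1
      exact lintegral_sub_left_eq_self (fun η => ‖g η‖ₑ ^ 2) ζ
  refine le_of_sq_le_mul_self ?_ hfin
  have hm : Measurable fun p : SpaceTime × SpaceTime =>
      absConv f g p.1 * (‖f p.2‖ₑ * ‖g (p.1 - p.2)‖ₑ) := by fun_prop
  have h1 : ∫⁻ ζ in A, absConv f g ζ ^ 2 =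
      ∫⁻ η, ‖f η‖ₑ * ∫⁻ ζ in A, ‖g (ζ - η)‖ₑ * absConv f g ζ := by
    calc _ = ∫⁻ ζ in A, ∫⁻ η, absConv f g ζ * (‖f η‖ₑ * ‖g (ζ - η)‖ₑ) := by
          refine lintegral_congr fun ζ => ?_
          rw [lintegral_const_mul _ (by fun_prop), sq]
          rfl
      _ = _ := by
          rw [lintegral_lintegral_swap hm.aemeasurable]
          refine lintegral_congr fun η => ?_
          rw [← lintegral_const_mul _ (by fun_prop)]
          refine lintegral_congr fun ζ => ?_
          ring
  have hm2 : Measurable fun p : SpaceTime × SpaceTime => ‖g (p.2 - p.1)‖ₑ * absConv f g p.2 := by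
    fun_prop
  have hm3 : Measurable fun p : SpaceTime × SpaceTime =>
      (‖g (p.2 - p.1)‖ₑ * absConv f g p.2) ^ 2 := by fun_prop
  calc _ ≤ nsq f * ∫⁻ η, (∫⁻ ζ in A, ‖g (ζ - η)‖ₑ * absConv f g ζ) ^ 2 := by
        rw [h1]
        exact lintegral_mul_sq_le volume (by fun_prop) hm2.lintegral_prod_right'.aemeasurable
    _ ≤ nsq f * ∫⁻ η, S * ∫⁻ ζ in A, (‖g (ζ - η)‖ₑ * absConv f g ζ) ^ 2 := by
        gcongr with η
        refine lintegral_sq_le_measure_mul _ (by fun_prop) ?_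
        rw [Measure.restrict_apply' hA]
        refine (measure_mono ?_).trans (hS η)
        rintro ζ ⟨h1, h2⟩
        exact ⟨h2, fun h => h1 (by simp [h])⟩
    _ = nsq f * (S * (nsq g * ∫⁻ ζ in A, absConv f g ζ ^ 2)) := by
        rw [lintegral_const_mul _ hm3.lintegral_prod_right',
          lintegral_lintegral_swap hm3.aemeasurable]
        congr 2
        have : ∀ ζ, ∫⁻ η, (‖g (ζ - η)‖ₑ * absConv f g ζ) ^ 2 = nsq g * absConv f g ζ ^ 2 :=
          fun ζ => by
            simp only [mul_pow]
            rw [lintegral_mul_const _ (by fun_prop)]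
            congr 1
            exact lintegral_sub_left_eq_self (fun η => ‖g η‖ₑ ^ 2) ζ
        simp only [this]
        rw [lintegral_const_mul _ (by fun_prop)]
    _ = _ := by ring

/-! ### Cut-offs in a spatial direction -/

/-- The function `∫ θ(s) exp(isr) ds`. -/
def kap (θ : ℝ → ℂ) (r : ℝ) : ℂ := ∫ s, θ s * Complex.exp ((s * r : ℝ) * Complex.I)

/-- The Fourier side of the multiplication by `kap θ (⟪z, a⟫ - y)`. -/
def cut (a : SpaceTime) (θ : ℝ → ℂ) (y : ℝ) (f : SpaceTime → ℂ) (ζ : SpaceTime) : ℂ :=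
  ∫ s, θ s * Complex.exp (-(s * y : ℝ) * Complex.I) * f (ζ - s • a)

/-- Continuous functions supported in `[-1,1]`. -/
structure Profile (θ : ℝ → ℂ) : Prop where
  continuous : Continuous θ
  support : ∀ s, θ s ≠ 0 → |s| ≤ 1

theorem Profile.hasCompactSupport {θ : ℝ → ℂ} (hθ : Profile θ) : HasCompactSupport θ :=
  HasCompactSupport.of_support_subset_isCompact (isCompact_Icc (a := (-1 : ℝ)) (b := 1))
    fun s hs => abs_le.1 (hθ.support s hs)

theorem Profile.integrable {θ : ℝ → ℂ} (hθ : Profile θ) : Integrable θ :=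
  hθ.continuous.integrable_of_hasCompactSupport hθ.hasCompactSupport

theorem Profile.exists_bound {θ : ℝ → ℂ} (hθ : Profile θ) : ∃ B : ℝ≥0, ∀ s, ‖θ s‖ₑ ≤ B := by
  obtain ⟨C, hC⟩ := hθ.continuous.bounded_above_of_compact_support hθ.hasCompactSupport
  refine ⟨C.toNNReal, fun s => ?_⟩
  rw [← ofReal_norm]
  exact ENNReal.ofReal_le_ofReal (hC s)

theorem enorm_exp_mul_I (x : ℝ) : ‖Complex.exp ((x : ℂ) * Complex.I)‖ₑ = 1 := by
  rw [← ofReal_norm, Complex.norm_exp_ofReal_mul_I, ENNReal.ofReal_one]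

theorem enorm_exp_neg_mul_I (x : ℝ) : ‖Complex.exp (-(x : ℂ) * Complex.I)‖ₑ = 1 := by
  rw [← Complex.ofReal_neg, enorm_exp_mul_I]

theorem cut_support {a : SpaceTime} {θ : ℝ → ℂ} (hθ : Profile θ) {y : ℝ} {f : SpaceTime → ℂ}
    {ζ : SpaceTime} (h : cut a θ y f ζ ≠ 0) : ∃ s : ℝ, |s| ≤ 1 ∧ f (ζ - s • a) ≠ 0 := by
  by_contra! hn
  refine h (integral_eq_zero_of_ae (.of_forall fun s => ?_))
  by_cases hs : θ s = 0
  · simp [hs]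
  · simp [hn s (hθ.support s hs)]

theorem measurable_cut {θ : ℝ → ℂ} (hθ : Profile θ) {f : SpaceTime → ℂ} (hf : Measurable f)
    (a : SpaceTime) (y : ℝ) : Measurable (cut a θ y f) := by
  have hθm := hθ.continuous.measurable
  have : Measurable fun p : SpaceTime × ℝ =>
      θ p.2 * Complex.exp (-(p.2 * y : ℝ) * Complex.I) * f (p.1 - p.2 • a) := by fun_prop
  exact this.stronglyMeasurable.integral_prod_right'.measurable

/-- Cauchy–Schwarz in `s` over the parameters that meet the support of `f`, then translation
invariance; `2` is the length of `[-1,1]`. The trivial choice `S = 2` shows that cut-offs are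
bounded on `L²`; a small `S` is the local smoothing gain. -/
theorem nsq_cut_le {θ : ℝ → ℂ} (hθ : Profile θ) {B : ℝ≥0} (hB : ∀ s, ‖θ s‖ₑ ≤ B)
    {f : SpaceTime → ℂ} (hf : Measurable f) (a : SpaceTime) (y : ℝ) {S : ℝ≥0∞}
    (hS : ∀ ζ, volume {s : ℝ | |s| ≤ 1 ∧ f (ζ - s • a) ≠ 0} ≤ S) :
    nsq (cut a θ y f) ≤ 2 * B ^ 2 * S * nsq f := by
  have hθm := hθ.continuous.measurable
  have hm : Measurable fun p : SpaceTime × ℝ => (‖θ p.2‖ₑ * ‖f (p.1 - p.2 • a)‖ₑ) ^ 2 := by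
    fun_prop
  calc nsq (cut a θ y f) ≤ ∫⁻ ζ, S * ∫⁻ s, (‖θ s‖ₑ * ‖f (ζ - s • a)‖ₑ) ^ 2 := by
        refine lintegral_mono fun ζ => ?_
        have h1 : ‖cut a θ y f ζ‖ₑ ≤ ∫⁻ s, ‖θ s‖ₑ * ‖f (ζ - s • a)‖ₑ := by
          refine (enorm_integral_le_lintegral_enorm _).trans_eq (lintegral_congr fun s => ?_)
          rw [enorm_mul, enorm_mul, enorm_exp_neg_mul_I, mul_one]
        refine (pow_le_pow_left₀ zero_le h1 2).trans ?_
        refine lintegral_sq_le_measure_mul volume (by fun_prop) ((measure_mono ?_).trans (hS ζ))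
        intro s hs
        simp only [Set.mem_ofPred_eq, ne_eq, mul_eq_zero, not_or, enorm_eq_zero] at hs
        exact ⟨hθ.support s hs.1, hs.2⟩
    _ = S * ∫⁻ s, ‖θ s‖ₑ ^ 2 * nsq f := by
        rw [lintegral_const_mul _ hm.lintegral_prod_right',
          lintegral_lintegral_swap hm.aemeasurable]
        congr 1
        refine lintegral_congr fun s => ?_
        simp only [mul_pow]
        rw [lintegral_const_mul _ (by fun_prop)]
        congr 1
        exact lintegral_sub_right_eq_self (fun ζ => ‖f ζ‖ₑ ^ 2) (s • a)
    _ ≤ S * ∫⁻ s, (Set.Icc (-1 : ℝ) 1).indicator (fun _ => (B : ℝ≥0∞) ^ 2 * nsq f) s := by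
        gcongr with s
        by_cases hs : θ s = 0
        · simp [hs]
        · rw [Set.indicator_of_mem (show s ∈ Set.Icc (-1 : ℝ) 1 from abs_le.1 (hθ.support s hs))]
          gcongr
          exact hB s
    _ = _ := by
        rw [lintegral_indicator measurableSet_Icc, setLIntegral_const, Real.volume_Icc]
        norm_num
        ring

theorem volume_abs_le_one_le (p : ℝ → Prop) : volume {s : ℝ | |s| ≤ 1 ∧ p s} ≤ 2 := by
  refine (measure_mono fun s hs => abs_le.1 hs.1).trans_eq ((Real.volume_Icc).trans ?_)
  norm_num

theorem Band.cut {f : SpaceTime → ℂ} (hf : Band f) {θ : ℝ → ℂ} (hθ : Profile θ) (a : SpaceTime)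
    (y : ℝ) : Band (cut a θ y f) := by
  refine ⟨measurable_cut hθ hf.measurable a y,
    ⟨(measurable_cut hθ hf.measurable a y).aestronglyMeasurable, ?_⟩, ?_⟩
  · obtain ⟨B, hB⟩ := hθ.exists_bound
    have := nsq_cut_le hθ hB hf.measurable a y fun ζ => volume_abs_le_one_le _
    rw [nsq_eq, nsq_eq] at this
    have h2 : eLpNorm (DNLS.cut a θ y f) 2 volume ^ 2 < ⊤ := this.trans_lt
      (ENNReal.mul_lt_top (ENNReal.mul_lt_top (ENNReal.mul_lt_top ENNReal.ofNat_lt_top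
        (ENNReal.pow_lt_top ENNReal.coe_lt_top)) ENNReal.ofNat_lt_top)
        (ENNReal.pow_lt_top hf.memLp.2))
    simpa using h2
  · obtain ⟨R, hR⟩ := hf.bounded
    refine ⟨R + ‖a‖, fun ζ hζ => ?_⟩
    obtain ⟨s, hs, hfs⟩ := cut_support hθ hζ
    calc ‖ζ‖ = ‖(ζ - s • a) + s • a‖ := by simp
      _ ≤ ‖ζ - s • a‖ + ‖s • a‖ := norm_add_le _ _
      _ ≤ R + 1 * ‖a‖ := by
        rw [norm_smul]
        gcongr
        exacts [hR _ hfs, hs]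
      _ = _ := by ring

theorem integrable_cut_kernel {θ : ℝ → ℂ} (hθ : Profile θ) {f : SpaceTime → ℂ} (hf : Band f)
    (a : SpaceTime) : Integrable (fun p : SpaceTime × ℝ => θ p.2 * f (p.1 - p.2 • a))
      (volume.prod volume) := by
  have hθm := hθ.continuous.measurable
  have hfm := hf.measurable
  have hm : Measurable fun p : SpaceTime × ℝ => θ p.2 * f (p.1 - p.2 • a) := by fun_prop
  rw [integrable_prod_iff' hm.aestronglyMeasurable]
  constructor
  · exact .of_forall fun s => (hf.integrable.comp_sub_right (s • a)).const_mul (θ s)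
  · have : ∀ s, ∫ ζ, ‖θ s * f (ζ - s • a)‖ = ‖θ s‖ * ∫ ζ, ‖f ζ‖ := fun s => by
      simp only [norm_mul]
      rw [integral_const_mul]
      congr 1
      exact integral_sub_right_eq_self (fun ζ => ‖f ζ‖) (s • a)
    simp only [this]
    exact hθ.integrable.norm.mul_const _

/-- Translating a frequency by `s • a` multiplies the function by `exp (i s ⟪z, a⟫)`; superposing
with weight `θ(s) exp(-isy)` produces `kap θ`. Fubini is justified by the integrability of the
kernel. -/
theorem synth_cut {θ : ℝ → ℂ} (hθ : Profile θ) {f : SpaceTime → ℂ} (hf : Band f)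
    (a : SpaceTime) (y : ℝ) (z : SpaceTime) :
    synth (cut a θ y f) z = kap θ (inner ℝ z a - y) * synth f z := by
  have hθm := hθ.continuous.measurable
  have hfm := hf.measurable
  set K : SpaceTime × ℝ → ℂ := fun p => Complex.exp ((inner ℝ z p.1 : ℝ) * Complex.I) *
    (θ p.2 * Complex.exp (-(p.2 * y : ℝ) * Complex.I) * f (p.1 - p.2 • a)) with hK
  have hKm : Measurable K := by rw [hK]; fun_prop
  have hKi : Integrable K (volume.prod volume) := by
    refine (integrable_cut_kernel hθ hf a).mono hKm.aestronglyMeasurable (.of_forall fun p => ?_)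
    rw [hK]
    simp only [norm_mul]
    rw [Complex.norm_exp_ofReal_mul_I, ← Complex.ofReal_neg, Complex.norm_exp_ofReal_mul_I]
    simp
  rw [synth_eq_integral, synth_eq_integral]
  have h1 : ∫ ζ, Complex.exp ((inner ℝ z ζ : ℝ) * Complex.I) * cut a θ y f ζ =
      ∫ ζ, ∫ s, K (ζ, s) := by
    refine integral_congr_ae (.of_forall fun ζ => ?_)
    simp only [hK, cut]
    rw [integral_const_mul]
  rw [h1, integral_integral_swap hKi, mul_left_comm]
  refine congrArg _ ?_
  rw [kap, ← integral_mul_const]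
  refine integral_congr_ae (.of_forall fun s => ?_)
  simp only [hK]
  rw [← integral_add_right_eq_self _ (s • a), ← integral_const_mul]
  refine integral_congr_ae (.of_forall fun ζ => ?_)
  simp only [add_sub_cancel_right]
  rw [inner_add_right, inner_smul_right]
  have : Complex.exp (((inner ℝ z ζ + s * inner ℝ z a : ℝ) : ℂ) * Complex.I) *
      Complex.exp (-(s * y : ℝ) * Complex.I) =
      Complex.exp ((s * (inner ℝ z a - y) : ℝ) * Complex.I) *
        Complex.exp ((inner ℝ z ζ : ℝ) * Complex.I) := by
    rw [← Complex.exp_add, ← Complex.exp_add]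
    congr 1
    push_cast
    ring
  linear_combination (θ s * f ζ) * this

/-- The commutator of a cut-off and a derivative. -/
theorem cut_symb_ae {θ : ℝ → ℂ} (hθ : Profile θ) {f : SpaceTime → ℂ} (hf : Band f)
    (a : SpaceTime) (y : ℝ) (b : Fin 2) :
    ∀ᵐ ζ, cut a θ y (symb b f) ζ = symb b (cut a θ y f) ζ -
      Complex.I * (a (sp b) : ℝ) * cut a (fun s => s * θ s) y f ζ := by
  -- Fubini provides integrability in `s` only for almost every `ζ`. At such `ζ` the identity
  -- follows from `ζ_b = (ζ - s a)_b + s a_b` under the integral.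
  have hint := (integrable_cut_kernel hθ hf a).prod_right_ae
  filter_upwards [hint] with ζ hζ
  have h1 : Integrable fun s : ℝ =>
      θ s * Complex.exp (-(s * y : ℝ) * Complex.I) * f (ζ - s • a) := by
    refine hζ.mono ?_ (.of_forall fun s => ?_)
    · have hθm := hθ.continuous.measurable
      have hfm := hf.measurable
      exact Measurable.aestronglyMeasurable (by fun_prop)
    · simp only [norm_mul]
      rw [← Complex.ofReal_neg, Complex.norm_exp_ofReal_mul_I, mul_one]
  have h2 : Integrable fun s : ℝ =>
      (s : ℂ) * θ s * Complex.exp (-(s * y : ℝ) * Complex.I) * f (ζ - s • a) := by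
    refine hζ.mono ?_ (.of_forall fun s => ?_)
    · have hθm := hθ.continuous.measurable
      have hfm := hf.measurable
      exact Measurable.aestronglyMeasurable (by fun_prop)
    · simp only [norm_mul]
      rw [← Complex.ofReal_neg, Complex.norm_exp_ofReal_mul_I, mul_one]
      by_cases hs : θ s = 0
      · simp [hs]
      · rw [Complex.norm_real, Real.norm_eq_abs]
        refine mul_le_mul_of_nonneg_right ?_ (norm_nonneg _)
        exact mul_le_of_le_one_left (norm_nonneg _) (hθ.support s hs)
  simp only [cut, symb]
  rw [← integral_const_mul, ← integral_const_mul, ← integral_sub (h1.const_mul _) (h2.const_mul _)]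
  refine integral_congr_ae (.of_forall fun s => ?_)
  simp only [PiLp.sub_apply, PiLp.smul_apply, smul_eq_mul]
  push_cast
  ring

theorem Profile.mul_id {θ : ℝ → ℂ} (hθ : Profile θ) : Profile fun s => s * θ s :=
  ⟨by have := hθ.continuous; fun_prop, fun s hs => hθ.support s (right_ne_zero_of_mul hs)⟩

/-- Smooth profiles have rapidly decaying transforms. -/
theorem exists_kap_bound {θ : ℝ → ℂ} (hθ : Profile θ) (hs : ContDiff ℝ ∞ θ) :
    ∃ C : ℝ, 0 < C ∧ ∀ r, ‖kap θ r‖ ≤ C * (1 + r ^ 2)⁻¹ := by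
  set φ : 𝓢(ℝ, ℂ) := hθ.hasCompactSupport.toSchwartzMap hs with hφ
  have hk : ∀ r, kap θ r = (𝓕⁻ φ) ((2 * Real.pi)⁻¹ * r) := fun r => by
    rw [SchwartzMap.fourierInv_coe, Real.fourierInv_eq', kap]
    refine integral_congr_ae (.of_forall fun s => ?_)
    change _ = _ • θ s
    simp only [smul_eq_mul]
    rw [mul_comm]
    congr 3
    simp only [RCLike.inner_apply, conj_trivial]
    field_simp
  obtain ⟨C0, hC0, h0⟩ := (𝓕⁻ φ).decay 0 0
  obtain ⟨C2, hC2, h2⟩ := (𝓕⁻ φ).decay 2 0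
  have hpi : (0:ℝ) < 2 * Real.pi := by positivity
  refine ⟨C0 + (2 * Real.pi) ^ 2 * C2, by positivity, fun r => ?_⟩
  rw [← div_eq_mul_inv, le_div_iff₀ (by positivity), hk, mul_add, mul_one]
  refine add_le_add ?_ ?_
  · simpa using h0 ((2 * Real.pi)⁻¹ * r)
  · have := h2 ((2 * Real.pi)⁻¹ * r)
    simp only [norm_iteratedFDeriv_zero, Real.norm_eq_abs, sq_abs] at this
    calc _ = (2 * Real.pi) ^ 2 * (((2 * Real.pi)⁻¹ * r) ^ 2 * ‖(𝓕⁻ φ) ((2 * Real.pi)⁻¹ * r)‖) := by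
          field_simp
      _ ≤ _ := by gcongr

end DNLS

end

noncomputable section

namespace DNLS

/-! ### One-dimensional integrals and sums -/

/-- The decay profile `1 / (1 + r²)`. -/
def decay (r : ℝ) : ℝ := (1 + r ^ 2)⁻¹

theorem decay_pos (r : ℝ) : 0 < decay r := by unfold decay; positivity

theorem decay_le_one (r : ℝ) : decay r ≤ 1 := inv_le_one_of_one_le₀ (by nlinarith [sq_nonneg r])

theorem measurable_decay : Measurable decay := by unfold decay; fun_prop

/-- From `s² ≤ 2 r² + 2 (r - s)²`, so that `1 + s² ≤ 3 + 2 r²`. It allows a decay factor to be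
frozen at the centre of a square. -/
theorem decay_le_of_abs_sub_le_one {r s : ℝ} (h : |r - s| ≤ 1) : decay r ≤ 3 * decay s := by
  unfold decay
  rw [← div_eq_mul_inv, le_div_iff₀ (by positivity), ← div_eq_inv_mul, div_le_iff₀ (by positivity)]
  have h1 : (r - s) ^ 2 ≤ 1 := (sq_le_one_iff_abs_le_one _).2 h
  nlinarith [sq_nonneg (2 * r - s)]

theorem lintegral_decay (r : ℝ) : ∫⁻ y, ENNReal.ofReal (decay (r - y)) = ENNReal.ofReal Real.pi := by
  rw [lintegral_sub_left_eq_self (fun y => ENNReal.ofReal (decay y)) r,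
    ← ofReal_integral_eq_lintegral_ofReal]
  · unfold decay
    rw [integral_univ_inv_one_add_sq]
  · exact integrable_inv_one_add_sq
  · exact .of_forall fun y => (decay_pos y).le

/-- Each term is at most three times the integral over a unit interval, and the whole line
contributes `π`, uniformly in `r`. -/
theorem tsum_decay_le (r : ℝ) :
    ∑' k : ℤ, ENNReal.ofReal (decay ((k : ℝ) - r)) ≤ ENNReal.ofReal (3 * Real.pi) := by
  have h1 : ∀ k : ℤ, ENNReal.ofReal (decay ((k : ℝ) - r)) ≤
      ∫⁻ y in Set.Ico (k : ℝ) (k + 1), ENNReal.ofReal (3 * decay (r - y)) := fun k => by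
    calc _ = ∫⁻ y in Set.Ico (k : ℝ) (k + 1), ENNReal.ofReal (decay ((k : ℝ) - r)) := by
          rw [setLIntegral_const, Real.volume_Ico]; simp
      _ ≤ _ := by
          refine setLIntegral_mono (by have := measurable_decay; fun_prop) fun y hy => ?_
          refine ENNReal.ofReal_le_ofReal ?_
          have : decay (r - y) = decay (y - r) := by unfold decay; ring
          rw [this]
          refine decay_le_of_abs_sub_le_one ?_
          rw [abs_le]
          constructor <;> linarith [hy.1, hy.2]
  calc _ ≤ ∑' k : ℤ, ∫⁻ y in Set.Ico (k : ℝ) (k + 1), ENNReal.ofReal (3 * decay (r - y)) :=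
        ENNReal.tsum_le_tsum h1
    _ = ∫⁻ y in ⋃ k : ℤ, Set.Ico (k : ℝ) (k + 1), ENNReal.ofReal (3 * decay (r - y)) := by
        rw [lintegral_iUnion (fun k => measurableSet_Ico) (Set.pairwise_disjoint_Ico_intCast ℝ)]
    _ ≤ ∫⁻ y, ENNReal.ofReal (3 * decay (r - y)) := setLIntegral_le_lintegral _ _
    _ = _ := by
        simp only [ENNReal.ofReal_mul (zero_le_three (α := ℝ))]
        rw [lintegral_const_mul _ (by have := measurable_decay; fun_prop), lintegral_decay]

/-! ### A profile -/

/-- A bump function works: for `|s|, |r| ≤ 1` one has `cos (s r) ≥ cos 1 > 0`, so the real part of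
`kap θ r` is at least `cos 1` times the mass of the bump. -/
theorem exists_profile : ∃ θ : ℝ → ℂ, Profile θ ∧ ContDiff ℝ ∞ θ ∧
    ∃ c : ℝ, 0 < c ∧ ∀ r, |r| ≤ 1 → c ≤ ‖kap θ r‖ := by
  let b : ContDiffBump (0 : ℝ) := ⟨1 / 2, 1, by norm_num, by norm_num⟩
  have hsm : ContDiff ℝ ∞ (fun s => ((b s : ℝ) : ℂ)) :=
    Complex.ofRealCLM.contDiff.comp b.contDiff
  have hP : Profile (fun s => ((b s : ℝ) : ℂ)) := by
    refine ⟨hsm.continuous, fun s hs => ?_⟩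
    by_contra h
    refine hs ?_
    rw [b.zero_of_le_dist (by simpa using (not_le.1 h).le), Complex.ofReal_zero]
  refine ⟨_, hP, hsm, Real.cos 1 * ∫ s, b s, mul_pos Real.cos_one_pos b.integral_pos, ?_⟩
  intro r hr
  refine le_trans ?_ (Complex.re_le_norm _)
  have hint : Integrable fun s : ℝ => ((b s : ℝ) : ℂ) * Complex.exp ((s * r : ℝ) * Complex.I) := by
    refine hP.integrable.mono
      (Continuous.aestronglyMeasurable (by have := hP.continuous; fun_prop)) (.of_forall fun s => ?_)
    rw [norm_mul, Complex.norm_exp_ofReal_mul_I, mul_one]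
  have hre : (kap (fun s => ((b s : ℝ) : ℂ)) r).re = ∫ s, b s * Real.cos (s * r) := by
    rw [kap]
    refine (integral_re hint).symm.trans (integral_congr_ae (.of_forall fun s => ?_))
    simp only [RCLike.re_to_complex, Complex.re_ofReal_mul, Complex.exp_ofReal_mul_I_re]
  rw [hre, ← integral_const_mul]
  refine integral_mono (b.integrable.const_mul _) ?_ fun s => ?_
  · exact (b.integrable (μ := volume)).mul_bdd (c := 1) (Continuous.aestronglyMeasurable (by fun_prop))
      (.of_forall fun s => Real.abs_cos_le_one _)
  · simp only
    rw [mul_comm]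
    by_cases h : (b s) = 0
    · simp [h]
    · have hs : |s| ≤ 1 := hP.support s (by exact_mod_cast h)
      refine mul_le_mul_of_nonneg_left ?_ b.nonneg
      rw [← Real.cos_abs (s * r)]
      refine Real.cos_le_cos_of_nonneg_of_le_pi (abs_nonneg _) (by linarith [Real.pi_gt_three]) ?_
      rw [abs_mul]
      exact mul_le_one₀ hs (abs_nonneg _) hr

theorem continuous_kap {θ : ℝ → ℂ} (hθ : Profile θ) : Continuous (kap θ) := by
  unfold kap
  refine continuous_of_dominated (bound := fun s => ‖θ s‖) (fun r => ?_) (fun r => ?_)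
    hθ.integrable.norm ?_
  · exact Continuous.aestronglyMeasurable (by have := hθ.continuous; fun_prop)
  · refine .of_forall fun s => ?_
    rw [norm_mul, Complex.norm_exp_ofReal_mul_I, mul_one]
  · exact .of_forall fun s => by fun_prop

/-! ### Orthonormal frames -/

/-- A vector of space, regarded as a vector of space-time. -/
def lift (w : EuclideanSpace ℝ (Fin 2)) : SpaceTime := !₂[w 0, w 1, 0]

/-- The rotation by a right angle. -/
def perp (e : EuclideanSpace ℝ (Fin 2)) : EuclideanSpace ℝ (Fin 2) := !₂[-e 1, e 0]

theorem inner_lift (z : SpaceTime) (w : EuclideanSpace ℝ (Fin 2)) :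
    inner ℝ z (lift w) = z 0 * w 0 + z 1 * w 1 := by
  simp [lift, PiLp.inner_apply, Fin.sum_univ_three]
  ring

theorem sq_add_sq_eq_one {e : EuclideanSpace ℝ (Fin 2)} (he : ‖e‖ = 1) : e 0 ^ 2 + e 1 ^ 2 = 1 := by
  have := EuclideanSpace.norm_sq_eq e
  rw [he, Fin.sum_univ_two] at this
  simp only [Real.norm_eq_abs, sq_abs] at this
  linarith

theorem norm_perp {e : EuclideanSpace ℝ (Fin 2)} (he : ‖e‖ = 1) : ‖perp e‖ = 1 := by
  rw [EuclideanSpace.norm_eq, Fin.sum_univ_two]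
  simp [perp, Real.sqrt_eq_one]
  linarith [sq_add_sq_eq_one he]

/-- The coordinates along `perp e`, along `e`, and in time. -/
theorem exists_frame {e : EuclideanSpace ℝ (Fin 2)} (he : ‖e‖ = 1) :
    ∃ Ψ : SpaceTime ≃ᵐ ℝ × ℝ × ℝ, MeasurePreserving Ψ ∧
      ∀ z, Ψ z = (inner ℝ z (lift (perp e)), inner ℝ z (lift e), time z) := by
  have h1 := sq_add_sq_eq_one he
  let v : Fin 3 → SpaceTime := ![lift (perp e), lift e, EuclideanSpace.single 2 1]
  have hv : Orthonormal ℝ v := by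
    rw [orthonormal_iff_ite]
    intro i j
    fin_cases i <;> fin_cases j <;>
      simp [v, lift, perp, PiLp.inner_apply, Fin.sum_univ_three]
    · left
      rw [EuclideanSpace.norm_eq, Real.sqrt_eq_one]
      simp [Fin.sum_univ_three]
      linarith
    · ring
    · ring
    · left
      rw [EuclideanSpace.norm_eq, Real.sqrt_eq_one]
      simp [Fin.sum_univ_three]
      linarith
  let b := (basisOfOrthonormalOfCardEqFinrank hv (by simp)).toOrthonormalBasis (by
    rw [coe_basisOfOrthonormalOfCardEqFinrank]; exact hv)
  have hb : ∀ i, b i = v i := fun i => by simp [b]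
  let Ψ₁ : SpaceTime ≃ᵐ SpaceTime := b.measurableEquiv
  let Ψ₂ : SpaceTime ≃ᵐ (Fin 3 → ℝ) := (MeasurableEquiv.toLp 2 (Fin 3 → ℝ)).symm
  let Ψ₃ : (Fin 3 → ℝ) ≃ᵐ ℝ × (Fin 2 → ℝ) := MeasurableEquiv.piFinSuccAbove (fun _ => ℝ) 0
  let Ψ₄ : ℝ × (Fin 2 → ℝ) ≃ᵐ ℝ × ℝ × ℝ :=
    MeasurableEquiv.prodCongr (MeasurableEquiv.refl ℝ) MeasurableEquiv.finTwoArrow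
  refine ⟨((Ψ₁.trans Ψ₂).trans Ψ₃).trans Ψ₄, ?_, fun z => ?_⟩
  · have m4 : MeasurePreserving Ψ₄ :=
      (MeasurePreserving.id volume).prod (volume_preserving_finTwoArrow ℝ)
    have m3 : MeasurePreserving Ψ₃ := volume_preserving_piFinSuccAbove (fun _ => ℝ) 0
    have m2 : MeasurePreserving Ψ₂ :=
      EuclideanSpace.volume_preserving_symm_measurableEquiv_toLp (Fin 3)
    have m1 : MeasurePreserving Ψ₁ := b.measurePreserving_measurableEquiv
    exact m4.comp (m3.comp (m2.comp m1))
  · have hr : ∀ i, b.repr z i = inner ℝ z (v i) := fun i => by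
      rw [b.repr_apply_apply, hb, real_inner_comm]
    have h2 : (inner ℝ z (v 2) : ℝ) = time z := by
      simp [v, time, EuclideanSpace.inner_single_right]
    change (b.repr z 0, b.repr z 1, b.repr z 2) = _
    rw [hr, hr, hr, h2]
    rfl

/-- The set where `F ≠ 0` has diameter at most `L`. Passing to its measurable hull makes any
measurability of `F` unnecessary. -/
theorem lintegral_le_of_abs_sub_le {F : ℝ → ℝ≥0∞} {c : ℝ≥0∞} {L : ℝ} (hc : ∀ q, F q ≤ c)
    (hL : ∀ q q', F q ≠ 0 → F q' ≠ 0 → |q - q'| ≤ L) : ∫⁻ q, F q ≤ ENNReal.ofReal L * c := by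
  set S := {q | F q ≠ 0} with hS
  have hv : volume S ≤ ENNReal.ofReal L := by
    refine (Real.volume_le_diam S).trans (Metric.ediam_le fun x hx y hy => ?_)
    rw [edist_dist, Real.dist_eq]
    exact ENNReal.ofReal_le_ofReal (hL x y hx hy)
  calc _ ≤ ∫⁻ q, (toMeasurable volume S).indicator (fun _ => c) q := by
        refine lintegral_mono fun q => ?_
        by_cases hq : F q = 0
        · simp [hq]
        · rw [Set.indicator_of_mem (subset_toMeasurable _ _ hq)]
          exact hc q
    _ = c * volume S := by
        rw [lintegral_indicator (measurableSet_toMeasurable _ _), setLIntegral_const,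
          measure_toMeasurable]
    _ ≤ _ := by
        rw [mul_comm]
        gcongr

/-- Fubini's bound for the volume of a set whose slices have bounded diameters. -/
theorem volume_le_of_slices {e : EuclideanSpace ℝ (Fin 2)} (he : ‖e‖ = 1) {G : Set SpaceTime}
    (hG : MeasurableSet G) {Lq Lp Lt : ℝ}
    (hq : ∀ z ∈ G, ∀ w ∈ G, |inner ℝ z (lift (perp e)) - inner ℝ w (lift (perp e))| ≤ Lq)
    (hp : ∀ z ∈ G, ∀ w ∈ G, inner ℝ z (lift (perp e)) = inner ℝ w (lift (perp e)) →
      |inner ℝ z (lift e) - inner ℝ w (lift e)| ≤ Lp)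
    (ht : ∀ z ∈ G, ∀ w ∈ G, inner ℝ z (lift (perp e)) = inner ℝ w (lift (perp e)) →
      inner ℝ z (lift e) = inner ℝ w (lift e) → |time z - time w| ≤ Lt) :
    volume G ≤ ENNReal.ofReal Lq * (ENNReal.ofReal Lp * ENNReal.ofReal Lt) := by
  obtain ⟨Ψ, hΨ, hΨz⟩ := exists_frame he
  set T := Ψ.symm ⁻¹' G with hT
  have hTm : MeasurableSet T := Ψ.symm.measurable hG
  have hvol : volume G = volume T := by
    rw [← hΨ.measure_preimage hTm.nullMeasurableSet, hT, ← Set.preimage_comp]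
    simp
  have hmem : ∀ q p t, (q, p, t) ∈ T → ∃ z ∈ G, inner ℝ z (lift (perp e)) = q ∧
      inner ℝ z (lift e) = p ∧ time z = t := fun q p t h => by
    refine ⟨_, h, ?_⟩
    have := hΨz (Ψ.symm (q, p, t))
    rw [MeasurableEquiv.apply_symm_apply] at this
    simpa [Prod.ext_iff, eq_comm] using this
  rw [hvol, Measure.volume_eq_prod, Measure.prod_apply hTm]
  have hex : ∀ q, volume (Prod.mk q ⁻¹' T) ≠ 0 → ∃ p t, (q, p, t) ∈ T := fun q h => by
    by_contra! hn
    refine h ?_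
    have : Prod.mk q ⁻¹' T = ∅ := Set.eq_empty_of_forall_notMem fun x hx => hn x.1 x.2 hx
    rw [this, measure_empty]
  refine lintegral_le_of_abs_sub_le (fun q => ?_) fun q q' h h' => ?_
  · have hTq : MeasurableSet (Prod.mk q ⁻¹' T) := measurable_prodMk_left hTm
    rw [Measure.volume_eq_prod, Measure.prod_apply hTq]
    refine lintegral_le_of_abs_sub_le (fun p => ?_) fun p p' h h' => ?_
    · refine (Real.volume_le_diam _).trans (Metric.ediam_le fun x hx y hy => ?_)
      obtain ⟨z, hz, z1, z2, z3⟩ := hmem q p x hx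
      obtain ⟨w, hw, w1, w2, w3⟩ := hmem q p y hy
      rw [edist_dist, Real.dist_eq, ← z3, ← w3]
      exact ENNReal.ofReal_le_ofReal (ht z hz w hw (z1.trans w1.symm) (z2.trans w2.symm))
    · have hex2 : ∀ p, volume (Prod.mk p ⁻¹' (Prod.mk q ⁻¹' T)) ≠ 0 → ∃ t, (q, p, t) ∈ T :=
        fun p h => by
          by_contra! hn
          refine h ?_
          have : Prod.mk p ⁻¹' (Prod.mk q ⁻¹' T) = ∅ :=
            Set.eq_empty_of_forall_notMem fun x hx => hn x hx
          rw [this, measure_empty]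
      obtain ⟨t, hpt⟩ := hex2 p h
      obtain ⟨t', hpt'⟩ := hex2 p' h'
      obtain ⟨z, hz, z1, z2, z3⟩ := hmem _ _ _ hpt
      obtain ⟨w, hw, w1, w2, w3⟩ := hmem _ _ _ hpt'
      rw [← z2, ← w2]
      exact hp z hz w hw (z1.trans w1.symm)
  · obtain ⟨p, t, hpt⟩ := hex q h
    obtain ⟨p', t', hpt'⟩ := hex q' h'
    obtain ⟨z, hz, z1, z2, z3⟩ := hmem _ _ _ hpt
    obtain ⟨w, hw, w1, w2, w3⟩ := hmem _ _ _ hpt'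
    rw [← z1, ← w1]
    exact hq z hz w hw

end DNLS

end

noncomputable section

namespace DNLS

/-! ### The decay norm and cut-offs -/

theorem measurable_space : Measurable space := by
  unfold space
  refine (MeasurableEquiv.toLp 2 (Fin 2 → ℝ)).measurable.comp ?_
  exact measurable_pi_lambda _ fun a => by fun_prop

theorem measurableSet_cube (i : ℕ) (m : Fin 2 → ℤ) : MeasurableSet (cube i m) := by
  have : cube i m = ⋂ a, {x | 2 ^ i * ((m a : ℝ) - 1 / 2) ≤ x a ∧ x a < 2 ^ i * ((m a : ℝ) + 1 / 2)} := by
    ext x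
    simp [cube]
  rw [this]
  refine MeasurableSet.iInter fun a => ?_
  have hm : Measurable fun x : EuclideanSpace ℝ (Fin 2) => x a := by fun_prop
  exact (measurableSet_le measurable_const hm).inter (measurableSet_lt hm measurable_const)

theorem exists_mem_cube (i : ℕ) (x : EuclideanSpace ℝ (Fin 2)) : ∃ m, x ∈ cube i m := by
  refine ⟨fun a => ⌊x a / 2 ^ i + 1 / 2⌋, fun a => ?_⟩
  have h : (0 : ℝ) < 2 ^ i := by positivity
  have h1 := Int.floor_le (x a / 2 ^ i + 1 / 2)
  have h2 := Int.lt_floor_add_one (x a / 2 ^ i + 1 / 2)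
  have h3 : x a = 2 ^ i * (x a / 2 ^ i) := by field_simp
  constructor
  · calc _ ≤ 2 ^ i * (x a / 2 ^ i) := by gcongr; linarith
      _ = _ := h3.symm
  · calc x a = 2 ^ i * (x a / 2 ^ i) := h3
      _ < _ := by gcongr; linarith

theorem tsum_sq_le {ι : Type*} (a : ι → ℝ≥0∞) : ∑' m, a m ^ 2 ≤ (∑' m, a m) ^ 2 := by
  calc _ ≤ ∑' m, a m * ∑' k, a k :=
        ENNReal.tsum_le_tsum fun m => by
          rw [sq]
          gcongr
          exact ENNReal.le_tsum m
    _ = _ := by rw [ENNReal.tsum_mul_right, sq]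

theorem eLpNorm_le_tsum_cube (i : ℕ) (F : SpaceTime → ℂ) :
    eLpNorm F 2 volume ≤ ∑' m, eLpNorm F 2 (volume.restrict (space ⁻¹' cube i m)) := by
  refine le_of_sq_le_sq (le_trans ?_ (tsum_sq_le _))
  simp only [eLpNorm_two_sq]
  refine le_trans (le_of_eq ?_) (lintegral_iUnion_le _ _)
  rw [Set.eq_univ_of_forall (s := ⋃ m, space ⁻¹' cube i m) fun z => ?_, Measure.restrict_univ]
  exact Set.mem_iUnion.2 (exists_mem_cube i (space z))

theorem abs_le_one_of_norm {n : EuclideanSpace ℝ (Fin 2)} (hn : ‖n‖ = 1) (a : Fin 2) :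
    |n a| ≤ 1 := by
  rw [← hn]
  exact PiLp.norm_apply_le n a

theorem inner_two (x y : EuclideanSpace ℝ (Fin 2)) : (inner ℝ x y : ℝ) = x 0 * y 0 + x 1 * y 1 := by
  simp [PiLp.inner_apply, Fin.sum_univ_two]
  ring

/-- On a cube the coordinates in a given direction differ by at most one (after rescaling). -/
theorem abs_inner_sub_le {i : ℕ} {m : Fin 2 → ℤ} {z : SpaceTime} (hz : space z ∈ cube i m)
    {w : EuclideanSpace ℝ (Fin 2)} (hw : ‖w‖ = 1) :
    |inner ℝ z ((2 ^ i : ℝ)⁻¹ • lift w) - ((m 0 : ℝ) * w 0 + (m 1 : ℝ) * w 1)| ≤ 1 := by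
  have h : (0 : ℝ) < 2 ^ i := by positivity
  have hc : ∀ a, |(2 ^ i : ℝ)⁻¹ * space z a - m a| ≤ 1 / 2 := fun a => by
    obtain ⟨h1, h2⟩ := hz a
    have e1 : (m a : ℝ) - 1 / 2 ≤ (2 ^ i : ℝ)⁻¹ * space z a := by
      rw [inv_mul_eq_div, le_div_iff₀ h]; linarith
    have e2 : (2 ^ i : ℝ)⁻¹ * space z a ≤ (m a : ℝ) + 1 / 2 := by
      rw [inv_mul_eq_div, div_le_iff₀ h]; linarith
    rw [abs_le]
    constructor <;> linarith
  have e0 : space z 0 = z 0 := rfl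
  have e1 : space z 1 = z 1 := rfl
  rw [inner_smul_right, inner_lift, ← e0, ← e1]
  have h0 := hc 0
  have h1 := hc 1
  have w0 := abs_le_one_of_norm hw 0
  have w1 := abs_le_one_of_norm hw 1
  calc _ = |((2 ^ i : ℝ)⁻¹ * space z 0 - m 0) * w 0 + ((2 ^ i : ℝ)⁻¹ * space z 1 - m 1) * w 1| := by
        congr 1; ring
    _ ≤ |(2 ^ i : ℝ)⁻¹ * space z 0 - m 0| * |w 0| + |(2 ^ i : ℝ)⁻¹ * space z 1 - m 1| * |w 1| := by
        rw [← abs_mul, ← abs_mul]; exact abs_add_le _ _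
    _ ≤ 1 / 2 * 1 + 1 / 2 * 1 := by gcongr
    _ = 1 := by norm_num

/-- Each cube meets one of the lines close to its centre. -/
theorem exists_line_meets (i : ℕ) (m : Fin 2 → ℤ) {n : EuclideanSpace ℝ (Fin 2)} (hn : ‖n‖ = 1) :
    ∃ k : ℤ, (cube i m ∩ line i n k).Nonempty ∧
      |((m 0 : ℝ) * n 0 + (m 1 : ℝ) * n 1) - k| ≤ 1 := by
  have hN : (0 : ℝ) < 2 ^ i := by positivity
  have hsq := sq_add_sq_eq_one hn
  set c : ℝ := (m 0 : ℝ) * n 0 + (m 1 : ℝ) * n 1 with hc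
  have key : ∀ (k : ℤ), (∀ a, -(1 / 2) ≤ ((k : ℝ) - c) * n a ∧ ((k : ℝ) - c) * n a < 1 / 2) →
      (cube i m ∩ line i n k).Nonempty := fun k hk => by
    refine ⟨WithLp.toLp 2 fun a => 2 ^ i * ((m a : ℝ) + ((k : ℝ) - c) * n a), fun a => ?_, ?_⟩
    · obtain ⟨h1, h2⟩ := hk a
      simp only
      constructor
      · gcongr; linarith
      · gcongr
    · change inner ℝ _ _ = _
      rw [inner_two]
      simp only
      linear_combination 2 ^ i * ((k : ℝ) - c) * hsq - 2 ^ i * hc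
  set k : ℤ := round c with hk
  have hr : |(k : ℝ) - c| ≤ 1 / 2 := by rw [abs_sub_comm]; exact abs_sub_round c
  -- The foot of the perpendicular from the centre to the nearest line lies within `1/2` of the
  -- centre, hence in the closed cube. Because cubes are half-open it can miss only if `n` is plus
  -- or minus a coordinate vector and the foot lies on an excluded face; the line on the opposite
  -- face, one index away, then meets the cube.
  by_cases h : ∀ a, ((k : ℝ) - c) * n a < 1 / 2
  · refine ⟨k, key k fun a => ⟨?_, h a⟩, ?_⟩
    · have : |((k : ℝ) - c) * n a| ≤ 1 / 2 * 1 := by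
        rw [abs_mul]
        exact mul_le_mul hr (abs_le_one_of_norm hn a) (abs_nonneg _) (by norm_num)
      linarith [(abs_le.1 this).1]
    · rw [abs_sub_comm]; linarith
  · push Not at h
    obtain ⟨a, ha⟩ := h
    have hna := abs_le.1 (abs_le_one_of_norm hn a)
    have hr' := abs_le.1 hr
    have hcase : ((k : ℝ) - c = 1 / 2 ∧ n a = 1) ∨ ((k : ℝ) - c = -(1 / 2) ∧ n a = -1) := by
      rcases le_total 0 (n a) with h0 | h0
      · left; constructor <;> nlinarith
      · right; constructor <;> nlinarith
    have hother : ∀ b, b ≠ a → n b = 0 := fun b hb => by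
      have hsqa : n a ^ 2 = 1 := by rcases hcase with h | h <;> rw [h.2] <;> norm_num
      have hsq2 : n a ^ 2 + n b ^ 2 = 1 := by
        rw [← hsq]
        fin_cases a <;> fin_cases b <;> simp at hb ⊢
        rw [add_comm]
      exact pow_eq_zero_iff two_ne_zero |>.1 (by linarith)
    rcases hcase with ⟨hk1, hn1⟩ | ⟨hk1, hn1⟩
    · refine ⟨k - 1, key _ fun b => ?_, ?_⟩
      · push_cast
        by_cases hb : b = a
        · rw [hb, hn1]; constructor <;> linarith
        · rw [hother b hb]; norm_num
      · push_cast; rw [abs_le]; constructor <;> linarith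
    · refine ⟨k + 1, key _ fun b => ?_, ?_⟩
      · push_cast
        by_cases hb : b = a
        · rw [hb, hn1]; constructor <;> linarith
        · rw [hother b hb]; norm_num
      · push_cast; rw [abs_le]; constructor <;> linarith

/-- The weighted sum over all cubes is controlled by the decay norm. -/
theorem tsum_decay_cube_le (i : ℕ) (u : L2) {n : EuclideanSpace ℝ (Fin 2)} (hn : ‖n‖ = 1) (y : ℝ) :
    ∑' m : Fin 2 → ℤ, ENNReal.ofReal (decay ((m 0 : ℝ) * n 0 + (m 1 : ℝ) * n 1 - y)) *
      eLpNorm u 2 (volume.restrict (space ⁻¹' cube i m)) ≤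
        ENNReal.ofReal (9 * Real.pi) * decayNorm i u := by
  set N : (Fin 2 → ℤ) → ℝ≥0∞ := fun m => eLpNorm u 2 (volume.restrict (space ⁻¹' cube i m)) with hN
  set meets : ℤ → Set (Fin 2 → ℤ) := fun k => {m | (cube i m ∩ line i n k).Nonempty} with hM
  -- Each cube is charged to one line passing near its centre, at the cost of a factor `3`. The
  -- cubes on one line sum to at most the decay norm, and the decay factors of the lines sum to at
  -- most `3 π`.
  have h1 : ∀ m : Fin 2 → ℤ,
      ENNReal.ofReal (decay ((m 0 : ℝ) * n 0 + (m 1 : ℝ) * n 1 - y)) * N m ≤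
        ∑' k : ℤ, ENNReal.ofReal (3 * decay ((k : ℝ) - y)) * (meets k).indicator N m := fun m => by
    obtain ⟨k, hk1, hk2⟩ := exists_line_meets i m hn
    refine le_trans ?_ (ENNReal.le_tsum k)
    rw [Set.indicator_of_mem (show m ∈ meets k from hk1)]
    gcongr
    exact decay_le_of_abs_sub_le_one (by rwa [sub_sub_sub_cancel_right])
  have h2 : ∀ k : ℤ, ∑' m, (meets k).indicator N m ≤ decayNorm i u := fun k => by
    rw [← tsum_subtype (meets k) N]
    exact le_iSup_of_le ⟨n, hn⟩ (le_iSup_of_le k le_rfl)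
  calc _ ≤ ∑' m : Fin 2 → ℤ, ∑' k : ℤ,
        ENNReal.ofReal (3 * decay ((k : ℝ) - y)) * (meets k).indicator N m :=
        ENNReal.tsum_le_tsum h1
    _ = ∑' k : ℤ, ENNReal.ofReal (3 * decay ((k : ℝ) - y)) * ∑' m, (meets k).indicator N m := by
        rw [ENNReal.tsum_comm]
        simp only [ENNReal.tsum_mul_left]
    _ ≤ ∑' k : ℤ, ENNReal.ofReal (3 * decay ((k : ℝ) - y)) * decayNorm i u :=
        ENNReal.tsum_le_tsum fun k => mul_le_mul_right (h2 k) _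
    _ = 3 * (∑' k : ℤ, ENNReal.ofReal (decay ((k : ℝ) - y))) * decayNorm i u := by
        rw [ENNReal.tsum_mul_right, ← ENNReal.tsum_mul_left]
        simp only [ENNReal.ofReal_mul (zero_le_three (α := ℝ)), ENNReal.ofReal_ofNat]
    _ ≤ 3 * ENNReal.ofReal (3 * Real.pi) * decayNorm i u := by
        gcongr
        exact tsum_decay_le y
    _ = _ := by
        rw [show (9 : ℝ) * Real.pi = 3 * (3 * Real.pi) by ring,
          ENNReal.ofReal_mul (zero_le_three (α := ℝ)) (q := 3 * Real.pi), ENNReal.ofReal_ofNat]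

/-- Cut-offs adapted to a family of parallel lines are summable in the decay norm. -/
theorem lintegral_eLpNorm_cutoff_le (i : ℕ) (u : L2) {F : SpaceTime → ℂ}
    (hF : ∀ᵐ z, ‖F z‖ ≤ ‖u z‖) {e : EuclideanSpace ℝ (Fin 2)} (he : ‖e‖ = 1) {κ₁ κ₂ : ℝ → ℂ}
    {C₁ C₂ : ℝ} (hC₁ : 0 ≤ C₁) (hC₂ : 0 ≤ C₂) (h₁ : ∀ r, ‖κ₁ r‖ ≤ C₁ * decay r)
    (h₂ : ∀ r, ‖κ₂ r‖ ≤ C₂ * decay r) (y₂ : ℝ) :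
    ∫⁻ y₁, eLpNorm (fun z => κ₁ (inner ℝ z ((2 ^ i : ℝ)⁻¹ • lift e) - y₁) *
      (κ₂ (inner ℝ z ((2 ^ i : ℝ)⁻¹ • lift (perp e)) - y₂) * F z)) 2 volume ≤
        ENNReal.ofReal (81 * Real.pi ^ 2 * C₁ * C₂) * decayNorm i u := by
  have hn := norm_perp he
  set n := perp e with hn'
  set N : (Fin 2 → ℤ) → ℝ≥0∞ := fun m => eLpNorm u 2 (volume.restrict (space ⁻¹' cube i m)) with hN
  set pe : (Fin 2 → ℤ) → ℝ := fun m => (m 0 : ℝ) * e 0 + (m 1 : ℝ) * e 1 with hpe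
  set pn : (Fin 2 → ℤ) → ℝ := fun m => (m 0 : ℝ) * n 0 + (m 1 : ℝ) * n 1 with hpn
  -- On one cube both cut-offs are comparable to decay factors at its centre. Integration in `y₁`
  -- removes the factor along `e` and leaves `π`; the remaining weight, with normal `perp e`,
  -- concentrates on cubes near a line parallel to `e`, as in the decay norm. The constant is `9 · π
  -- · 9 π`.
  have hloc : ∀ (y₁ : ℝ) (m : Fin 2 → ℤ),
      eLpNorm (fun z => κ₁ (inner ℝ z ((2 ^ i : ℝ)⁻¹ • lift e) - y₁) *
        (κ₂ (inner ℝ z ((2 ^ i : ℝ)⁻¹ • lift n) - y₂) * F z)) 2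
          (volume.restrict (space ⁻¹' cube i m)) ≤
        ENNReal.ofReal (9 * C₁ * C₂) * ENNReal.ofReal (decay (pe m - y₁)) *
          (ENNReal.ofReal (decay (pn m - y₂)) * N m) := fun y₁ m => by
    have hmeas : MeasurableSet (space ⁻¹' cube i m) := measurable_space (measurableSet_cube i m)
    refine (eLpNorm_le_mul_eLpNorm_of_ae_le_mul (g := u)
      (c := 9 * C₁ * C₂ * decay (pe m - y₁) * decay (pn m - y₂)) ?_ 2).trans_eq ?_
    · filter_upwards [ae_restrict_of_ae hF, ae_restrict_mem hmeas] with z hz1 hz2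
      have d1 := abs_inner_sub_le hz2 he
      have d2 := abs_inner_sub_le hz2 hn
      have b1 : ‖κ₁ (inner ℝ z ((2 ^ i : ℝ)⁻¹ • lift e) - y₁)‖ ≤ C₁ * (3 * decay (pe m - y₁)) :=
        (h₁ _).trans (mul_le_mul_of_nonneg_left
          (decay_le_of_abs_sub_le_one (by rwa [sub_sub_sub_cancel_right])) hC₁)
      have b2 : ‖κ₂ (inner ℝ z ((2 ^ i : ℝ)⁻¹ • lift n) - y₂)‖ ≤ C₂ * (3 * decay (pn m - y₂)) :=
        (h₂ _).trans (mul_le_mul_of_nonneg_left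
          (decay_le_of_abs_sub_le_one (by rwa [sub_sub_sub_cancel_right])) hC₂)
      rw [norm_mul, norm_mul]
      have p1 := (decay_pos (pe m - y₁)).le
      have p2 := (decay_pos (pn m - y₂)).le
      calc _ ≤ C₁ * (3 * decay (pe m - y₁)) * (C₂ * (3 * decay (pn m - y₂)) * ‖u z‖) := by
            gcongr
        _ = _ := by ring
    · have p1 := (decay_pos (pe m - y₁)).le
      rw [ENNReal.ofReal_mul (by positivity), ENNReal.ofReal_mul (by positivity)]
      ring
  have hdm := measurable_decay
  calc _ ≤ ∫⁻ y₁, ∑' m, ENNReal.ofReal (9 * C₁ * C₂) * ENNReal.ofReal (decay (pe m - y₁)) *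
          (ENNReal.ofReal (decay (pn m - y₂)) * N m) :=
        lintegral_mono fun y₁ => (eLpNorm_le_tsum_cube i _).trans (ENNReal.tsum_le_tsum (hloc y₁))
    _ = ∑' m, ENNReal.ofReal (9 * C₁ * C₂) * ENNReal.ofReal Real.pi *
          (ENNReal.ofReal (decay (pn m - y₂)) * N m) := by
        rw [lintegral_tsum fun m => by fun_prop]
        congr 1
        ext m
        rw [lintegral_mul_const _ (by fun_prop), lintegral_const_mul _ (by fun_prop),
          lintegral_decay]
    _ ≤ ENNReal.ofReal (9 * C₁ * C₂) * ENNReal.ofReal Real.pi *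
          (ENNReal.ofReal (9 * Real.pi) * decayNorm i u) := by
        rw [ENNReal.tsum_mul_left]
        gcongr
        exact tsum_decay_cube_le i u hn y₂
    _ = _ := by
        rw [← mul_assoc, ← ENNReal.ofReal_mul (by positivity), ← ENNReal.ofReal_mul (by positivity)]
        congr 2
        ring

end DNLS

end

noncomputable section

namespace DNLS

/-! ### Coordinates along a frame and cut-offs -/

theorem norm_space_sq (ζ : SpaceTime) : ‖space ζ‖ ^ 2 = ζ 0 ^ 2 + ζ 1 ^ 2 := by
  rw [EuclideanSpace.norm_sq_eq, Fin.sum_univ_two]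
  simp only [Real.norm_eq_abs, sq_abs]
  rfl

theorem norm_space_sq_eq_frame {e : EuclideanSpace ℝ (Fin 2)} (he : ‖e‖ = 1) (ζ : SpaceTime) :
    ‖space ζ‖ ^ 2 = inner ℝ ζ (lift e) ^ 2 + inner ℝ ζ (lift (perp e)) ^ 2 := by
  have h := sq_add_sq_eq_one he
  rw [norm_space_sq, inner_lift, inner_lift]
  simp only [perp, PiLp.toLp_apply, Matrix.cons_val_zero, Matrix.cons_val_one]
  linear_combination (-(ζ 0 ^ 2 + ζ 1 ^ 2)) * h

theorem inner_lift_lift {e : EuclideanSpace ℝ (Fin 2)} (he : ‖e‖ = 1) :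
    inner ℝ (lift e) (lift e) = (1 : ℝ) := by
  rw [inner_lift, ← sq_add_sq_eq_one he]
  simp [lift]
  ring

theorem inner_lift_perp (e : EuclideanSpace ℝ (Fin 2)) :
    inner ℝ (lift e) (lift (perp e)) = (0 : ℝ) := by
  rw [inner_lift]
  simp [lift, perp]
  ring

theorem time_sub_lift (ζ : SpaceTime) (s t : ℝ) (w : EuclideanSpace ℝ (Fin 2)) :
    time (ζ - s • t • lift w) = time ζ := by
  simp [time, lift]

theorem inner_sub_lift (ζ : SpaceTime) (s t : ℝ) (w x : EuclideanSpace ℝ (Fin 2)) :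
    inner ℝ (ζ - s • t • lift w) (lift x) = inner ℝ ζ (lift x) - s * t * inner ℝ (lift w) (lift x) := by
  rw [inner_sub_left, real_inner_smul_left, real_inner_smul_left, mul_assoc]

theorem abs_coord_lift_le {e : EuclideanSpace ℝ (Fin 2)} (he : ‖e‖ = 1) (b : Fin 2) :
    |lift e (sp b)| ≤ 1 := by
  have := abs_le_one_of_norm he b
  fin_cases b <;> simpa [lift, sp] using this

theorem abs_coord_le_norm_space (ζ : SpaceTime) (b : Fin 2) : |ζ (sp b)| ≤ ‖space ζ‖ :=
  PiLp.norm_apply_le (space ζ) b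

/-- The effect of a small shift of a coordinate on the modulation. -/
theorem abs_modulation_shift_le {σ τ r q t M Q δ : ℝ} (hσ : |σ| = 1) (hq : |q - t| ≤ Q)
    (ht : |t| ≤ δ) (h : |τ - σ * (r + (q - t) ^ 2)| ≤ M) :
    |τ - σ * (r + q ^ 2)| ≤ M + (2 * Q + δ) * δ := by
  have h1 : |σ * (t * (2 * (q - t) + t))| ≤ (2 * Q + δ) * δ := by
    rw [abs_mul, hσ, one_mul, abs_mul, mul_comm]
    have : |2 * (q - t) + t| ≤ 2 * Q + δ := by
      refine (abs_add_le _ _).trans ?_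
      rw [abs_mul, abs_two]
      linarith
    exact mul_le_mul this ht (abs_nonneg _) ((abs_nonneg _).trans this)
  calc |τ - σ * (r + q ^ 2)| = |(τ - σ * (r + (q - t) ^ 2)) - σ * (t * (2 * (q - t) + t))| := by
        congr 1; ring
    _ ≤ _ := (abs_sub _ _).trans (add_le_add h h1)

theorem synth_congr {f g : SpaceTime → ℂ} (h : f =ᵐ[volume] g) (z : SpaceTime) :
    synth f z = synth g z := by unfold synth; rw [hatL1_congr h]

theorem synth_sub_const_mul {f g : SpaceTime → ℂ} (hf : Integrable f) (hg : Integrable g) (c : ℂ)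
    (z : SpaceTime) : synth (fun ζ => f ζ - c * g ζ) z = synth f z - c * synth g z := by
  have hexp : Continuous fun ζ : SpaceTime => Complex.exp ((inner ℝ z ζ : ℝ) * Complex.I) := by
    fun_prop
  have hb : ∀ {F : SpaceTime → ℂ}, Integrable F →
      Integrable fun ζ => Complex.exp ((inner ℝ z ζ : ℝ) * Complex.I) * F ζ := fun hF =>
    hF.bdd_mul (c := 1) hexp.aestronglyMeasurable
      (.of_forall fun ζ => (Complex.norm_exp_ofReal_mul_I _).le)
  rw [synth_eq_integral, synth_eq_integral, synth_eq_integral, mul_left_comm, ← mul_sub,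
    ← integral_const_mul c, ← integral_sub (hb hf) ((hb hg).const_mul c)]
  congr 1
  refine integral_congr_ae (.of_forall fun ζ => ?_)
  ring

/-- The Leibniz rule for cut-offs. -/
theorem kap_mul_synth_symb {θ : ℝ → ℂ} (hθ : Profile θ) {f : SpaceTime → ℂ} (hf : Band f)
    (a : SpaceTime) (y : ℝ) (b : Fin 2) (z : SpaceTime) :
    kap θ (inner ℝ z a - y) * synth (symb b f) z = synth (symb b (cut a θ y f)) z -
      Complex.I * (a (sp b) : ℝ) * synth (cut a (fun s => s * θ s) y f) z := by
  rw [← synth_cut hθ (hf.symb b), synth_congr (cut_symb_ae hθ hf a y b)]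
  exact synth_sub_const_mul ((hf.cut hθ a y).symb b).integrable (hf.cut hθ.mul_id a y).integrable _ z

theorem eLpNorm_eq_nsq (f : SpaceTime → ℂ) : eLpNorm f 2 volume = nsq f ^ (1 / 2 : ℝ) := by
  rw [nsq_eq, ← ENNReal.rpow_natCast, ← ENNReal.rpow_mul]
  simp

theorem measurable_eLpNorm_param {X : Type*} [MeasurableSpace X] {G : X → SpaceTime → ℂ}
    (hG : Measurable (Function.uncurry G)) : Measurable fun x => eLpNorm (G x) 2 volume := by
  simp only [eLpNorm_eq_nsq, nsq]
  have : Measurable fun p : X × SpaceTime => ‖G p.1 p.2‖ₑ ^ 2 := hG.enorm.pow_const 2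
  exact (this.lintegral_prod_right').pow_const _

theorem eLpNorm_le_sqrt_mul {f a b : SpaceTime → ℂ} {s : ℝ} (hs : 0 ≤ s)
    (h : nsq f ≤ ENNReal.ofReal s * (nsq a * nsq b)) :
    eLpNorm f 2 volume ≤ ENNReal.ofReal √s * (eLpNorm a 2 volume * eLpNorm b 2 volume) := by
  refine le_of_sq_le_sq ?_
  rw [mul_pow, mul_pow, ← nsq_eq, ← nsq_eq, ← nsq_eq, ← ENNReal.ofReal_pow (Real.sqrt_nonneg _),
    Real.sq_sqrt hs]
  exact h

theorem eLpNorm_symb_le {f : SpaceTime → ℂ} {R : ℝ} (b : Fin 2)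
    (h : ∀ ζ, f ζ ≠ 0 → ‖space ζ‖ ≤ R) :
    eLpNorm (symb b f) 2 volume ≤ ENNReal.ofReal R * eLpNorm f 2 volume := by
  refine eLpNorm_le_mul_eLpNorm_of_ae_le_mul (.of_forall fun ζ => ?_) 2
  by_cases h0 : f ζ = 0
  · simp [symb, h0]
  · simp only [symb, norm_mul, Complex.norm_I, one_mul, Complex.norm_real, Real.norm_eq_abs]
    exact mul_le_mul_of_nonneg_right ((abs_coord_le_norm_space ζ b).trans (h ζ h0)) (norm_nonneg _)

/-! ### Support conditions -/

section Support

variable {e : EuclideanSpace ℝ (Fin 2)} {N J M σ : ℝ}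

/-- Band-limited functions of low frequency `≲ N` and modulation `≲ M`. -/
structure LowTube (e : EuclideanSpace ℝ (Fin 2)) (N σ M A : ℝ) (ζ : SpaceTime) : Prop where
  along : |inner ℝ ζ (lift e)| ≤ A * N
  across : |inner ℝ ζ (lift (perp e))| ≤ A * N
  modul : |time ζ - σ * ‖space ζ‖ ^ 2| ≤ 12 * M

/-- Frequencies `≳ J` in the direction `e`, with modulation `≲ M`. -/
structure HighTube (e : EuclideanSpace ℝ (Fin 2)) (J σ M : ℝ) (ζ : SpaceTime) : Prop where
  along : J / 9 ≤ inner ℝ ζ (lift e)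
  modul : |time ζ - σ * ‖space ζ‖ ^ 2| ≤ 13 * M

/-- The cut-offs move frequencies by at most `1/N`. At frequencies `≤ 2 N` each of the two shifts
changes the modulation by at most `(4 N + 1/N)/N ≤ 5`, and `2 M + 10 ≤ 12 M`. -/
theorem lowTube_of_cut (he : ‖e‖ = 1) (hN : 1 ≤ N) (hM : 1 ≤ M) (hσ : |σ| = 1)
    {f : SpaceTime → ℂ} (hf : ∀ ζ, f ζ ≠ 0 → ‖space ζ‖ ≤ 2 * N ∧
      |time ζ - σ * ‖space ζ‖ ^ 2| ≤ 2 * M) {θ₁ θ₂ : ℝ → ℂ} (h₁ : Profile θ₁) (h₂ : Profile θ₂)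
    (y₁ y₂ : ℝ) {ζ : SpaceTime}
    (hζ : cut (N⁻¹ • lift e) θ₁ y₁ (cut (N⁻¹ • lift (perp e)) θ₂ y₂ f) ζ ≠ 0) :
    LowTube e N σ M 3 ζ := by
  obtain ⟨s, hs, h⟩ := cut_support h₁ hζ
  obtain ⟨t, ht, h⟩ := cut_support h₂ h
  obtain ⟨h3, h4⟩ := hf _ h
  rw [time_sub_lift, time_sub_lift, norm_space_sq_eq_frame he] at h4
  have h3' : ‖space (ζ - s • N⁻¹ • lift e - t • N⁻¹ • lift (perp e))‖ ^ 2 ≤ (2 * N) ^ 2 :=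
    pow_le_pow_left₀ (norm_nonneg _) h3 2
  rw [norm_space_sq_eq_frame he] at h3'
  simp only [inner_sub_lift, inner_lift_lift he, inner_lift_lift (norm_perp he), inner_lift_perp,
    real_inner_comm (lift e) (lift (perp e)), mul_one, mul_zero, sub_zero] at h3' h4
  set p := inner ℝ ζ (lift e)
  set q := inner ℝ ζ (lift (perp e))
  have hNi : N⁻¹ ≤ 1 := inv_le_one_of_one_le₀ hN
  have hN0 : 0 < N⁻¹ := by positivity
  have hNN : N * N⁻¹ = 1 := mul_inv_cancel₀ (by positivity)
  have hsN : |s * N⁻¹| ≤ N⁻¹ := by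
    rw [abs_mul, abs_of_pos hN0]; exact mul_le_of_le_one_left hN0.le hs
  have htN : |t * N⁻¹| ≤ N⁻¹ := by
    rw [abs_mul, abs_of_pos hN0]; exact mul_le_of_le_one_left hN0.le ht
  have hp : |p - s * N⁻¹| ≤ 2 * N := abs_le_of_sq_le_sq (by nlinarith [sq_nonneg (q - t * N⁻¹)]) (by linarith)
  have hq : |q - t * N⁻¹| ≤ 2 * N := abs_le_of_sq_le_sq (by nlinarith [sq_nonneg (p - s * N⁻¹)]) (by linarith)
  have h5 := abs_modulation_shift_le hσ hq htN h4
  rw [add_comm ((p - s * N⁻¹) ^ 2)] at h5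
  have h6 := abs_modulation_shift_le hσ hp hsN h5
  refine ⟨?_, ?_, ?_⟩
  · have := abs_add_le (p - s * N⁻¹) (s * N⁻¹)
    rw [sub_add_cancel] at this
    linarith
  · have := abs_add_le (q - t * N⁻¹) (t * N⁻¹)
    rw [sub_add_cancel] at this
    linarith
  · rw [norm_space_sq_eq_frame he, add_comm (_ ^ 2)]
    refine h6.trans ?_
    nlinarith

/-- Only the transverse cut-off is harmless for a high frequency: its transverse component is at
most `5 N`, so the modulation changes by at most `11`. A cut-off along `e` could move it by about `J
/ N`. -/
theorem highTube_of_cut (he : ‖e‖ = 1) (hN : 1 ≤ N) (hM : 1 ≤ M) (hσ : |σ| = 1)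
    {g : SpaceTime → ℂ} (hg : ∀ ζ, g ζ ≠ 0 → J / 9 ≤ inner ℝ ζ (lift e) ∧
      |inner ℝ ζ (lift (perp e))| ≤ 5 * N ∧ |time ζ - σ * ‖space ζ‖ ^ 2| ≤ 2 * M)
    {θ : ℝ → ℂ} (hθ : Profile θ) (y : ℝ) {ζ : SpaceTime}
    (hζ : cut (N⁻¹ • lift (perp e)) θ y g ζ ≠ 0) : HighTube e J σ M ζ := by
  obtain ⟨t, ht, h⟩ := cut_support hθ hζ
  obtain ⟨h1, h2, h3⟩ := hg _ h
  rw [time_sub_lift, norm_space_sq_eq_frame he] at h3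
  simp only [inner_sub_lift, inner_lift_lift (norm_perp he),
    real_inner_comm (lift e) (lift (perp e)), inner_lift_perp, mul_one, mul_zero, sub_zero]
    at h1 h2 h3
  have hN0 : 0 < N⁻¹ := by positivity
  have hNi : N⁻¹ ≤ 1 := inv_le_one_of_one_le₀ hN
  have hNN : N * N⁻¹ = 1 := mul_inv_cancel₀ (by positivity)
  have htN : |t * N⁻¹| ≤ N⁻¹ := by
    rw [abs_mul, abs_of_pos hN0]; exact mul_le_of_le_one_left hN0.le ht
  refine ⟨h1, ?_⟩
  rw [norm_space_sq_eq_frame he]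
  refine (abs_modulation_shift_le hσ h2 htN h3).trans ?_
  nlinarith

theorem sub_inner_lift (ζ η : SpaceTime) (w : EuclideanSpace ℝ (Fin 2)) :
    inner ℝ (ζ - η) (lift w) = inner ℝ ζ (lift w) - inner ℝ η (lift w) := inner_sub_left _ _ _

/-- For a fixed total `P` the resonance `p ↦ σ₁ p² + σ₂ (P - p)²` is monotone with slope at least
`c`, whatever the signs, because the high component `P - p ≥ B` dominates the low one `|p| ≤ A`. The
difference of two values factors through `p - p'`. -/
theorem abs_sub_le_of_resonance {σ₁ σ₂ p p' P c E : ℝ} (hc : 0 < c) (h₁ : |σ₁| = 1)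
    (h₂ : |σ₂| = 1) {A B : ℝ} (hp : |p| ≤ A) (hp' : |p'| ≤ A) (hP : B ≤ P - p) (hP' : B ≤ P - p')
    (hAB : c ≤ 2 * B - 2 * A)
    (h : |σ₁ * (p ^ 2 - p' ^ 2) + σ₂ * ((P - p) ^ 2 - (P - p') ^ 2)| ≤ E) :
    |p - p'| ≤ E / c := by
  have hb : c ≤ |σ₁ * (p + p') - σ₂ * ((P - p) + (P - p'))| := by
    have hA : 0 ≤ A := (abs_nonneg _).trans hp
    have e1 : |σ₁ * (p + p')| ≤ 2 * A := by
      rw [abs_mul, h₁, one_mul]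
      exact (abs_add_le _ _).trans (by linarith)
    have e2 : 2 * B ≤ |σ₂ * ((P - p) + (P - p'))| := by
      rw [abs_mul, h₂, one_mul]
      exact le_trans (by linarith) (le_abs_self _)
    have := abs_sub_abs_le_abs_sub (σ₂ * ((P - p) + (P - p'))) (σ₁ * (p + p'))
    rw [abs_sub_comm] at this
    linarith
  rw [le_div_iff₀ hc]
  calc |p - p'| * c ≤ |p - p'| * |σ₁ * (p + p') - σ₂ * ((P - p) + (P - p'))| := by gcongr
    _ = |σ₁ * (p ^ 2 - p' ^ 2) + σ₂ * ((P - p) ^ 2 - (P - p') ^ 2)| := by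
        rw [← abs_mul]; congr 1; ring
    _ ≤ E := h

/-- Transversality of the two paraboloids. The transverse coordinate ranges over `O(N)`; for fixed
transverse coordinate the two modulation constraints confine the coordinate along `e` to `O((M₁ +
M₂)/J)`; for fixed frequency, time ranges over `O(min M₁ M₂)`. -/
theorem volume_low_high_le (he : ‖e‖ = 1) (hN : 1 ≤ N) (hJ : 32 * N ≤ J) {M₁ M₂ σ₁ σ₂ : ℝ}
    (hM₁ : 1 ≤ M₁) (hM₂ : 1 ≤ M₂) (h₁ : |σ₁| = 1) (h₂ : |σ₂| = 1) {f g : SpaceTime → ℂ}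
    (hf : Measurable f) (hg : Measurable g) (hfs : ∀ ζ, f ζ ≠ 0 → LowTube e N σ₁ M₁ 3 ζ)
    (hgs : ∀ ζ, g ζ ≠ 0 → HighTube e J σ₂ M₂ ζ) (ζ : SpaceTime) :
    volume {η | f η ≠ 0 ∧ g (ζ - η) ≠ 0} ≤
      ENNReal.ofReal (250000 * N * (M₁ * M₂) / J) := by
  have hJ0 : 0 < J := by linarith
  have hG : MeasurableSet {η | f η ≠ 0 ∧ g (ζ - η) ≠ 0} :=
    (hf (measurableSet_singleton 0).compl).inter
      ((hg.comp (measurable_const.sub measurable_id)) (measurableSet_singleton 0).compl)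
  have hmin : 0 ≤ min M₁ M₂ := le_min (by linarith) (by linarith)
  -- The slope is `2 J/9 - 6 N ≥ J/30`, which uses `32 N ≤ J`. The modulation windows contribute at
  -- most `26 (M₁ + M₂)`, whence `780 = 26 · 30`.
  refine (volume_le_of_slices he hG (Lq := 6 * N) (Lp := 780 * (M₁ + M₂) / J)
    (Lt := 26 * min M₁ M₂) ?_ ?_ ?_).trans ?_
  · rintro z ⟨hz, -⟩ w ⟨hw, -⟩
    have := (hfs z hz).across
    have := (hfs w hw).across
    exact (abs_sub _ _).trans (by linarith)
  · rintro z ⟨hz1, hz2⟩ w ⟨hw1, hw2⟩ hq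
    obtain ⟨a1, -, a3⟩ := hfs z hz1
    obtain ⟨b1, -, b3⟩ := hfs w hw1
    obtain ⟨c1, c3⟩ := hgs _ hz2
    obtain ⟨d1, d3⟩ := hgs _ hw2
    rw [norm_space_sq_eq_frame he] at a3 b3 c3 d3
    rw [sub_inner_lift] at c1 d1
    rw [sub_inner_lift, sub_inner_lift] at c3 d3
    rw [← hq] at b3 d3
    have ht1 : time (ζ - z) = time ζ - time z := rfl
    have ht2 : time (ζ - w) = time ζ - time w := rfl
    rw [ht1] at c3
    rw [ht2] at d3
    have := abs_sub_le_of_resonance (c := J / 30) (E := 26 * (M₁ + M₂)) (by positivity) h₁ h₂ a1 b1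
      c1 d1 (by linarith) (by
        rw [abs_le] at a3 b3 c3 d3 ⊢
        constructor <;> linarith)
    refine this.trans (le_of_eq ?_)
    field_simp
    ring
  · rintro z ⟨hz1, hz2⟩ w ⟨hw1, hw2⟩ hq hp
    have a3 := (hfs z hz1).modul
    have b3 := (hfs w hw1).modul
    have c3 := (hgs _ hz2).modul
    have d3 := (hgs _ hw2).modul
    rw [norm_space_sq_eq_frame he] at a3 b3 c3 d3
    rw [sub_inner_lift, sub_inner_lift] at c3 d3
    rw [← hq, ← hp] at b3 d3
    have ht1 : time (ζ - z) = time ζ - time z := rfl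
    have ht2 : time (ζ - w) = time ζ - time w := rfl
    rw [ht1] at c3
    rw [ht2] at d3
    rw [abs_le] at a3 b3 c3 d3
    rcases min_cases M₁ M₂ with ⟨h, -⟩ | ⟨h, -⟩ <;> rw [h, abs_le] <;> constructor <;> linarith
  · rw [← ENNReal.ofReal_mul (by positivity), ← ENNReal.ofReal_mul (by positivity)]
    refine ENNReal.ofReal_le_ofReal ?_
    have hmm : (M₁ + M₂) * min M₁ M₂ ≤ 2 * (M₁ * M₂) := by
      have e1 : M₁ * min M₁ M₂ ≤ M₁ * M₂ := by gcongr; exact min_le_right _ _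
      have e2 : M₂ * min M₁ M₂ ≤ M₂ * M₁ := by gcongr; exact min_le_left _ _
      linarith
    rw [le_div_iff₀ hJ0]
    calc 6 * N * (780 * (M₁ + M₂) / J * (26 * min M₁ M₂)) * J =
          121680 * N * ((M₁ + M₂) * min M₁ M₂) := by field_simp; ring
      _ ≤ 121680 * N * (2 * (M₁ * M₂)) := by gcongr
      _ ≤ _ := by nlinarith [mul_pos (by linarith : 0 < N) (by positivity : 0 < M₁ * M₂)]

/-- Local smoothing: along a line in direction `e` the modulation varies at rate at least `2
(J/9)/N` in `s`, but must stay in a window of length `26 M`; the quotient is `117 N M / J`. -/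
theorem volume_line_high_le (he : ‖e‖ = 1) (hN : 1 ≤ N) (hJ : 0 < J) {h : SpaceTime → ℂ}
    (hσ : |σ| = 1) (hh : ∀ ζ, h ζ ≠ 0 → HighTube e J σ M ζ) (ζ : SpaceTime) :
    volume {s : ℝ | |s| ≤ 1 ∧ h (ζ - s • N⁻¹ • lift e) ≠ 0} ≤
      ENNReal.ofReal (117 * N * M / J) := by
  refine (Real.volume_le_diam _).trans (Metric.ediam_le ?_)
  rintro s ⟨-, hs⟩ t ⟨-, ht⟩
  rw [edist_dist, Real.dist_eq]
  refine ENNReal.ofReal_le_ofReal ?_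
  obtain ⟨a1, a2⟩ := hh _ hs
  obtain ⟨b1, b2⟩ := hh _ ht
  rw [norm_space_sq_eq_frame he, time_sub_lift] at a2 b2
  simp only [inner_sub_lift, inner_lift_lift he, inner_lift_perp, mul_one, mul_zero, sub_zero]
    at a1 a2 b1 b2
  set P := inner ℝ ζ (lift e)
  have hN0 : 0 < N := by linarith
  rw [le_div_iff₀ hJ]
  have h1 : |s * N⁻¹ - t * N⁻¹| * (2 * (J / 9)) ≤ 26 * M := by
    calc _ ≤ |s * N⁻¹ - t * N⁻¹| * |(P - s * N⁻¹) + (P - t * N⁻¹)| := by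
          gcongr
          exact le_trans (by linarith) (le_abs_self _)
      _ = |σ * ((P - s * N⁻¹) ^ 2 - (P - t * N⁻¹) ^ 2)| := by
          rw [abs_mul, hσ, one_mul, ← abs_mul, ← abs_neg]
          congr 1
          ring
      _ ≤ _ := by
          rw [abs_le] at a2 b2 ⊢
          constructor <;> linarith
  have h2 : |s - t| = N * |s * N⁻¹ - t * N⁻¹| := by
    rw [← sub_mul, abs_mul, abs_of_pos (inv_pos.2 hN0)]
    field_simp
  rw [h2]
  nlinarith

end Support

end DNLS

end

noncomputable section

namespace DNLS

/-! ### The trilinear estimate for functions localized in one frequency square -/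

theorem le_lintegral_kap_pow {θ : ℝ → ℂ} {c : ℝ} (hc : ∀ r, |r| ≤ 1 → c ≤ ‖kap θ r‖) (n : ℕ)
    (r : ℝ) : 2 * ENNReal.ofReal c ^ n ≤ ∫⁻ y, ‖kap θ (r - y)‖ₑ ^ n := by
  calc 2 * ENNReal.ofReal c ^ n = ∫⁻ _ in Set.Icc (r - 1) (r + 1), ENNReal.ofReal c ^ n := by
        rw [setLIntegral_const, Real.volume_Icc, mul_comm]
        congr 1
        rw [show r + 1 - (r - 1) = 2 by ring, ENNReal.ofReal_ofNat]
    _ ≤ ∫⁻ y in Set.Icc (r - 1) (r + 1), ‖kap θ (r - y)‖ₑ ^ n := by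
        refine setLIntegral_mono' measurableSet_Icc fun y hy => ?_
        gcongr
        rw [← ofReal_norm]
        refine ENNReal.ofReal_le_ofReal (hc _ ?_)
        rw [abs_le]
        constructor <;> linarith [hy.1, hy.2]
    _ ≤ _ := setLIntegral_le_lintegral _ _

theorem lintegral_kap_sq_le {θ : ℝ → ℂ} {K : ℝ} (hK : ∀ r, ‖kap θ r‖ ≤ K * decay r)
    (r : ℝ) : ∫⁻ y, ‖kap θ (r - y)‖ₑ ^ 2 ≤ ENNReal.ofReal (K ^ 2 * Real.pi) := by
  calc _ ≤ ∫⁻ y, ENNReal.ofReal (K ^ 2) * ENNReal.ofReal (decay (r - y)) := by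
        refine lintegral_mono fun y => ?_
        rw [← ofReal_norm, ← ENNReal.ofReal_pow (norm_nonneg _), ← ENNReal.ofReal_mul (by positivity)]
        refine ENNReal.ofReal_le_ofReal ?_
        calc _ ≤ (K * decay (r - y)) ^ 2 := pow_le_pow_left₀ (norm_nonneg _) (hK _) 2
          _ = K ^ 2 * (decay (r - y) * decay (r - y)) := by ring
          _ ≤ K ^ 2 * (decay (r - y) * 1) := by
              have := (decay_pos (r - y)).le
              gcongr
              exact decay_le_one _
          _ = _ := by ring
    _ = _ := by
        have := measurable_decay
        rw [lintegral_const_mul _ (by fun_prop), lintegral_decay, ENNReal.ofReal_mul (by positivity)]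

theorem lintegral_enorm_mul_le (F G : SpaceTime → ℂ) (hF : Measurable F) (hG : Measurable G) :
    ∫⁻ z, ‖F z‖ₑ * ‖G z‖ₑ ≤ eLpNorm F 2 volume * eLpNorm G 2 volume := by
  refine le_of_sq_le_sq ?_
  rw [mul_pow, ← nsq_eq, ← nsq_eq]
  exact lintegral_mul_sq_le volume (by fun_prop) (by fun_prop)

/-- Superposition of cut-offs in one direction. -/
theorem lintegral_cutoff_mul_le {θ : ℝ → ℂ} (hθ : Profile θ) {K : ℝ} (hK : ∀ r, ‖kap θ r‖ ≤ K * decay r) (a : SpaceTime) {Y Z : SpaceTime → ℂ} (hY : Measurable Y)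
    (hZ : Measurable Z) :
    ∫⁻ y, eLpNorm (fun z => kap θ (inner ℝ z a - y) * Y z) 2 volume *
      eLpNorm (fun z => kap θ (inner ℝ z a - y) * Z z) 2 volume ≤
        ENNReal.ofReal (K ^ 2 * Real.pi) * (eLpNorm Y 2 volume * eLpNorm Z 2 volume) := by
  have hk := (continuous_kap hθ).measurable
  have key : ∀ {X : SpaceTime → ℂ}, Measurable X →
      ∫⁻ y, eLpNorm (fun z => kap θ (inner ℝ z a - y) * X z) 2 volume ^ 2 ≤
        ENNReal.ofReal (K ^ 2 * Real.pi) * eLpNorm X 2 volume ^ 2 := fun {X} hX => by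
    simp only [← nsq_eq, nsq, enorm_mul, mul_pow]
    have hm : Measurable fun p : ℝ × SpaceTime =>
        ‖kap θ (inner ℝ p.2 a - p.1)‖ₑ ^ 2 * ‖X p.2‖ₑ ^ 2 := by fun_prop
    rw [lintegral_lintegral_swap hm.aemeasurable, ← lintegral_const_mul _ (by fun_prop)]
    refine lintegral_mono fun z => ?_
    rw [lintegral_mul_const _ (by fun_prop)]
    gcongr
    exact lintegral_kap_sq_le hK _
  have hmeas : ∀ {X : SpaceTime → ℂ}, Measurable X →
      Measurable fun y => eLpNorm (fun z => kap θ (inner ℝ z a - y) * X z) 2 volume :=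
    fun {X} hX => measurable_eLpNorm_param
      (G := fun (y : ℝ) (z : SpaceTime) => kap θ (inner ℝ z a - y) * X z)
      (by unfold Function.uncurry; fun_prop)
  refine le_of_sq_le_sq ?_
  calc _ ≤ _ := lintegral_mul_sq_le volume (hmeas hY).aemeasurable (hmeas hZ).aemeasurable
    _ ≤ (ENNReal.ofReal (K ^ 2 * Real.pi) * eLpNorm Y 2 volume ^ 2) *
        (ENNReal.ofReal (K ^ 2 * Real.pi) * eLpNorm Z 2 volume ^ 2) :=
        mul_le_mul' (key hY) (key hZ)
    _ = _ := by ring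

/-- Insertion of cut-offs in two directions. -/
theorem lintegral_mul_le_cutoff {θ : ℝ → ℂ} (hθ : Profile θ) {c : ℝ}
    (hc : ∀ r, |r| ≤ 1 → c ≤ ‖kap θ r‖) (a₁ a₂ : SpaceTime) {X Y Z : SpaceTime → ℂ}
    (hX : Measurable X) (hY : Measurable Y) (hZ : Measurable Z) :
    4 * ENNReal.ofReal c ^ 5 * ∫⁻ z, ‖X z‖ₑ * ‖Y z‖ₑ * ‖Z z‖ₑ ≤
      ∫⁻ y₂, ∫⁻ y₁, eLpNorm (fun z => (kap θ (inner ℝ z a₁ - y₁) *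
          (kap θ (inner ℝ z a₂ - y₂) * X z)) * (kap θ (inner ℝ z a₂ - y₂) * Y z)) 2 volume *
        eLpNorm (fun z => kap θ (inner ℝ z a₁ - y₁) *
          (kap θ (inner ℝ z a₂ - y₂) * Z z)) 2 volume := by
  have hk := (continuous_kap hθ).measurable
  -- The transverse cut-off is inserted on all three factors, the one along `e` only on `X` and `Z`.
  -- So `Φ` carries a cube in `y₂` and a square in `y₁`, whose integrals are at least `2 c³` and `2
  -- c²`. The factor `Y` stays uncut along `e`, which would spoil its modulation.
  set Φ : SpaceTime → ℝ → ℝ → ℝ≥0∞ := fun z y₂ y₁ =>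
    ‖(kap θ (inner ℝ z a₁ - y₁) * (kap θ (inner ℝ z a₂ - y₂) * X z)) *
      (kap θ (inner ℝ z a₂ - y₂) * Y z)‖ₑ *
    ‖kap θ (inner ℝ z a₁ - y₁) * (kap θ (inner ℝ z a₂ - y₂) * Z z)‖ₑ with hΦ
  have hm1 : Measurable fun p : (SpaceTime × ℝ) × ℝ => Φ p.1.1 p.1.2 p.2 := by
    rw [hΦ]; fun_prop
  have hm2 : Measurable fun p : SpaceTime × ℝ => ∫⁻ y₁, Φ p.1 p.2 y₁ := hm1.lintegral_prod_right'
  have hm3 : ∀ y₂, Measurable fun p : SpaceTime × ℝ => Φ p.1 y₂ p.2 := fun y₂ => by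
    rw [hΦ]; fun_prop
  calc _ ≤ ∫⁻ z, ∫⁻ y₂, ∫⁻ y₁, Φ z y₂ y₁ := by
        rw [← lintegral_const_mul _ (by fun_prop)]
        refine lintegral_mono fun z => ?_
        have e1 : ∀ y₂ y₁, Φ z y₂ y₁ = ‖kap θ (inner ℝ z a₂ - y₂)‖ₑ ^ 3 *
            (‖X z‖ₑ * ‖Y z‖ₑ * ‖Z z‖ₑ) * ‖kap θ (inner ℝ z a₁ - y₁)‖ₑ ^ 2 := fun y₂ y₁ => by
          simp only [hΦ, enorm_mul]
          ring
        simp only [e1]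
        have e2 : ∀ y₂, ∫⁻ y₁, ‖kap θ (inner ℝ z a₂ - y₂)‖ₑ ^ 3 *
            (‖X z‖ₑ * ‖Y z‖ₑ * ‖Z z‖ₑ) * ‖kap θ (inner ℝ z a₁ - y₁)‖ₑ ^ 2 =
            ‖kap θ (inner ℝ z a₂ - y₂)‖ₑ ^ 3 * ((‖X z‖ₑ * ‖Y z‖ₑ * ‖Z z‖ₑ) *
              ∫⁻ y₁, ‖kap θ (inner ℝ z a₁ - y₁)‖ₑ ^ 2) := fun y₂ => by
          rw [lintegral_const_mul _ (by fun_prop), mul_assoc]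
        simp only [e2]
        rw [lintegral_mul_const _ (by fun_prop)]
        calc _ = (2 * ENNReal.ofReal c ^ 3) * ((‖X z‖ₑ * ‖Y z‖ₑ * ‖Z z‖ₑ) *
              (2 * ENNReal.ofReal c ^ 2)) := by ring
          _ ≤ _ := by
            gcongr
            · exact le_lintegral_kap_pow hc 3 _
            · exact le_lintegral_kap_pow hc 2 _
    _ = ∫⁻ y₂, ∫⁻ y₁, ∫⁻ z, Φ z y₂ y₁ := by
        rw [lintegral_lintegral_swap hm2.aemeasurable]
        refine lintegral_congr fun y₂ => ?_
        rw [lintegral_lintegral_swap (hm3 y₂).aemeasurable]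
    _ ≤ _ := by
        refine lintegral_mono fun y₂ => lintegral_mono fun y₁ => ?_
        exact lintegral_enorm_mul_le _ _ (by fun_prop) (by fun_prop)

/-- The heart of the matter: all high frequencies share one direction `e`, so transversality for the
product of `f` and `g` and local smoothing for `h` apply simultaneously to the cut-off functions.
The function `u` enters only through the bound `‖synth f‖ ≤ ‖u‖`, so that one decay norm serves for
`u` and for its conjugate. -/
theorem exists_core_estimate : ∃ C : ℝ, 0 < C ∧ ∀ (i : ℕ) (J M₁ M₂ M₃ σ₁ σ₂ : ℝ)
    (e : EuclideanSpace ℝ (Fin 2)), ‖e‖ = 1 → 32 * 2 ^ i ≤ J → 1 ≤ M₁ → 1 ≤ M₂ → 1 ≤ M₃ →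
    |σ₁| = 1 → |σ₂| = 1 → ∀ f g h : SpaceTime → ℂ, Band f → Band g → Band h →
    (∀ ζ, f ζ ≠ 0 → ‖space ζ‖ ≤ 2 * 2 ^ i ∧ |time ζ - σ₁ * ‖space ζ‖ ^ 2| ≤ 2 * M₁) →
    (∀ ζ, g ζ ≠ 0 → J / 9 ≤ inner ℝ ζ (lift e) ∧ |inner ℝ ζ (lift (perp e))| ≤ 5 * 2 ^ i ∧
      |time ζ - σ₂ * ‖space ζ‖ ^ 2| ≤ 2 * M₂) →
    (∀ ζ, h ζ ≠ 0 → J / 9 ≤ inner ℝ ζ (lift e) ∧ |inner ℝ ζ (lift (perp e))| ≤ 5 * 2 ^ i ∧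
      |time ζ - 1 * ‖space ζ‖ ^ 2| ≤ 2 * M₃) →
    ∀ (u : L2), (∀ᵐ z, ‖synth f z‖ ≤ ‖u z‖) → ∀ b : Fin 2,
    ∫⁻ z, ‖synth (symb b f) z‖ₑ * ‖synth g z‖ₑ * ‖synth h z‖ₑ ≤
      ENNReal.ofReal (C * ((2 ^ i) ^ 2 * √(M₁ * M₂ * M₃) / J)) * decayNorm i u *
        (eLpNorm g 2 volume * eLpNorm h 2 volume) := by
  obtain ⟨θ, hθ, hsm, c, hc0, hc⟩ := exists_profile
  have hθ' := hθ.mul_id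
  have hsm' : ContDiff ℝ ∞ (fun s : ℝ => (s : ℂ) * θ s) := Complex.ofRealCLM.contDiff.mul hsm
  obtain ⟨K₁, hK₁, hk₁⟩ := exists_kap_bound hθ hsm
  obtain ⟨K₂, hK₂, hk₂⟩ := exists_kap_bound hθ' hsm'
  set K := max K₁ K₂ with hKdef
  have hK : 0 < K := lt_max_of_lt_left hK₁
  have hk : ∀ r, ‖kap θ r‖ ≤ K * decay r := fun r => (hk₁ r).trans
    (mul_le_mul_of_nonneg_right (le_max_left _ _) (decay_pos r).le)
  have hk' : ∀ r, ‖kap (fun s : ℝ => (s : ℂ) * θ s) r‖ ≤ K * decay r := fun r => (hk₂ r).trans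
    (mul_le_mul_of_nonneg_right (le_max_right _ _) (decay_pos r).le)
  obtain ⟨B, hB⟩ := hθ.exists_bound
  -- The `8` is `6 + 1 + 1`: the derivative of the localized low factor costs `6 N`, and each of the
  -- two commutators costs at most `1 ≤ N`.
  set T : ℝ := 8 * (81 * Real.pi ^ 2 * K * K) with hT
  set R : ℝ := √(250000 * (2 * B ^ 2 * 117)) with hR
  -- The summand `1` only makes the constant visibly positive, since `R` may vanish if `B` does.
  refine ⟨(4 * c ^ 5)⁻¹ * (R * T * (K ^ 2 * Real.pi)) + 1, by positivity, ?_⟩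
  intro i J M₁ M₂ M₃ σ₁ σ₂ e he hJ hM₁ hM₂ hM₃ hσ₁ hσ₂ f g h hf hg hh hfs hgs hhs u hu b
  set N : ℝ := 2 ^ i with hN
  have hN1 : 1 ≤ N := one_le_pow₀ one_le_two
  have hJ0 : 0 < J := by linarith
  set a₁ : SpaceTime := N⁻¹ • lift e with ha₁
  set a₂ : SpaceTime := N⁻¹ • lift (perp e) with ha₂
  have hcoef : ∀ {w : EuclideanSpace ℝ (Fin 2)}, ‖w‖ = 1 →
      ‖Complex.I * (((N⁻¹ • lift w : SpaceTime) (sp b) : ℝ) : ℂ)‖ₑ ≤ 1 := fun {w} hw => by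
    rw [← ofReal_norm]
    refine ENNReal.ofReal_le_one.2 ?_
    rw [norm_mul, Complex.norm_I, one_mul, Complex.norm_real, Real.norm_eq_abs, PiLp.smul_apply,
      smul_eq_mul, abs_mul, abs_of_pos (by positivity)]
    exact mul_le_one₀ (inv_le_one_of_one_le₀ hN1) (abs_nonneg _) (abs_coord_lift_le hw b)
  have hfm := hf.continuous_synth.measurable
  have hgm := hg.continuous_synth.measurable
  have hhm := hh.continuous_synth.measurable
  have hXm := (hf.symb b).continuous_synth.measurable
  -- the low frequency factor
  set E : (ℝ → ℂ) → (ℝ → ℂ) → ℝ → ℝ → ℝ≥0∞ := fun θ₁ θ₂ y₁ y₂ =>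
    eLpNorm (fun z => kap θ₁ (inner ℝ z a₁ - y₁) * (kap θ₂ (inner ℝ z a₂ - y₂) * synth f z)) 2
      volume with hE
  have hEcut : ∀ {θ₁ θ₂ : ℝ → ℂ}, Profile θ₁ → Profile θ₂ → ∀ y₁ y₂,
      eLpNorm (cut a₁ θ₁ y₁ (cut a₂ θ₂ y₂ f)) 2 volume = E θ₁ θ₂ y₁ y₂ :=
    fun {θ₁ θ₂} h₁ h₂ y₁ y₂ => by
      rw [← ((hf.cut h₂ a₂ y₂).cut h₁ a₁ y₁).eLpNorm_synth]
      congr 1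
      ext z
      rw [synth_cut h₁ (hf.cut h₂ a₂ y₂), synth_cut h₂ hf]
  have hEm : ∀ {θ₁ θ₂ : ℝ → ℂ}, Profile θ₁ → Profile θ₂ → ∀ y₂,
      Measurable fun y₁ => E θ₁ θ₂ y₁ y₂ := fun {θ₁ θ₂} h₁ h₂ y₂ => by
    have := (continuous_kap h₁).measurable
    have := (continuous_kap h₂).measurable
    exact measurable_eLpNorm_param (G := fun (y₁ : ℝ) (z : SpaceTime) =>
      kap θ₁ (inner ℝ z a₁ - y₁) * (kap θ₂ (inner ℝ z a₂ - y₂) * synth f z))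
      (by unfold Function.uncurry; fun_prop)
  have hEint : ∀ {θ₁ θ₂ : ℝ → ℂ}, (∀ r, ‖kap θ₁ r‖ ≤ K * decay r) →
      (∀ r, ‖kap θ₂ r‖ ≤ K * decay r) → ∀ y₂, ∫⁻ y₁, E θ₁ θ₂ y₁ y₂ ≤
        ENNReal.ofReal (81 * Real.pi ^ 2 * K * K) * decayNorm i u := fun {θ₁ θ₂} h₁ h₂ y₂ =>
    lintegral_eLpNorm_cutoff_le i u hu he hK.le hK.le h₁ h₂ y₂
  set θ' : ℝ → ℂ := fun s => (s : ℂ) * θ s with hθ'def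
  set s₁ : ℝ := 250000 * N * (M₁ * M₂) / J with hs₁
  have hs₁0 : 0 ≤ s₁ := by positivity
  set s₃ : ℝ := 2 * B ^ 2 * (117 * N * M₃ / J) with hs₃
  have hs₃0 : 0 ≤ s₃ := by positivity
  -- the bilinear estimate
  have hlow : ∀ {θ₁ θ₂ : ℝ → ℂ}, Profile θ₁ → Profile θ₂ → ∀ y₁ y₂ ζ,
      cut a₁ θ₁ y₁ (cut a₂ θ₂ y₂ f) ζ ≠ 0 → LowTube e N σ₁ M₁ 3 ζ := fun {θ₁ θ₂} h₁ h₂ y₁ y₂ ζ hζ =>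
    lowTube_of_cut he hN1 hM₁ hσ₁ hfs h₁ h₂ y₁ y₂ hζ
  have hbil : ∀ y₂ {F : SpaceTime → ℂ}, Band F → (∀ ζ, F ζ ≠ 0 → LowTube e N σ₁ M₁ 3 ζ) →
      eLpNorm (fun z => synth F z * synth (cut a₂ θ y₂ g) z) 2 volume ≤
        ENNReal.ofReal √s₁ * (eLpNorm F 2 volume * eLpNorm (cut a₂ θ y₂ g) 2 volume) :=
    fun y₂ {F} hF hFs => by
      refine eLpNorm_le_sqrt_mul hs₁0 (nsq_synth_mul_le hF (hg.cut hθ a₂ y₂) fun ζ => ?_)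
      exact volume_low_high_le he hN1 hJ hM₁ hM₂ hσ₁ hσ₂ hF.measurable (hg.cut hθ a₂ y₂).measurable
        hFs (fun ζ hζ => highTube_of_cut he hN1 hM₂ hσ₂ hgs hθ y₂ hζ) ζ
  have hD : ∀ y₁ y₂, eLpNorm (fun z => (kap θ (inner ℝ z a₁ - y₁) *
      (kap θ (inner ℝ z a₂ - y₂) * synth (symb b f) z)) *
        (kap θ (inner ℝ z a₂ - y₂) * synth g z)) 2 volume ≤
      ENNReal.ofReal √s₁ * eLpNorm (cut a₂ θ y₂ g) 2 volume *
        (ENNReal.ofReal (6 * N) * E θ θ y₁ y₂ + E θ' θ y₁ y₂ + E θ θ' y₁ y₂) := fun y₁ y₂ => by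
    set V := cut a₂ θ y₂ g with hV
    have hVb : Band V := hg.cut hθ a₂ y₂
    have b2 := hf.cut hθ a₂ y₂
    have b2' := hf.cut hθ' a₂ y₂
    have b0 := b2.cut hθ a₁ y₁
    have b1 := b2.cut hθ' a₁ y₁
    have b3 := b2'.cut hθ a₁ y₁
    -- The Leibniz rule for both cut-offs: the derivative falls on the localized function, up to two
    -- terms in which one profile `θ` is replaced by `θ'`, that is, `s θ(s)`, with coefficients
    -- `O(1/N)`.
    have heq : (fun z => (kap θ (inner ℝ z a₁ - y₁) *
        (kap θ (inner ℝ z a₂ - y₂) * synth (symb b f) z)) *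
          (kap θ (inner ℝ z a₂ - y₂) * synth g z)) =
        ((fun z => synth (symb b (cut a₁ θ y₁ (cut a₂ θ y₂ f))) z * synth V z) -
          (Complex.I * (a₁ (sp b) : ℝ)) •
            (fun z => synth (cut a₁ θ' y₁ (cut a₂ θ y₂ f)) z * synth V z)) -
          (Complex.I * (a₂ (sp b) : ℝ)) •
            (fun z => synth (cut a₁ θ y₁ (cut a₂ θ' y₂ f)) z * synth V z) := by
      ext z
      have e1 := kap_mul_synth_symb hθ hf a₂ y₂ b z
      have e2 := kap_mul_synth_symb hθ b2 a₁ y₁ b z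
      have e3 := synth_cut hθ b2' a₁ y₁ z
      have e4 := synth_cut hθ hg a₂ y₂ z
      simp only [Pi.sub_apply, Pi.smul_apply, smul_eq_mul]
      rw [e1, ← e4, mul_sub, e2, e3]
      ring
    have hmeas : ∀ {F : SpaceTime → ℂ}, Band F →
        AEStronglyMeasurable (fun z => synth F z * synth V z) volume := fun hF =>
      (hF.continuous_synth.mul hVb.continuous_synth).aestronglyMeasurable
    rw [heq]
    refine (eLpNorm_sub_le ((hmeas (b0.symb b)).sub ((hmeas b1).const_smul _))
      ((hmeas b3).const_smul _) one_le_two).trans ?_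
    refine (add_le_add (eLpNorm_sub_le (hmeas (b0.symb b)) ((hmeas b1).const_smul _)
      one_le_two) le_rfl).trans ?_
    rw [eLpNorm_const_smul, eLpNorm_const_smul]
    have c0 : eLpNorm (symb b (cut a₁ θ y₁ (cut a₂ θ y₂ f))) 2 volume ≤
        ENNReal.ofReal (6 * N) * E θ θ y₁ y₂ := by
      rw [← hEcut hθ hθ]
      refine eLpNorm_symb_le b fun ζ hζ => ?_
      obtain ⟨l1, l2, -⟩ := hlow hθ hθ y₁ y₂ ζ hζ
      refine abs_le_of_sq_le_sq' (b := 6 * N) ?_ (by linarith) |>.2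
      rw [norm_space_sq_eq_frame he]
      have m1 := sq_le_sq' (abs_le.1 l1).1 (abs_le.1 l1).2
      have m2 := sq_le_sq' (abs_le.1 l2).1 (abs_le.1 l2).2
      nlinarith
    have d0 := hbil y₂ (b0.symb b) fun ζ hζ =>
      hlow hθ hθ y₁ y₂ ζ fun h0 => hζ (by simp [symb, h0])
    have d1 := hbil y₂ b1 (hlow hθ' hθ y₁ y₂)
    have d3 := hbil y₂ b3 (hlow hθ hθ' y₁ y₂)
    rw [hEcut hθ' hθ] at d1
    rw [hEcut hθ hθ'] at d3
    calc _ ≤ ENNReal.ofReal √s₁ * ((ENNReal.ofReal (6 * N) * E θ θ y₁ y₂) * eLpNorm V 2 volume) +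
          1 * (ENNReal.ofReal √s₁ * (E θ' θ y₁ y₂ * eLpNorm V 2 volume)) +
          1 * (ENNReal.ofReal √s₁ * (E θ θ' y₁ y₂ * eLpNorm V 2 volume)) := by
          refine add_le_add (add_le_add (d0.trans ?_) (mul_le_mul' (hcoef he) d1))
            (mul_le_mul' (hcoef (norm_perp he)) d3)
          gcongr
      _ = _ := by ring
  -- local smoothing
  have hW : ∀ y₁ y₂, eLpNorm (fun z => kap θ (inner ℝ z a₁ - y₁) *
      (kap θ (inner ℝ z a₂ - y₂) * synth h z)) 2 volume ≤
        ENNReal.ofReal √s₃ * eLpNorm (cut a₂ θ y₂ h) 2 volume := fun y₁ y₂ => by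
    have b2 := hh.cut hθ a₂ y₂
    have e1 : (fun z => kap θ (inner ℝ z a₁ - y₁) * (kap θ (inner ℝ z a₂ - y₂) * synth h z)) =
        synth (cut a₁ θ y₁ (cut a₂ θ y₂ h)) := by
      ext z
      rw [synth_cut hθ b2, synth_cut hθ hh]
    rw [e1, (b2.cut hθ a₁ y₁).eLpNorm_synth]
    refine le_of_sq_le_sq ?_
    rw [mul_pow, ← nsq_eq, ← nsq_eq, ← ENNReal.ofReal_pow (Real.sqrt_nonneg _), Real.sq_sqrt hs₃0]
    refine (nsq_cut_le hθ hB b2.measurable a₁ y₁ fun ζ => volume_line_high_le he hN1 hJ0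
      (σ := 1) (by simp)
      (fun ζ hζ => highTube_of_cut he hN1 hM₃ (by simp) hhs hθ y₂ hζ) ζ).trans_eq ?_
    have hB2 : ENNReal.ofReal ((B : ℝ) ^ 2) = (B : ℝ≥0∞) ^ 2 := by
      rw [ENNReal.ofReal_pow B.coe_nonneg, ENNReal.ofReal_coe_nnreal]
    rw [hs₃, ENNReal.ofReal_mul (by positivity), ENNReal.ofReal_mul (by positivity), hB2,
      ENNReal.ofReal_ofNat]
  -- summation over the cut-offs
  have hTot : ∀ y₂, ∫⁻ y₁, (ENNReal.ofReal (6 * N) * E θ θ y₁ y₂ + E θ' θ y₁ y₂ + E θ θ' y₁ y₂) ≤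
      ENNReal.ofReal (N * T) * decayNorm i u := fun y₂ => by
    have m1 := hEm hθ hθ y₂
    have m2 := hEm hθ' hθ y₂
    have m3 := hEm hθ hθ' y₂
    rw [lintegral_add_right _ m3, lintegral_add_right _ m2, lintegral_const_mul _ m1]
    set D := ENNReal.ofReal (81 * Real.pi ^ 2 * K * K) * decayNorm i u with hDdef
    have hN1' : (1 : ℝ≥0∞) ≤ ENNReal.ofReal N := ENNReal.one_le_ofReal.2 hN1
    calc _ ≤ ENNReal.ofReal (6 * N) * D + D + D :=
          add_le_add (add_le_add (mul_le_mul_right (hEint hk hk y₂) _) (hEint hk' hk y₂))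
            (hEint hk hk' y₂)
      _ = (ENNReal.ofReal (6 * N) + 1 + 1) * D := by ring
      _ ≤ (ENNReal.ofReal (6 * N) + ENNReal.ofReal N + ENNReal.ofReal N) * D := by gcongr
      _ = _ := by
          rw [← ENNReal.ofReal_add (by positivity) (by positivity),
            ← ENNReal.ofReal_add (by positivity) (by positivity), hDdef, ← mul_assoc,
            ← ENNReal.ofReal_mul (by positivity), hT]
          congr 2
          ring
  have hmain := lintegral_mul_le_cutoff hθ hc a₁ a₂ hXm hgm hhm
  have hcutg : ∀ y₂, eLpNorm (cut a₂ θ y₂ g) 2 volume =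
      eLpNorm (fun z => kap θ (inner ℝ z a₂ - y₂) * synth g z) 2 volume := fun y₂ => by
    rw [← (hg.cut hθ a₂ y₂).eLpNorm_synth]
    congr 1
    ext z
    rw [synth_cut hθ hg]
  have hcuth : ∀ y₂, eLpNorm (cut a₂ θ y₂ h) 2 volume =
      eLpNorm (fun z => kap θ (inner ℝ z a₂ - y₂) * synth h z) 2 volume := fun y₂ => by
    rw [← (hh.cut hθ a₂ y₂).eLpNorm_synth]
    congr 1
    ext z
    rw [synth_cut hθ hh]
  have hfinal : 4 * ENNReal.ofReal c ^ 5 *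
      ∫⁻ z, ‖synth (symb b f) z‖ₑ * ‖synth g z‖ₑ * ‖synth h z‖ₑ ≤
        ENNReal.ofReal (√s₁ * √s₃ * (N * T) * (K ^ 2 * Real.pi)) * decayNorm i u *
          (eLpNorm g 2 volume * eLpNorm h 2 volume) := by
    refine hmain.trans ?_
    -- After both gains are used, the high factors depend on `y₂` alone. Integration in `y₁` meets
    -- only the low factor and yields the decay norm uniformly in `y₂`; Cauchy–Schwarz in `y₂`
    -- treats `g` and `h`.
    calc _ ≤ ∫⁻ y₂, ∫⁻ y₁, (ENNReal.ofReal √s₁ * ENNReal.ofReal √s₃ *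
          (eLpNorm (cut a₂ θ y₂ g) 2 volume * eLpNorm (cut a₂ θ y₂ h) 2 volume)) *
            (ENNReal.ofReal (6 * N) * E θ θ y₁ y₂ + E θ' θ y₁ y₂ + E θ θ' y₁ y₂) := by
          refine lintegral_mono fun y₂ => lintegral_mono fun y₁ => ?_
          refine (mul_le_mul' (hD y₁ y₂) (hW y₁ y₂)).trans_eq ?_
          ring
      _ ≤ ∫⁻ y₂, (ENNReal.ofReal √s₁ * ENNReal.ofReal √s₃ * (ENNReal.ofReal (N * T) *
          decayNorm i u)) *
          (eLpNorm (cut a₂ θ y₂ g) 2 volume * eLpNorm (cut a₂ θ y₂ h) 2 volume) := by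
          refine lintegral_mono fun y₂ => ?_
          rw [lintegral_const_mul]
          · refine (mul_le_mul_right (hTot y₂) _).trans_eq ?_
            ring
          · have m1 := hEm hθ hθ y₂
            have m2 := hEm hθ' hθ y₂
            have m3 := hEm hθ hθ' y₂
            fun_prop
      _ ≤ (ENNReal.ofReal √s₁ * ENNReal.ofReal √s₃ * (ENNReal.ofReal (N * T) *
          decayNorm i u)) * (ENNReal.ofReal (K ^ 2 * Real.pi) *
            (eLpNorm g 2 volume * eLpNorm h 2 volume)) := by
          have hkm := (continuous_kap hθ).measurable
          simp only [hcutg, hcuth]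
          rw [lintegral_const_mul]
          · gcongr
            have := lintegral_cutoff_mul_le hθ hk a₂ hgm hhm
            rwa [hg.eLpNorm_synth, hh.eLpNorm_synth] at this
          · refine Measurable.mul ?_ ?_
            · exact measurable_eLpNorm_param (G := fun (y : ℝ) (z : SpaceTime) =>
                kap θ (inner ℝ z a₂ - y) * synth g z) (by unfold Function.uncurry; fun_prop)
            · exact measurable_eLpNorm_param (G := fun (y : ℝ) (z : SpaceTime) =>
                kap θ (inner ℝ z a₂ - y) * synth h z) (by unfold Function.uncurry; fun_prop)
      _ = _ := by
          rw [ENNReal.ofReal_mul (p := √s₁ * √s₃ * (N * T)) (by positivity),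
            ENNReal.ofReal_mul (p := √s₁ * √s₃) (by positivity),
            ENNReal.ofReal_mul (p := √s₁) (by positivity)]
          ring
  have hsqrt : √s₁ * √s₃ = R * (N * √(M₁ * M₂ * M₃) / J) := by
    have : s₁ * s₃ = (250000 * (2 * B ^ 2 * 117)) * ((N / J) ^ 2 * (M₁ * M₂ * M₃)) := by
      rw [hs₁, hs₃]
      field_simp
    rw [← Real.sqrt_mul hs₁0, this, Real.sqrt_mul (x := 250000 * (2 * (B : ℝ) ^ 2 * 117)) (by positivity),
      Real.sqrt_mul (x := (N / J) ^ 2) (by positivity), Real.sqrt_sq (by positivity)]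
    ring
  have hc5 : (4 : ℝ≥0∞) * ENNReal.ofReal c ^ 5 = ENNReal.ofReal (4 * c ^ 5) := by
    rw [ENNReal.ofReal_mul (by norm_num), ENNReal.ofReal_pow hc0.le, ENNReal.ofReal_ofNat]
  rw [hc5] at hfinal
  set I := ∫⁻ z, ‖synth (symb b f) z‖ₑ * ‖synth g z‖ₑ * ‖synth h z‖ₑ
  have hc50 : 0 < 4 * c ^ 5 := by positivity
  calc I = ENNReal.ofReal (4 * c ^ 5)⁻¹ * (ENNReal.ofReal (4 * c ^ 5) * I) := by
        rw [← mul_assoc, ← ENNReal.ofReal_mul (by positivity), inv_mul_cancel₀ hc50.ne',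
          ENNReal.ofReal_one, one_mul]
    _ ≤ ENNReal.ofReal (4 * c ^ 5)⁻¹ * (ENNReal.ofReal (√s₁ * √s₃ * (N * T) * (K ^ 2 * Real.pi)) *
          decayNorm i u * (eLpNorm g 2 volume * eLpNorm h 2 volume)) := by gcongr
    _ = ENNReal.ofReal ((4 * c ^ 5)⁻¹ * (R * T * (K ^ 2 * Real.pi)) *
          (N ^ 2 * √(M₁ * M₂ * M₃) / J)) * decayNorm i u *
            (eLpNorm g 2 volume * eLpNorm h 2 volume) := by
        have hq : (4 * c ^ 5)⁻¹ * (R * T * (K ^ 2 * Real.pi)) * (N ^ 2 * √(M₁ * M₂ * M₃) / J) =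
            (4 * c ^ 5)⁻¹ * (√s₁ * √s₃ * (N * T) * (K ^ 2 * Real.pi)) := by
          rw [hsqrt]
          ring
        rw [hq, ENNReal.ofReal_mul (p := (4 * c ^ 5)⁻¹) (by positivity)]
        ring
    _ ≤ _ := by
        gcongr
        linarith

end DNLS

end

noncomputable section

namespace DNLS

/-! ### Localization of the output frequency -/

theorem integral_hatL1_mul {f g : SpaceTime → ℂ} (hf : Integrable f) (hg : Integrable g) :
    ∫ ζ, hatL1 f ζ * g ζ = ∫ z, f z * hatL1 g z := by
  set K : SpaceTime × SpaceTime → ℂ := fun p =>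
    Complex.exp (-(inner ℝ p.2 p.1 : ℝ) * Complex.I) * (g p.1 * f p.2) with hK
  have hKi : Integrable K (volume.prod volume) := by
    refine (hg.mul_prod hf).bdd_mul (c := 1) ?_ (.of_forall fun p => ?_)
    · exact Continuous.aestronglyMeasurable (by fun_prop)
    · rw [← Complex.ofReal_neg, Complex.norm_exp_ofReal_mul_I]
  calc ∫ ζ, hatL1 f ζ * g ζ = ∫ ζ, angularConst * ∫ z, K (ζ, z) := by
        refine integral_congr_ae (.of_forall fun ζ => ?_)
        simp only [hatL1_eq_integral, hK]
        rw [mul_assoc, ← integral_mul_const]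
        congr 2
        ext z
        ring
    _ = angularConst * ∫ z, ∫ ζ, K (ζ, z) := by
        rw [integral_const_mul, integral_integral_swap hKi]
    _ = _ := by
        rw [← integral_const_mul]
        refine integral_congr_ae (.of_forall fun z => ?_)
        simp only [hatL1_eq_integral, hK]
        rw [mul_left_comm (f z), ← integral_const_mul (f z)]
        congr 1
        refine integral_congr_ae (.of_forall fun ζ => ?_)
        simp only [real_inner_comm z ζ]
        ring

theorem Band.star {f : SpaceTime → ℂ} (hf : Band f) : Band (fun ζ => star (f ζ)) := by
  refine ⟨continuous_star.measurable.comp hf.measurable, ?_, ?_⟩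
  · exact (memLp_congr_norm (continuous_star.measurable.comp hf.measurable).aestronglyMeasurable
      hf.measurable.aestronglyMeasurable (.of_forall fun ζ => norm_star _)).2 hf.memLp
  · obtain ⟨R, hR⟩ := hf.bounded
    exact ⟨R, fun ζ hζ => hR ζ fun h => hζ (by simp [h])⟩

theorem hatL1_star (f : SpaceTime → ℂ) (z : SpaceTime) :
    hatL1 (fun ζ => star (f ζ)) z = star (synth f z) := by
  rw [hatL1_eq_integral, synth_eq_integral]
  simp only [star_mul', Complex.star_def, Complex.conj_ofReal]
  congr 1
  rw [← integral_conj]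
  congr 1
  ext ζ
  rw [map_mul, ← Complex.exp_conj, map_mul, Complex.conj_ofReal, Complex.conj_I, real_inner_comm]
  simp

theorem nsq_eq_ofReal_integral {f : SpaceTime → ℂ} (hf : MemLp f 2) :
    nsq f = ENNReal.ofReal (∫ ζ, ‖f ζ‖ ^ 2) := by
  rw [ofReal_integral_eq_lintegral_ofReal hf.norm.integrable_sq (.of_forall fun ζ => by positivity)]
  refine lintegral_congr fun ζ => ?_
  rw [← ofReal_norm, ENNReal.ofReal_pow (norm_nonneg _)]

/-- The `L²` norm of a part of the Fourier transform of a product, by duality. -/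
theorem nsq_indicator_le {f g : SpaceTime → ℂ} (hf : Band f) (hg : Band g) {E : Set SpaceTime}
    (hh : Band (E.indicator (hatL1 fun z => synth f z * synth g z))) :
    nsq (E.indicator (hatL1 fun z => synth f z * synth g z)) ≤
      ∫⁻ z, ‖synth f z‖ₑ * ‖synth g z‖ₑ *
        ‖synth (E.indicator (hatL1 fun z => synth f z * synth g z)) z‖ₑ := by
  set P : SpaceTime → ℂ := fun z => synth f z * synth g z with hP
  set h := E.indicator (hatL1 P) with hhdef
  have h1 : ((∫ ζ, ‖h ζ‖ ^ 2 : ℝ) : ℂ) = ∫ z, P z * star (synth h z) := by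
    simp only [← hatL1_star]
    rw [← integral_hatL1_mul (hf.synth_mul_integrable hg) hh.star.integrable, ← integral_complex_ofReal]
    refine integral_congr_ae (.of_forall fun ζ => ?_)
    by_cases hζ : ζ ∈ E
    · simp only [hhdef, Set.indicator_of_mem hζ]
      rw [Complex.star_def, Complex.mul_conj, Complex.normSq_eq_norm_sq]
    · simp [hhdef, Set.indicator_of_notMem hζ]
  rw [nsq_eq_ofReal_integral hh.memLp]
  calc _ ≤ ENNReal.ofReal ‖((∫ ζ, ‖h ζ‖ ^ 2 : ℝ) : ℂ)‖ := by
        rw [Complex.norm_real]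
        exact ENNReal.ofReal_le_ofReal (le_abs_self _)
    _ = ‖∫ z, P z * star (synth h z)‖ₑ := by rw [h1, ofReal_norm]
    _ ≤ ∫⁻ z, ‖P z * star (synth h z)‖ₑ := enorm_integral_le_lintegral_enorm _
    _ = _ := by
        have hs : ∀ w : ℂ, ‖star w‖ₑ = ‖w‖ₑ := fun w => by
          rw [← ofReal_norm, norm_star, ofReal_norm]
        simp only [hP, enorm_mul, hs]

theorem Band.indicator {f : SpaceTime → ℂ} (hf : Band f) {S : Set SpaceTime}
    (hS : MeasurableSet S) : Band (S.indicator f) := by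
  refine ⟨hf.measurable.indicator hS, hf.memLp.indicator hS, ?_⟩
  obtain ⟨R, hR⟩ := hf.bounded
  exact ⟨R, fun ζ hζ => hR ζ (Set.indicator_apply_ne_zero.1 hζ).2⟩

theorem band_indicator_hatL1 {f g : SpaceTime → ℂ} (hf : Band f) (hg : Band g) {E : Set SpaceTime}
    (hE : MeasurableSet E) (hb : Bornology.IsBounded E) :
    Band (E.indicator (hatL1 fun z => synth f z * synth g z)) := by
  have hc := continuous_hatL1 (hf.synth_mul_integrable hg)
  refine ⟨hc.measurable.indicator hE,
    (hatL1_memLp (hf.synth_mul_integrable hg) (hf.synth_mul_memLp hg)).indicator hE, ?_⟩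
  obtain ⟨R, hR⟩ := hb.exists_norm_le
  exact ⟨R, fun ζ hζ => hR ζ (Set.mem_of_indicator_ne_zero hζ)⟩

/-- In the convolution, outputs in `E` only see `g` at the points `ζ - η` with `η` in the support of
`f`. -/
theorem indicator_hatL1_localize {f g : SpaceTime → ℂ} (hf : Band f) (hg : Band g)
    {E S : Set SpaceTime} (hS : MeasurableSet S) (h : ∀ ζ ∈ E, ∀ η, f η ≠ 0 → ζ - η ∈ S) :
    E.indicator (hatL1 fun z => synth f z * synth g z) =
      E.indicator (hatL1 fun z => synth f z * synth (S.indicator g) z) := by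
  refine Set.indicator_congr fun ζ hζ => ?_
  rw [hatL1_synth_mul hf hg, hatL1_synth_mul hf (hg.indicator hS)]
  congr 2
  ext η
  by_cases hη : f η = 0
  · simp [hη]
  · rw [Set.indicator_of_mem (h ζ hζ η hη)]

/-! ### Frequency squares: their directions and their bounded overlap. -/

theorem inner_lift_eq (z : SpaceTime) (w : EuclideanSpace ℝ (Fin 2)) :
    (inner ℝ z (lift w) : ℝ) = inner ℝ (space z) w := by
  rw [inner_lift, inner_two]
  rfl

theorem inner_perp_self (e : EuclideanSpace ℝ (Fin 2)) : (inner ℝ e (perp e) : ℝ) = 0 := by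
  rw [inner_two]
  simp [perp]
  ring

/-- Take `e = ξ / ‖ξ‖`. Moving by at most `4 N ≤ J/8` keeps the component along `e` above `J/4 - J/8
≥ J/9` and the transverse one below `4 N`. -/
theorem exists_direction {N J : ℝ} (hN : 1 ≤ N) (hJ : 32 * N ≤ J) {ξ : EuclideanSpace ℝ (Fin 2)}
    (hξ : J / 4 ≤ ‖ξ‖) : ∃ e : EuclideanSpace ℝ (Fin 2), ‖e‖ = 1 ∧
      ∀ ζ : SpaceTime, ‖space ζ - ξ‖ ≤ 4 * N →
        J / 9 ≤ inner ℝ ζ (lift e) ∧ |inner ℝ ζ (lift (perp e))| ≤ 5 * N := by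
  have hξ0 : 0 < ‖ξ‖ := by linarith
  set e := ‖ξ‖⁻¹ • ξ with he
  have he1 : ‖e‖ = 1 := by
    rw [he, norm_smul, norm_inv, norm_norm, inv_mul_cancel₀ hξ0.ne']
  have hξe : ξ = ‖ξ‖ • e := by rw [he, smul_inv_smul₀ hξ0.ne']
  refine ⟨e, he1, fun ζ hζ => ?_⟩
  have h1 : (inner ℝ ξ e : ℝ) = ‖ξ‖ := by
    conv_lhs => rw [hξe]
    rw [real_inner_smul_left, real_inner_self_eq_norm_sq, he1]
    ring
  have h2 : (inner ℝ ξ (perp e) : ℝ) = 0 := by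
    rw [hξe, real_inner_smul_left, inner_perp_self, mul_zero]
  have h3 := abs_real_inner_le_norm (space ζ - ξ) e
  have h4 := abs_real_inner_le_norm (space ζ - ξ) (perp e)
  rw [he1, mul_one, inner_sub_left, h1] at h3
  rw [norm_perp he1, mul_one, inner_sub_left, h2, sub_zero] at h4
  rw [inner_lift_eq, inner_lift_eq]
  refine ⟨?_, by linarith⟩
  have := (abs_le.1 h3).1
  linarith

theorem norm_space_sub_le_of_cube {i : ℕ} {m : Fin 2 → ℤ} {x y : EuclideanSpace ℝ (Fin 2)}
    (hx : x ∈ cube i m) (hy : y ∈ cube i m) : ‖x - y‖ ≤ 2 * 2 ^ i := by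
  have hN : (0 : ℝ) < 2 ^ i := by positivity
  refine abs_le_of_sq_le_sq' (b := (2 : ℝ) * 2 ^ i) ?_ (by positivity) |>.2
  rw [EuclideanSpace.norm_sq_eq, Fin.sum_univ_two]
  have h : ∀ a, ‖(x - y) a‖ ^ 2 ≤ (2 ^ i) ^ 2 := fun a => by
    rw [Real.norm_eq_abs, sq_abs, PiLp.sub_apply]
    obtain ⟨h1, h2⟩ := hx a
    obtain ⟨h3, h4⟩ := hy a
    exact sq_le_sq' (by linarith) (by linarith)
  linarith [h 0, h 1, sq_nonneg ((2 : ℝ) ^ i)]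

/-- The set of frequencies close to a cube. -/
def nearCube (i : ℕ) (m : Fin 2 → ℤ) : Set SpaceTime :=
  {ζ | ∀ a, |ζ (sp a) - 2 ^ i * m a| ≤ 5 * 2 ^ i}

theorem measurableSet_nearCube (i : ℕ) (m : Fin 2 → ℤ) : MeasurableSet (nearCube i m) := by
  have : nearCube i m = ⋂ a, {ζ : SpaceTime | |ζ (sp a) - 2 ^ i * m a| ≤ 5 * 2 ^ i} := by
    ext ζ
    simp [nearCube]
  rw [this]
  exact MeasurableSet.iInter fun a => measurableSet_le (by fun_prop) measurable_const

theorem one_le_decay {x : ℝ} (hx : |x| ≤ 5) : (1 : ℝ≥0∞) ≤ 26 * ENNReal.ofReal (decay x) := by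
  rw [← ENNReal.ofReal_ofNat, ← ENNReal.ofReal_mul (by norm_num), ENNReal.one_le_ofReal, decay,
    ← div_eq_mul_inv, le_div_iff₀ (by positivity)]
  have := sq_le_sq' (abs_le.1 hx).1 (abs_le.1 hx).2
  linarith

/-- Bounded overlap. The indicator is dominated by a product of two decay factors, one per
coordinate, where `26 = 1 + 5²`; each one-dimensional sum is at most `3 π`. -/
theorem tsum_nearCube_le (i : ℕ) (ζ : SpaceTime) :
    ∑' m, (nearCube i m).indicator (1 : SpaceTime → ℝ≥0∞) ζ ≤
      ENNReal.ofReal ((78 * Real.pi) ^ 2) := by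
  have hN : (0 : ℝ) < 2 ^ i := by positivity
  set r : Fin 2 → ℝ := fun a => ζ (sp a) / 2 ^ i with hr
  have h1 : ∀ m : Fin 2 → ℤ, (nearCube i m).indicator (1 : SpaceTime → ℝ≥0∞) ζ ≤
      (26 * ENNReal.ofReal (decay (m 0 - r 0))) * (26 * ENNReal.ofReal (decay (m 1 - r 1))) :=
    fun m => by
      by_cases h : ζ ∈ nearCube i m
      · rw [Set.indicator_of_mem h, Pi.one_apply, ← one_mul (1 : ℝ≥0∞)]
        have : ∀ a, |(m a : ℝ) - r a| ≤ 5 := fun a => by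
          have h2 := h a
          have h3 : ζ (sp a) = 2 ^ i * r a := by rw [hr]; field_simp
          rw [h3, ← mul_sub, abs_mul, abs_of_pos hN, abs_sub_comm, mul_comm] at h2
          exact le_of_mul_le_mul_right h2 hN
        exact mul_le_mul' (one_le_decay (this 0)) (one_le_decay (this 1))
      · rw [Set.indicator_of_notMem h]
        exact zero_le
  refine (ENNReal.tsum_le_tsum h1).trans ?_
  rw [← (finTwoArrowEquiv ℤ).symm.tsum_eq]
  simp only [finTwoArrowEquiv_symm_apply, Matrix.cons_val_zero, Matrix.cons_val_one]
  rw [ENNReal.tsum_prod (f := fun k l : ℤ => 26 * ENNReal.ofReal (decay (k - r 0)) *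
    (26 * ENNReal.ofReal (decay (l - r 1))))]
  simp only [ENNReal.tsum_mul_left, ENNReal.tsum_mul_right]
  calc _ ≤ (26 * ENNReal.ofReal (3 * Real.pi)) * (26 * ENNReal.ofReal (3 * Real.pi)) :=
        mul_le_mul' (mul_le_mul_right (tsum_decay_le _) _) (mul_le_mul_right (tsum_decay_le _) _)
    _ = _ := by
        rw [← ENNReal.ofReal_ofNat, ← ENNReal.ofReal_mul (by norm_num),
          ← ENNReal.ofReal_mul (by positivity)]
        congr 1
        ring

theorem tsum_nsq_nearCube_le (i : ℕ) {g : SpaceTime → ℂ} (hg : Measurable g) :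
    ∑' m, nsq ((nearCube i m).indicator g) ≤ ENNReal.ofReal ((78 * Real.pi) ^ 2) * nsq g := by
  unfold nsq
  rw [← lintegral_tsum fun m => by
    have := hg.indicator (measurableSet_nearCube i m)
    fun_prop, ← lintegral_const_mul _ (by fun_prop)]
  refine lintegral_mono fun ζ => ?_
  have : ∀ m, ‖(nearCube i m).indicator g ζ‖ₑ ^ 2 =
      (nearCube i m).indicator (1 : SpaceTime → ℝ≥0∞) ζ * ‖g ζ‖ₑ ^ 2 := fun m => by
    by_cases h : ζ ∈ nearCube i m <;> simp [h]
  simp only [this]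
  rw [ENNReal.tsum_mul_right]
  gcongr
  exact tsum_nearCube_le i ζ

/-- The interaction of a low and a high frequency, with an output close to the paraboloid. -/
theorem exists_low_high_estimate : ∃ C : ℝ, 0 < C ∧ ∀ (i : ℕ) (J M₁ M₂ M₃ σ₁ σ₂ : ℝ),
    32 * 2 ^ i ≤ J → 1 ≤ M₁ → 1 ≤ M₂ → 1 ≤ M₃ → |σ₁| = 1 → |σ₂| = 1 →
    ∀ (A : Set SpaceTime), MeasurableSet A → Bornology.IsBounded A →
    (∀ ζ ∈ A, J / 4 ≤ ‖space ζ‖ ∧ |modulation ζ| ≤ 2 * M₃) →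
    ∀ f g : SpaceTime → ℂ, Band f → Band g →
    (∀ ζ, f ζ ≠ 0 → ‖space ζ‖ ≤ 2 * 2 ^ i ∧ |time ζ - σ₁ * ‖space ζ‖ ^ 2| ≤ 2 * M₁) →
    (∀ ζ, g ζ ≠ 0 → |time ζ - σ₂ * ‖space ζ‖ ^ 2| ≤ 2 * M₂) →
    ∀ (u : L2), (∀ᵐ z, ‖synth f z‖ ≤ ‖u z‖) → ∀ b : Fin 2,
    eLpNorm (A.indicator (hatL1 fun z => synth (symb b f) z * synth g z)) 2 volume ≤
      ENNReal.ofReal (C * ((2 ^ i) ^ 2 * √(M₁ * M₂ * M₃) / J)) * decayNorm i u *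
        eLpNorm g 2 volume := by
  obtain ⟨C, hC, hcore⟩ := exists_core_estimate
  refine ⟨C * (78 * Real.pi), by positivity, ?_⟩
  intro i J M₁ M₂ M₃ σ₁ σ₂ hJ hM₁ hM₂ hM₃ hσ₁ hσ₂ A hA hAb hAs f g hf hg hfs hgs u hu b
  have hN : (1 : ℝ) ≤ 2 ^ i := one_le_pow₀ one_le_two
  have hJ0 : 0 < J := by linarith
  have hsb := hf.symb b
  set F := hatL1 fun z => synth (symb b f) z * synth g z with hF
  set D := ENNReal.ofReal (C * ((2 ^ i) ^ 2 * √(M₁ * M₂ * M₃) / J)) * decayNorm i u with hD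
  have hpiece : ∀ m, eLpNorm ((A ∩ space ⁻¹' cube i m).indicator F) 2 volume ≤
      D * eLpNorm ((nearCube i m).indicator g) 2 volume := fun m => by
    set E := A ∩ space ⁻¹' cube i m with hE
    have hEm : MeasurableSet E := hA.inter (measurable_space (measurableSet_cube i m))
    rcases E.eq_empty_or_nonempty with h0 | ⟨ζ₀, hζ₀A, hζ₀⟩
    · simp [h0]
    obtain ⟨e, he, hdir⟩ := exists_direction hN hJ (hAs ζ₀ hζ₀A).1
    set S : Set SpaceTime := {ζ | ‖space ζ - space ζ₀‖ ≤ 4 * 2 ^ i} with hS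
    have hSm : MeasurableSet S :=
      measurableSet_le (measurable_space.sub measurable_const).norm measurable_const
    have hEb := hAb.subset (Set.inter_subset_left (s := A) (t := space ⁻¹' cube i m))
    have hspace : ∀ ζ η : SpaceTime, space (ζ - η) = space ζ - space η := fun ζ η => rfl
    -- Outputs in one square are within `2 N` of `ζ₀` in space, and `f` has frequencies at most `2
    -- N`, so only frequencies of `g` within `4 N` of that of `ζ₀` contribute.
    have hloc : E.indicator F = E.indicator
        (hatL1 fun z => synth (symb b f) z * synth (S.indicator g) z) := by
      refine indicator_hatL1_localize hsb hg hSm fun ζ hζ η hη => ?_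
      have hη' : f η ≠ 0 := fun h => hη (by simp [symb, h])
      have h1 := norm_space_sub_le_of_cube hζ.2 hζ₀
      have h2 := (hfs η hη').1
      change ‖space (ζ - η) - space ζ₀‖ ≤ _
      rw [hspace, sub_right_comm]
      exact (norm_sub_le _ _).trans (by linarith)
    have hgS := hg.indicator hSm
    have hh := band_indicator_hatL1 hsb hgS hEm hEb
    have hdual := nsq_indicator_le hsb hgS hh
    rw [← hloc] at hdual hh
    have hest := hcore i J M₁ M₂ M₃ σ₁ σ₂ e he hJ hM₁ hM₂ hM₃ hσ₁ hσ₂ f (S.indicator g)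
      (E.indicator F) hf hgS hh hfs (fun ζ hζ => by
        obtain ⟨h1, h2⟩ := Set.indicator_apply_ne_zero.1 hζ
        exact ⟨(hdir ζ h1).1, (hdir ζ h1).2, hgs ζ h2⟩) (fun ζ hζ => by
        have h1 := Set.mem_of_indicator_ne_zero hζ
        have h2 := norm_space_sub_le_of_cube h1.2 hζ₀
        have h3 := hdir ζ (by linarith)
        rw [one_mul]
        exact ⟨h3.1, h3.2, (hAs ζ h1.1).2⟩) u hu b
    -- The piece is tested against itself: the square of its norm is at most `D ‖g‖` times its norm,
    -- and one factor is cancelled.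
    have hle := hdual.trans hest
    rw [nsq_eq, ← mul_assoc] at hle
    refine (le_of_sq_le_mul_self hle hh.memLp.2.ne).trans ?_
    gcongr
    -- Distance `4 N` from `ζ₀` plus distance `N/2` from `ζ₀` to the centre, per coordinate, stays
    -- within the `5 N` of `nearCube`.
    refine eLpNorm_mono fun ζ => ?_
    by_cases hζ : ζ ∈ S
    · have : ζ ∈ nearCube i m := fun a => by
        have h1 := (abs_coord_le_norm_space (ζ - ζ₀) a).trans hζ
        obtain ⟨h2, h3⟩ := hζ₀ a
        change |ζ (sp a) - ζ₀ (sp a)| ≤ _ at h1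
        change _ ≤ ζ₀ (sp a) at h2
        change ζ₀ (sp a) < _ at h3
        rw [abs_le] at h1 ⊢
        constructor <;> linarith [h1.1, h1.2]
      rw [Set.indicator_of_mem hζ, Set.indicator_of_mem this]
    · rw [Set.indicator_of_notMem hζ, norm_zero]
      exact norm_nonneg _
  refine le_of_sq_le_sq ?_
  -- The squares tile the output frequencies, so squared norms add up; on the right the enlarged
  -- squares overlap boundedly.
  calc eLpNorm (A.indicator F) 2 volume ^ 2 ≤
        ∑' m, eLpNorm ((A ∩ space ⁻¹' cube i m).indicator F) 2 volume ^ 2 := by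
        have h1 : ∀ B : Set SpaceTime, MeasurableSet B →
            eLpNorm (B.indicator F) 2 volume ^ 2 = ∫⁻ ζ in B, ‖F ζ‖ₑ ^ 2 := fun B hB => by
          rw [eLpNorm_indicator_eq_eLpNorm_restrict hB, eLpNorm_two_sq]
        rw [h1 A hA]
        simp only [fun m => h1 _ (hA.inter (measurable_space (measurableSet_cube i m)))]
        refine le_trans (le_of_eq ?_) (lintegral_iUnion_le _ _)
        congr 2
        rw [← Set.inter_iUnion, Set.eq_univ_of_forall (s := ⋃ m, space ⁻¹' cube i m)
          fun z => Set.mem_iUnion.2 (exists_mem_cube i (space z)), Set.inter_univ]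
    _ ≤ ∑' m, D ^ 2 * nsq ((nearCube i m).indicator g) := by
        refine ENNReal.tsum_le_tsum fun m => ?_
        rw [nsq_eq, ← mul_pow]
        exact pow_le_pow_left₀ zero_le (hpiece m) 2
    _ ≤ D ^ 2 * (ENNReal.ofReal ((78 * Real.pi) ^ 2) * nsq g) := by
        rw [ENNReal.tsum_mul_left]
        gcongr
        exact tsum_nsq_nearCube_le i hg.measurable
    _ = _ := by
        rw [nsq_eq, ENNReal.ofReal_pow (by positivity), ← mul_pow, ← mul_pow, hD,
          mul_comm C (78 * Real.pi), mul_assoc (78 * Real.pi),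
          ENNReal.ofReal_mul (p := 78 * Real.pi) (by positivity)]
        ring

end DNLS

end

noncomputable section

namespace DNLS

/-! ### Estimates for products of localized functions -/

/-- The functions supported at frequencies of size at most `N` and at distance `M` of a
paraboloid. -/
structure Localized (f : SpaceTime → ℂ) (N M σ : ℝ) : Prop where
  band : Band f
  one_le : 1 ≤ M
  abs_sign : |σ| = 1
  space_le : ∀ ζ, f ζ ≠ 0 → ‖space ζ‖ ≤ 2 * N
  time_le : ∀ ζ, f ζ ≠ 0 → |time ζ| ≤ 4 * N ^ 2
  modul_le : ∀ ζ, f ζ ≠ 0 → |time ζ - σ * ‖space ζ‖ ^ 2| ≤ 2 * M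
  le_space : 1024 * M ≤ N ^ 2 → ∀ ζ, f ζ ≠ 0 → N / 4 ≤ ‖space ζ‖

/-- On the Fourier side conjugation of a function reflects through the origin, which exchanges the
paraboloids `τ = σ |ξ|²` and `τ = -σ |ξ|²` and preserves all sizes. -/
theorem Localized.conj {f : SpaceTime → ℂ} {N M σ : ℝ} (h : Localized f N M σ) :
    Localized (fun ζ => star (f (-ζ))) N M (-σ) := by
  have h0 : ∀ ζ, star (f (-ζ)) ≠ 0 → f (-ζ) ≠ 0 := fun ζ hζ => star_ne_zero.1 hζ
  have hs : ∀ ζ, ‖space (-ζ)‖ = ‖space ζ‖ := fun ζ => norm_neg (space ζ)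
  have ht : ∀ ζ, time (-ζ) = -time ζ := fun ζ => rfl
  refine ⟨?_, h.one_le, by rw [abs_neg, h.abs_sign], fun ζ hζ => ?_, fun ζ hζ => ?_,
    fun ζ hζ => ?_, fun hM ζ hζ => ?_⟩
  · simpa using h.band.conj_reflect 0
  · rw [← hs]
    exact h.space_le _ (h0 ζ hζ)
  · rw [← abs_neg, ← ht]
    exact h.time_le _ (h0 ζ hζ)
  · have := h.modul_le _ (h0 ζ hζ)
    rw [hs, ht, ← abs_neg] at this
    convert this using 2
    ring
  · rw [← hs]
    exact h.le_space hM _ (h0 ζ hζ)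

theorem abs_inner_lift_le {w : EuclideanSpace ℝ (Fin 2)} (hw : ‖w‖ = 1) (z : SpaceTime) :
    |(inner ℝ z (lift w) : ℝ)| ≤ ‖space z‖ := by
  rw [inner_lift_eq]
  exact (abs_real_inner_le_norm _ _).trans_eq (by rw [hw, mul_one])

/-- A box with sides `4 N`, `4 N`, `8 N²`. The volume `128 N⁴` is rounded up to a perfect square
because its root is what Cauchy–Schwarz produces. -/
theorem volume_low_le {G : Set SpaceTime} (hG : MeasurableSet G) {N : ℝ} (hN : 0 ≤ N)
    (h : ∀ ζ ∈ G, ‖space ζ‖ ≤ 2 * N ∧ |time ζ| ≤ 4 * N ^ 2) :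
    volume G ≤ ENNReal.ofReal ((12 * N ^ 2) ^ 2) := by
  have he : ‖(EuclideanSpace.single 0 1 : EuclideanSpace ℝ (Fin 2))‖ = 1 := by simp
  refine (volume_le_of_slices he hG (Lq := 4 * N) (Lp := 4 * N) (Lt := 8 * N ^ 2) ?_ ?_ ?_).trans ?_
  · intro z hz w hw
    have h1 := abs_inner_lift_le (norm_perp he) z
    have h2 := abs_inner_lift_le (norm_perp he) w
    exact (abs_sub _ _).trans (by linarith [(h z hz).1, (h w hw).1])
  · intro z hz w hw _
    have h1 := abs_inner_lift_le he z
    have h2 := abs_inner_lift_le he w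
    exact (abs_sub _ _).trans (by linarith [(h z hz).1, (h w hw).1])
  · intro z hz w hw _ _
    exact (abs_sub _ _).trans (by linarith [(h z hz).2, (h w hw).2])
  · rw [← ENNReal.ofReal_mul (by positivity), ← ENNReal.ofReal_mul (by positivity)]
    refine ENNReal.ofReal_le_ofReal ?_
    nlinarith [pow_nonneg hN 4]

theorem eLpNorm_hatL1_le_of_low_input {f g : SpaceTime → ℂ} (hf : Band f) (hg : Band g) {N : ℝ}
    (hN : 0 ≤ N) (h : ∀ ζ, f ζ ≠ 0 → ‖space ζ‖ ≤ 2 * N ∧ |time ζ| ≤ 4 * N ^ 2) :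
    eLpNorm (hatL1 fun z => synth f z * synth g z) 2 volume ≤
      ENNReal.ofReal (12 * N ^ 2) * (eLpNorm f 2 volume * eLpNorm g 2 volume) := by
  have := eLpNorm_le_sqrt_mul (sq_nonneg _) (nsq_hatL1_synth_mul_le hf hg fun ζ =>
    (measure_mono fun η hη => hη.1).trans (volume_low_le
      (hf.measurable (measurableSet_singleton 0).compl) hN h))
  rwa [Real.sqrt_sq (by positivity)] at this

theorem nsq_indicator {A : Set SpaceTime} (hA : MeasurableSet A) (F : SpaceTime → ℂ) :
    nsq (A.indicator F) = ∫⁻ ζ in A, ‖F ζ‖ₑ ^ 2 := by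
  rw [nsq_eq, eLpNorm_indicator_eq_eLpNorm_restrict hA, eLpNorm_two_sq]

theorem eLpNorm_hatL1_le_of_low_output {f g : SpaceTime → ℂ} (hf : Band f) (hg : Band g)
    {A : Set SpaceTime} (hA : MeasurableSet A) {N : ℝ} (hN : 0 ≤ N)
    (h : ∀ ζ ∈ A, ‖space ζ‖ ≤ 2 * N ∧ |time ζ| ≤ 4 * N ^ 2) :
    eLpNorm (A.indicator (hatL1 fun z => synth f z * synth g z)) 2 volume ≤
      ENNReal.ofReal (12 * N ^ 2) * (eLpNorm f 2 volume * eLpNorm g 2 volume) := by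
  have hv := volume_low_le hA hN h
  have := eLpNorm_le_sqrt_mul (sq_nonneg _) ((nsq_indicator hA _).trans_le
    (lintegral_hatL1_synth_mul_le hf hg hA (ne_top_of_le_ne_top ENNReal.ofReal_ne_top hv) fun ζ =>
      (measure_mono fun η hη => hη.1).trans hv))
  rwa [Real.sqrt_sq (by positivity)] at this

/-- The points `ζ - η` lie within `4 N` of one high frequency, hence share a direction `e` along
which the paraboloid has slope at least `2 J/9`. With time confined to `8 N²` and the modulation to
a window of length `4 M`, the coordinate along `e` ranges over `(8 N² + 4 M)/(2 J/9)`, and time at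
fixed frequency over the smaller of the two lengths. -/
theorem volume_low_output_le {A : Set SpaceTime} (hA : MeasurableSet A) {N J M σ : ℝ} (hN : 1 ≤ N)
    (hJ : 32 * N ≤ J) (hM : 1 ≤ M) (hσ : |σ| = 1)
    (h : ∀ ζ ∈ A, ‖space ζ‖ ≤ 2 * N ∧ |time ζ| ≤ 4 * N ^ 2) {g : SpaceTime → ℂ}
    (hg : Measurable g)
    (hgs : ∀ ζ, g ζ ≠ 0 → J / 4 ≤ ‖space ζ‖ ∧ |time ζ - σ * ‖space ζ‖ ^ 2| ≤ 2 * M)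
    (η : SpaceTime) :
    volume {ζ | ζ ∈ A ∧ g (ζ - η) ≠ 0} ≤ ENNReal.ofReal (1152 * N ^ 3 * M / J) := by
  have hJ0 : 0 < J := by linarith
  set G := {ζ | ζ ∈ A ∧ g (ζ - η) ≠ 0} with hGdef
  have hG : MeasurableSet G :=
    hA.inter ((hg.comp (measurable_id.sub measurable_const)) (measurableSet_singleton 0).compl)
  rcases G.eq_empty_or_nonempty with h0 | ⟨ζ₀, hζ₀, hgζ₀⟩
  · simp [h0]
  obtain ⟨e, he, hdir⟩ := exists_direction hN hJ (hgs _ hgζ₀).1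
  have hlow : ∀ ζ ∈ G, J / 9 ≤ inner ℝ (ζ - η) (lift e) := fun ζ hζ => by
    refine (hdir _ ?_).1
    change ‖(space ζ - space η) - (space ζ₀ - space η)‖ ≤ _
    rw [sub_sub_sub_cancel_right]
    exact (norm_sub_le _ _).trans (by linarith [(h ζ hζ.1).1, (h ζ₀ hζ₀).1])
  have hmin : 0 ≤ min (8 * N ^ 2) (4 * M) := le_min (by positivity) (by linarith)
  refine (volume_le_of_slices he hG (Lq := 4 * N) (Lp := (8 * N ^ 2 + 4 * M) / (2 * J / 9))
    (Lt := min (8 * N ^ 2) (4 * M)) ?_ ?_ ?_).trans ?_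
  · intro z hz w hw
    have h1 := abs_inner_lift_le (norm_perp he) z
    have h2 := abs_inner_lift_le (norm_perp he) w
    exact (abs_sub _ _).trans (by linarith [(h z hz.1).1, (h w hw.1).1])
  · intro z hz w hw hq
    have a1 := hlow z hz
    have b1 := hlow w hw
    have a2 := (hgs _ hz.2).2
    have b2 := (hgs _ hw.2).2
    have a3 := (h z hz.1).2
    have b3 := (h w hw.1).2
    rw [norm_space_sq_eq_frame he] at a2 b2
    rw [sub_inner_lift] at a1 b1
    rw [sub_inner_lift, sub_inner_lift] at a2 b2
    rw [← hq] at b2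
    have ht1 : time (z - η) = time z - time η := rfl
    have ht2 : time (w - η) = time w - time η := rfl
    rw [ht1] at a2
    rw [ht2] at b2
    set p := inner ℝ z (lift e)
    set p' := inner ℝ w (lift e)
    set P := inner ℝ η (lift e)
    rw [le_div_iff₀ (by positivity)]
    calc |p - p'| * (2 * J / 9) ≤ |p - p'| * |(p - P) + (p' - P)| := by
          gcongr
          exact le_trans (by linarith) (le_abs_self _)
      _ = |σ * ((p - P) ^ 2 - (p' - P) ^ 2)| := by
          rw [abs_mul, hσ, one_mul, ← abs_mul]
          congr 1
          ring
      _ ≤ _ := by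
          rw [abs_le] at a2 b2 a3 b3 ⊢
          constructor <;> linarith
  · intro z hz w hw hq hp
    have a2 := (hgs _ hz.2).2
    have b2 := (hgs _ hw.2).2
    have a3 := (h z hz.1).2
    have b3 := (h w hw.1).2
    rw [norm_space_sq_eq_frame he, sub_inner_lift, sub_inner_lift] at a2 b2
    rw [← hq, ← hp] at b2
    have ht1 : time (z - η) = time z - time η := rfl
    have ht2 : time (w - η) = time w - time η := rfl
    rw [ht1] at a2
    rw [ht2] at b2
    rw [abs_le] at a2 b2 a3 b3
    rw [le_min_iff, abs_le, abs_le]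
    refine ⟨⟨?_, ?_⟩, ?_, ?_⟩ <;> linarith
  · rw [← ENNReal.ofReal_mul (by positivity), ← ENNReal.ofReal_mul (by positivity)]
    refine ENNReal.ofReal_le_ofReal ?_
    have hmm : (8 * N ^ 2 + 4 * M) * min (8 * N ^ 2) (4 * M) ≤ 64 * (N ^ 2 * M) := by
      have e1 : 8 * N ^ 2 * min (8 * N ^ 2) (4 * M) ≤ 8 * N ^ 2 * (4 * M) := by
        gcongr; exact min_le_right _ _
      have e2 : 4 * M * min (8 * N ^ 2) (4 * M) ≤ 4 * M * (8 * N ^ 2) := by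
        gcongr; exact min_le_left _ _
      linarith
    rw [le_div_iff₀ hJ0]
    calc _ = 18 * N * ((8 * N ^ 2 + 4 * M) * min (8 * N ^ 2) (4 * M)) := by field_simp; ring
      _ ≤ 18 * N * (64 * (N ^ 2 * M)) := by gcongr
      _ = _ := by ring

/-- Low-high interactions. -/
theorem exists_low_high_bound : ∃ C : ℝ, 0 < C ∧ ∀ (i : ℕ) (J M₁ M₂ M₃ σ₁ σ₂ : ℝ),
    32 * 2 ^ i ≤ J → 1 ≤ M₃ → (1024 * M₃ ≤ J ^ 2 ∨ (2 ^ i) ^ 2 ≤ 4 * M₁) →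
    ∀ (A : Set SpaceTime), MeasurableSet A → Bornology.IsBounded A →
    (∀ ζ ∈ A, |modulation ζ| ≤ 2 * M₃) →
    (1024 * M₃ ≤ J ^ 2 → ∀ ζ ∈ A, J / 4 ≤ ‖space ζ‖) →
    ∀ f g : SpaceTime → ℂ, Localized f (2 ^ i) M₁ σ₁ → Localized g J M₂ σ₂ →
    ∀ (u : L2), (∀ᵐ z, ‖synth f z‖ ≤ ‖u z‖) → ∀ a b : Fin 2,
    eLpNorm (A.indicator (hatL1 fun z => synth (symb a f) z * synth (symb b g) z)) 2 volume ≤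
      ENNReal.ofReal (C * (2 ^ i) ^ 2 * √(M₁ * M₂ * M₃)) *
        ((decayNorm i u + eLpNorm u 2 volume) * eLpNorm g 2 volume) := by
  obtain ⟨C, hC, hest⟩ := exists_low_high_estimate
  refine ⟨2 * C + 3072, by positivity, ?_⟩
  intro i J M₁ M₂ M₃ σ₁ σ₂ hJ hM₃ hor A hA hAb hAm hAs f g hf hg u hu a b
  have hN : (1 : ℝ) ≤ 2 ^ i := one_le_pow₀ one_le_two
  have hJ0 : 0 < J := by linarith
  have hM₁ := hf.one_le
  have hM₂ := hg.one_le
  have hsg : ∀ ζ, symb b g ζ ≠ 0 → g ζ ≠ 0 := fun ζ hζ h0 => hζ (by simp [symb, h0])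
  have hsf : ∀ ζ, symb a f ζ ≠ 0 → f ζ ≠ 0 := fun ζ hζ h0 => hζ (by simp [symb, h0])
  have hfu : eLpNorm f 2 volume ≤ eLpNorm u 2 volume := by
    rw [← hf.band.eLpNorm_synth]
    exact eLpNorm_mono_ae hu
  have hg2 := eLpNorm_symb_le b hg.space_le
  have hf2 := eLpNorm_symb_le a hf.space_le
  -- Near the paraboloid the output frequency is at least `J/4` and the trilinear estimate applies;
  -- its gain `1/J` pays for the derivative of `g`. Otherwise both `M₁ ≳ N²` and `M₃ ≳ J²`, and
  -- crude Cauchy–Schwarz is enough.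
  by_cases hcase : 1024 * M₃ ≤ J ^ 2
  · have := hest i J M₁ M₂ M₃ σ₁ σ₂ hJ hM₁ hM₂ hM₃ hf.abs_sign hg.abs_sign A hA hAb
      (fun ζ hζ => ⟨hAs hcase ζ hζ, hAm ζ hζ⟩) f (symb b g) hf.band (hg.band.symb b)
      (fun ζ hζ => ⟨hf.space_le ζ hζ, hf.modul_le ζ hζ⟩)
      (fun ζ hζ => hg.modul_le ζ (hsg ζ hζ)) u hu a
    calc _ ≤ _ := this
      _ ≤ ENNReal.ofReal (C * ((2 ^ i) ^ 2 * √(M₁ * M₂ * M₃) / J)) *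
          (decayNorm i u + eLpNorm u 2 volume) *
            (ENNReal.ofReal (2 * J) * eLpNorm g 2 volume) := by
          gcongr
          exact le_self_add
      _ = ENNReal.ofReal (C * ((2 ^ i) ^ 2 * √(M₁ * M₂ * M₃) / J) * (2 * J)) *
          ((decayNorm i u + eLpNorm u 2 volume) * eLpNorm g 2 volume) := by
          rw [ENNReal.ofReal_mul (q := 2 * J) (by positivity)]
          ring
      _ ≤ _ := by
          refine mul_le_mul' (ENNReal.ofReal_le_ofReal ?_) le_rfl
          calc _ = 2 * C * (2 ^ i) ^ 2 * √(M₁ * M₂ * M₃) := by field_simp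
            _ ≤ _ := by
              gcongr
              linarith
  · have h1 := hor.resolve_left hcase
    push Not at hcase
    have hlow := eLpNorm_hatL1_le_of_low_input (hf.band.symb a) (hg.band.symb b)
      (N := 2 ^ i) (by positivity) fun ζ hζ => ⟨hf.space_le ζ (hsf ζ hζ), hf.time_le ζ (hsf ζ hζ)⟩
    calc _ ≤ _ := eLpNorm_indicator_le _
      _ ≤ _ := hlow
      _ ≤ ENNReal.ofReal (12 * (2 ^ i) ^ 2) *
          ((ENNReal.ofReal (2 * 2 ^ i) * (decayNorm i u + eLpNorm u 2 volume)) *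
            (ENNReal.ofReal (2 * J) * eLpNorm g 2 volume)) := by
          gcongr
          exact hf2.trans (by gcongr; exact hfu.trans le_add_self)
      _ = ENNReal.ofReal (12 * (2 ^ i) ^ 2 * (2 * 2 ^ i) * (2 * J)) *
          ((decayNorm i u + eLpNorm u 2 volume) * eLpNorm g 2 volume) := by
          rw [ENNReal.ofReal_mul (q := 2 * J) (by positivity),
            ENNReal.ofReal_mul (q := 2 * 2 ^ i) (by positivity)]
          ring
      _ ≤ _ := by
          refine mul_le_mul' (ENNReal.ofReal_le_ofReal ?_) le_rfl
          -- The two modulation bounds pay for both derivatives; `4 · 1024 = 64²`.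
          have h2 : 2 ^ i * J ≤ 64 * √(M₁ * M₂ * M₃) := by
            rw [show (64 : ℝ) = √(64 ^ 2) by rw [Real.sqrt_sq (by norm_num)],
              ← Real.sqrt_mul (by positivity)]
            refine Real.le_sqrt_of_sq_le ?_
            calc (2 ^ i * J) ^ 2 = (2 ^ i) ^ 2 * J ^ 2 := by ring
              _ ≤ (4 * M₁) * (1024 * M₃) := by gcongr
              _ = 64 ^ 2 * (M₁ * 1 * M₃) := by ring
              _ ≤ _ := by gcongr
          calc 12 * (2 ^ i) ^ 2 * (2 * 2 ^ i) * (2 * J) = 48 * (2 ^ i) ^ 2 * (2 ^ i * J) := by ring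
            _ ≤ 48 * (2 ^ i) ^ 2 * (64 * √(M₁ * M₂ * M₃)) := by gcongr
            _ = 3072 * (2 ^ i) ^ 2 * √(M₁ * M₂ * M₃) := by ring
            _ ≤ _ := by
              gcongr
              linarith

/-- High-high interactions with low output. -/
theorem high_high_bound {K N J M₁ M₂ M₃ σ₁ σ₂ : ℝ} (hK : 1 ≤ K) (hJ : 32 * K ≤ J) (hN : N ≤ 2 * J)
    (hM₃ : K ^ 2 ≤ 4 * M₃) {A : Set SpaceTime} (hA : MeasurableSet A)
    (hAs : ∀ ζ ∈ A, ‖space ζ‖ ≤ 2 * K ∧ |time ζ| ≤ 4 * K ^ 2) {f g : SpaceTime → ℂ}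
    (hf : Localized f N M₁ σ₁) (hg : Localized g J M₂ σ₂) (a b : Fin 2) :
    eLpNorm (A.indicator (hatL1 fun z => synth (symb a f) z * synth (symb b g) z)) 2 volume ≤
      ENNReal.ofReal (6144 * (K * J * √(J / K)) * √(M₁ * M₂ * M₃)) *
        (eLpNorm f 2 volume * eLpNorm g 2 volume) := by
  have hJ0 : 0 < J := by linarith
  have hM₁ := hf.one_le
  have hM₂ := hg.one_le
  have hM₃0 : 0 < M₃ := by nlinarith
  have hsg : ∀ ζ, symb b g ζ ≠ 0 → g ζ ≠ 0 := fun ζ hζ h0 => hζ (by simp [symb, h0])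
  have hg2 := eLpNorm_symb_le b hg.space_le
  have hf2 := eLpNorm_symb_le (R := 4 * J) a fun ζ hζ => (hf.space_le ζ hζ).trans (by linarith)
  have hroot : 6144 * (K * J * √(J / K)) * √(M₁ * M₂ * M₃) =
      √(6144 ^ 2 * (K * J ^ 3) * (M₁ * M₂ * M₃)) := by
    rw [Real.sqrt_mul (x := 6144 ^ 2 * (K * J ^ 3)) (by positivity),
      Real.sqrt_mul (x := 6144 ^ 2) (by positivity), Real.sqrt_sq (x := 6144) (by positivity),
      show K * J ^ 3 = (K * J) ^ 2 * (J / K) by field_simp,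
      Real.sqrt_mul (x := (K * J) ^ 2) (by positivity), Real.sqrt_sq (x := K * J) (by positivity)]
  -- The derivatives cost `4 J · 2 J = 8 J²`, since `N ≤ 2 J`. It remains to find a product bound
  -- `s` without derivatives for which `s · 8 J²` fits under the claimed constant.
  have hfin : ∀ s : ℝ, 0 ≤ s → (s * (8 * J ^ 2)) ^ 2 ≤ 6144 ^ 2 * (K * J ^ 3) * (M₁ * M₂ * M₃) →
      eLpNorm (A.indicator (hatL1 fun z => synth (symb a f) z * synth (symb b g) z)) 2 volume ≤
        ENNReal.ofReal s * (eLpNorm (symb a f) 2 volume * eLpNorm (symb b g) 2 volume) →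
      eLpNorm (A.indicator (hatL1 fun z => synth (symb a f) z * synth (symb b g) z)) 2 volume ≤
        ENNReal.ofReal (6144 * (K * J * √(J / K)) * √(M₁ * M₂ * M₃)) *
          (eLpNorm f 2 volume * eLpNorm g 2 volume) := fun s hs hs2 h => by
    calc _ ≤ _ := h
      _ ≤ ENNReal.ofReal s * ((ENNReal.ofReal (4 * J) * eLpNorm f 2 volume) *
          (ENNReal.ofReal (2 * J) * eLpNorm g 2 volume)) := by gcongr
      _ = ENNReal.ofReal (s * (4 * J) * (2 * J)) * (eLpNorm f 2 volume * eLpNorm g 2 volume) := by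
          rw [ENNReal.ofReal_mul (q := 2 * J) (by positivity),
            ENNReal.ofReal_mul (q := 4 * J) (by positivity)]
          ring
      _ ≤ _ := by
          refine mul_le_mul' (ENNReal.ofReal_le_ofReal ?_) le_rfl
          rw [hroot]
          refine Real.le_sqrt_of_sq_le (le_trans (le_of_eq ?_) hs2)
          ring
  -- If `g` is near its paraboloid, its frequencies are at least `J/4` and the slice bound `K³ M₂ /
  -- J` is available. Otherwise `M₂` itself exceeds `J²/1024` and the volume of the output region
  -- suffices; this case fixes the constant, as `9216 · 4 · 1024 = 6144²`.
  by_cases hcase : 1024 * M₂ ≤ J ^ 2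
  · refine hfin √(1152 * K ^ 3 * M₂ / J) (Real.sqrt_nonneg _) ?_ ?_
    · rw [mul_pow, Real.sq_sqrt (by positivity)]
      calc 1152 * K ^ 3 * M₂ / J * (8 * J ^ 2) ^ 2 = 73728 * (K * J ^ 3) * (1 * M₂ * K ^ 2) := by
            field_simp
            ring
        _ ≤ 73728 * (K * J ^ 3) * (M₁ * M₂ * (4 * M₃)) := by gcongr
        _ = 294912 * ((K * J ^ 3) * (M₁ * M₂ * M₃)) := by ring
        _ ≤ 6144 ^ 2 * ((K * J ^ 3) * (M₁ * M₂ * M₃)) := by gcongr; norm_num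
        _ = _ := by ring
    · have hv := volume_low_le hA (by linarith) hAs
      exact eLpNorm_le_sqrt_mul (by positivity) ((nsq_indicator hA _).trans_le
        (lintegral_hatL1_synth_mul_le (hf.band.symb a) (hg.band.symb b) hA
          (ne_top_of_le_ne_top ENNReal.ofReal_ne_top hv) (volume_low_output_le hA hK hJ hM₂
            hg.abs_sign hAs (hg.band.symb b).measurable fun ζ hζ =>
              ⟨hg.le_space hcase ζ (hsg ζ hζ), hg.modul_le ζ (hsg ζ hζ)⟩)))
  · push Not at hcase
    refine hfin (12 * K ^ 2) (by positivity) ?_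
      (eLpNorm_hatL1_le_of_low_output (hf.band.symb a) (hg.band.symb b) hA (by linarith) hAs)
    calc (12 * K ^ 2 * (8 * J ^ 2)) ^ 2 = 9216 * (K * J ^ 3) * (K ^ 2 * (K * J)) := by ring
      _ ≤ 9216 * (K * J ^ 3) * ((4 * M₃) * (J * J)) := by
          gcongr
          linarith
      _ = 9216 * (K * J ^ 3) * (4 * (1 * J ^ 2 * M₃)) := by ring
      _ ≤ 9216 * (K * J ^ 3) * (4 * (M₁ * (1024 * M₂) * M₃)) := by gcongr
      _ = _ := by ring

end DNLS

end

noncomputable section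

namespace DNLS

/-! ### The frequency regions -/

theorem le_of_dyadicCutoff_ne_zero {φ₀ : ℝ → ℝ} (hφ : IsCutoff φ₀) {i : ℕ} {x : ℝ}
    (h : dyadicCutoff φ₀ i x ≠ 0) : x ≤ 2 * 2 ^ i := by
  by_contra! hx
  apply h
  unfold dyadicCutoff
  have h2 : (0 : ℝ) < 2 ^ i := by positivity
  split_ifs with hi
  · subst hi
    exact hφ.eq_zero _ (by linarith)
  · have h1 : (2 : ℝ) ≤ 2 ^ (-(i : ℤ)) * x := by
      rw [zpow_neg, zpow_natCast, inv_mul_eq_div, le_div_iff₀ h2]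
      exact hx.le
    have h3 : (2 : ℝ) ^ (-(i : ℤ) + 1) * x = 2 * (2 ^ (-(i : ℤ)) * x) := by
      rw [zpow_add₀ two_ne_zero, zpow_one]
      ring
    rw [h3, hφ.eq_zero _ h1, hφ.eq_zero _ (by linarith), sub_zero]

theorem ge_of_dyadicCutoff_ne_zero {φ₀ : ℝ → ℝ} (hφ : IsCutoff φ₀) {i : ℕ} (hi : i ≠ 0) {x : ℝ}
    (hx0 : 0 ≤ x) (h : dyadicCutoff φ₀ i x ≠ 0) : 2 ^ i / 2 ≤ x := by
  by_contra! hx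
  apply h
  unfold dyadicCutoff
  have h2 : (0 : ℝ) < 2 ^ i := by positivity
  have h0 : (0 : ℝ) ≤ 2 ^ (-(i : ℤ)) * x := by positivity
  have h1 : (2 : ℝ) ^ (-(i : ℤ)) * x ≤ 1 / 2 := by
    rw [zpow_neg, zpow_natCast, inv_mul_eq_div, div_le_iff₀ h2]
    linarith
  have h3 : (2 : ℝ) ^ (-(i : ℤ) + 1) * x = 2 * (2 ^ (-(i : ℤ)) * x) := by
    rw [zpow_add₀ two_ne_zero, zpow_one]
    ring
  rw [if_neg hi, h3, hφ.eq_one _ h0 (by linarith), hφ.eq_one _ (by linarith) (by linarith),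
    sub_self]

theorem continuous_space : Continuous space := by
  unfold space
  fun_prop

theorem continuous_pnorm : Continuous pnorm := by
  have := continuous_space
  unfold pnorm time
  fun_prop

theorem continuous_modulation : Continuous modulation := by
  have := continuous_space
  unfold modulation time
  fun_prop

/-- The modulation size `2^i d` is the dyadic number with the index of the modulation cut-off. The
truncation `toNat` is harmless because `log₂ d ≥ -i`. -/
theorem distances_spec {i : ℕ} {d : ℝ} (hd : d ∈ distances i) :
    2 ^ i * d = 2 ^ ((i : ℤ) + Int.log 2 d).toNat := by
  obtain ⟨l, h1, -, rfl⟩ := hd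
  have hl : Int.log 2 ((2 : ℝ) ^ l) = l := by
    have := Int.log_zpow (R := ℝ) (b := 2) one_lt_two l
    rwa [Nat.cast_ofNat] at this
  rw [hl, ← zpow_natCast, ← zpow_natCast, Int.toNat_of_nonneg (by linarith),
    zpow_add₀ two_ne_zero]

theorem one_le_of_distances {i : ℕ} {d : ℝ} (hd : d ∈ distances i) : 1 ≤ 2 ^ i * d := by
  rw [distances_spec hd]
  exact one_le_pow₀ one_le_two

theorem abs_le_bracket (r : ℝ) : |r| ≤ bracket r := by
  rw [bracket, ← Real.sqrt_sq_eq_abs]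
  exact Real.sqrt_le_sqrt (by linarith)

theorem one_le_bracket (r : ℝ) : 1 ≤ bracket r := by
  rw [bracket, Real.one_le_sqrt]
  nlinarith [sq_nonneg r]

section Region

variable {φ₀ : ℝ → ℝ} {i : ℕ} {d : ℝ}

/-- A region is the closure of the set where its cut-off is nonzero; non-strict inequalities between
continuous functions pass to the closure. The bounds below follow the same pattern. -/
theorem region_pnorm_le (hφ : IsCutoff φ₀) {ζ : SpaceTime} (hζ : ζ ∈ region φ₀ i d) : pnorm ζ ≤ 2 * 2 ^ i := by
  refine closure_minimal (t := {ζ | pnorm ζ ≤ 2 * 2 ^ i}) (fun ζ hζ => ?_)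
    (isClosed_le continuous_pnorm continuous_const) hζ
  exact le_of_dyadicCutoff_ne_zero hφ (left_ne_zero_of_mul hζ)

theorem le_pnorm_of_region (hφ : IsCutoff φ₀) (hi : i ≠ 0) {ζ : SpaceTime} (hζ : ζ ∈ region φ₀ i d) :
    2 ^ i / 2 ≤ pnorm ζ := by
  refine closure_minimal (t := {ζ | 2 ^ i / 2 ≤ pnorm ζ}) (fun ζ hζ => ?_)
    (isClosed_le continuous_const continuous_pnorm) hζ
  exact ge_of_dyadicCutoff_ne_zero hφ hi (Real.sqrt_nonneg _) (left_ne_zero_of_mul hζ)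

theorem region_modulation_le (hφ : IsCutoff φ₀) (hd : d ∈ distances i) {ζ : SpaceTime} (hζ : ζ ∈ region φ₀ i d) :
    |modulation ζ| ≤ 2 * (2 ^ i * d) := by
  rw [distances_spec hd]
  refine closure_minimal (t := {ζ | |modulation ζ| ≤ _}) (fun ζ hζ => ?_)
    (isClosed_le continuous_modulation.abs continuous_const) hζ
  exact le_of_dyadicCutoff_ne_zero hφ (right_ne_zero_of_mul hζ)

theorem le_bracket_of_region (hφ : IsCutoff φ₀) (hd : d ∈ distances i) {ζ : SpaceTime} (hζ : ζ ∈ region φ₀ i d) :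
    2 ^ i * d / 2 ≤ bracket (modulation ζ) := by
  rw [distances_spec hd]
  set n := ((i : ℤ) + Int.log 2 d).toNat with hn
  -- The lowest cut-off gives no lower bound for the modulation, but there the bracket is at least
  -- `1`, which is why the bracket is used.
  by_cases h0 : n = 0
  · rw [h0]
    linarith [one_le_bracket (modulation ζ)]
  · refine le_trans ?_ (abs_le_bracket _)
    refine closure_minimal (t := {ζ | 2 ^ n / 2 ≤ |modulation ζ|}) (fun ζ hζ => ?_)
      (isClosed_le continuous_const continuous_modulation.abs) hζ
    exact ge_of_dyadicCutoff_ne_zero hφ h0 (abs_nonneg _) (right_ne_zero_of_mul hζ)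

theorem pnorm_sq (ζ : SpaceTime) : pnorm ζ ^ 2 = |time ζ| + ‖space ζ‖ ^ 2 :=
  Real.sq_sqrt (by positivity)

theorem region_space_le (hφ : IsCutoff φ₀) {ζ : SpaceTime} (hζ : ζ ∈ region φ₀ i d) : ‖space ζ‖ ≤ 2 * 2 ^ i := by
  have h1 := pow_le_pow_left₀ (Real.sqrt_nonneg _) (region_pnorm_le hφ hζ) 2
  change pnorm ζ ^ 2 ≤ _ at h1
  rw [pnorm_sq] at h1
  exact (abs_le_of_sq_le_sq' (by linarith [abs_nonneg (time ζ)]) (by positivity)).2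

theorem region_time_le (hφ : IsCutoff φ₀) {ζ : SpaceTime} (hζ : ζ ∈ region φ₀ i d) : |time ζ| ≤ 4 * (2 ^ i) ^ 2 := by
  have h1 := pow_le_pow_left₀ (Real.sqrt_nonneg _) (region_pnorm_le hφ hζ) 2
  change pnorm ζ ^ 2 ≤ _ at h1
  rw [pnorm_sq] at h1
  nlinarith [sq_nonneg ‖space ζ‖]

/-- Since `|τ| ≤ |τ - |ξ|²| + |ξ|²`, the lower bound `N²/4` for `|τ| + |ξ|²`, with `N = 2^i`, is at
most `2 |ξ|²` plus a modulation of at most `N²/512`. The hypothesis excludes `i = 0`, where no lower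
bound exists. -/
theorem le_space_of_region (hφ : IsCutoff φ₀) (hd : d ∈ distances i) (hM : 1024 * (2 ^ i * d) ≤ (2 ^ i) ^ 2)
    {ζ : SpaceTime} (hζ : ζ ∈ region φ₀ i d) : 2 ^ i / 4 ≤ ‖space ζ‖ := by
  have hM1 := one_le_of_distances hd
  have hi : i ≠ 0 := by
    rintro rfl
    norm_num at hM hM1
    linarith
  have hp : (0 : ℝ) < 2 ^ i := by positivity
  have h1 := pow_le_pow_left₀ (by positivity) (le_pnorm_of_region hφ hi hζ) 2
  rw [pnorm_sq] at h1
  have h2 := region_modulation_le hφ hd hζ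
  have h3 : |time ζ| ≤ |modulation ζ| + ‖space ζ‖ ^ 2 := by
    have := abs_add_le (modulation ζ) (‖space ζ‖ ^ 2)
    rwa [modulation, sub_add_cancel, abs_of_nonneg (sq_nonneg ‖space ζ‖)] at this
  exact (abs_le_of_sq_le_sq' (by nlinarith) (by positivity)).2

theorem measurableSet_region : MeasurableSet (region φ₀ i d) :=
  (isClosed_tsupport _).measurableSet

theorem isBounded_region (hφ : IsCutoff φ₀) : Bornology.IsBounded (region φ₀ i d) := by
  refine isBounded_iff_forall_norm_le.2 ⟨2 * 2 ^ i + 4 * (2 ^ i) ^ 2, fun ζ hζ => ?_⟩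
  have h1 := region_space_le hφ hζ
  have h2 := region_time_le hφ hζ
  refine (abs_le_of_sq_le_sq' ?_ (by positivity)).2
  rw [EuclideanSpace.norm_sq_eq, Fin.sum_univ_three]
  simp only [Real.norm_eq_abs, sq_abs]
  rw [← norm_space_sq]
  have h3 := pow_le_pow_left₀ (norm_nonneg _) h1 2
  have h4 := pow_le_pow_left₀ (abs_nonneg _) h2 2
  rw [sq_abs] at h4
  change ‖space ζ‖ ^ 2 + time ζ ^ 2 ≤ _
  have hp : (0 : ℝ) < 2 ^ i := by positivity
  nlinarith [pow_pos hp 3]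

theorem weight_zero (b : ℝ) (ζ : SpaceTime) : weight 0 b ζ = bracket (modulation ζ) ^ b := by
  rw [weight, Real.rpow_zero, one_mul]

/-- A function with Fourier support in a region. -/
theorem exists_localized (hφ : IsCutoff φ₀) (hd : d ∈ distances i) {u : L2}
    (hu : FourierSupportedIn u (region φ₀ i d)) :
    ∃ f, Localized f (2 ^ i) (2 ^ i * d) 1 ∧ u =ᵐ[volume] synth f ∧
      ENNReal.ofReal √(2 ^ i * d / 2) * eLpNorm f 2 volume ≤ xNorm 0 (1 / 2) u := by
  obtain ⟨hb, hs, hae⟩ := exists_band measurableSet_region (isBounded_region hφ) hu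
  have hM := one_le_of_distances hd
  set f := (region φ₀ i d).indicator (hatL2 u) with hf
  have hmem : ∀ ζ, f ζ ≠ 0 → ζ ∈ region φ₀ i d := fun ζ hζ => Set.mem_of_indicator_ne_zero hζ
  refine ⟨f, ⟨hb, hM, by simp, fun ζ hζ => region_space_le hφ (hmem ζ hζ),
    fun ζ hζ => region_time_le hφ (hmem ζ hζ), fun ζ hζ => ?_,
    fun h ζ hζ => le_space_of_region hφ hd h (hmem ζ hζ)⟩, hs, ?_⟩
  · rw [one_mul]
    exact region_modulation_le hφ hd (hmem ζ hζ)
  · have h1 : ENNReal.ofReal √(2 ^ i * d / 2) * eLpNorm f 2 volume =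
        eLpNorm ((√(2 ^ i * d / 2) : ℝ) • f) 2 volume := by
      rw [eLpNorm_const_smul, ← ofReal_norm, Real.norm_of_nonneg (Real.sqrt_nonneg _)]
    rw [h1, xNorm]
    refine eLpNorm_mono_ae ?_
    filter_upwards [hae] with ζ hζ
    rw [Pi.smul_apply, norm_smul, norm_mul, ← hζ, Complex.norm_real]
    by_cases h0 : f ζ = 0
    · simp [h0]
    gcongr
    rw [weight_zero, Real.sqrt_eq_rpow, Real.norm_of_nonneg (by positivity)]
    refine le_trans ?_ (le_abs_self _)
    exact Real.rpow_le_rpow (by positivity) (le_bracket_of_region hφ hd (hmem ζ h0)) (by norm_num)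

theorem xNormOn_le (hφ : IsCutoff φ₀) (hd : d ∈ distances i) (g : SpaceTime → ℂ) :
    xNormOn 0 (-(1 / 2)) (region φ₀ i d) g ≤
      ENNReal.ofReal (√(2 ^ i * d / 2))⁻¹ *
        eLpNorm ((region φ₀ i d).indicator (hatL1 g)) 2 volume := by
  have hM := one_le_of_distances hd
  refine eLpNorm_le_mul_eLpNorm_of_ae_le_mul (.of_forall fun ζ => ?_) 2
  by_cases hζ : ζ ∈ region φ₀ i d
  · rw [Set.indicator_of_mem hζ, Set.indicator_of_mem hζ, norm_mul, Complex.norm_real]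
    gcongr
    have hb := le_bracket_of_region hφ hd hζ
    have hb0 : 0 < bracket (modulation ζ) := by linarith
    rw [weight_zero, Real.norm_of_nonneg (by positivity), Real.rpow_neg hb0.le, ← Real.sqrt_eq_rpow]
    gcongr
  · simp [Set.indicator_of_notMem hζ]

end Region

end DNLS

end

noncomputable section

namespace DNLS

/-! ### The bilinear form -/

theorem hatL1_sum {ι : Type*} (s : Finset ι) (c : ι → ℂ) {F : ι → SpaceTime → ℂ}
    (hF : ∀ p, Integrable (F p)) (ζ : SpaceTime) :
    hatL1 (fun z => ∑ p ∈ s, c p * F p z) ζ = ∑ p ∈ s, c p * hatL1 (F p) ζ := by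
  have hexp : Continuous fun z : SpaceTime => Complex.exp (-(inner ℝ z ζ : ℝ) * Complex.I) := by
    fun_prop
  have hi : ∀ p, Integrable fun z => Complex.exp (-(inner ℝ z ζ : ℝ) * Complex.I) * F p z :=
    fun p => (hF p).bdd_mul (c := 1) hexp.aestronglyMeasurable (.of_forall fun z => by
      rw [← Complex.ofReal_neg, Complex.norm_exp_ofReal_mul_I])
  simp only [hatL1_eq_integral, Finset.mul_sum]
  have : ∀ z, ∑ p ∈ s, Complex.exp (-(inner ℝ z ζ : ℝ) * Complex.I) * (c p * F p z) =
      ∑ p ∈ s, c p * (Complex.exp (-(inner ℝ z ζ : ℝ) * Complex.I) * F p z) := fun z =>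
    Finset.sum_congr rfl fun p _ => by ring
  simp only [this]
  rw [integral_finsetSum _ fun p _ => (hi p).const_mul _, Finset.mul_sum]
  refine Finset.sum_congr rfl fun p _ => ?_
  rw [integral_const_mul]
  ring

theorem xNormOn_bilinear_le {φ₀ : ℝ → ℝ} (hφ : IsCutoff φ₀) {k : ℕ} {d : ℝ}
    (hd : d ∈ distances k) (c : Fin 2 → Fin 2 → ℂ) {f g : SpaceTime → ℂ} (hf : Band f)
    (hg : Band g) {G : SpaceTime → ℂ}
    (hG : G =ᵐ[volume] fun z => ∑ a, ∑ b, c a b * synth (symb a f) z * synth (symb b g) z)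
    {B : ℝ≥0∞} (hB : ∀ a b, eLpNorm ((region φ₀ k d).indicator
      (hatL1 fun z => synth (symb a f) z * synth (symb b g) z)) 2 volume ≤ B) :
    Integrable G ∧ xNormOn 0 (-(1 / 2)) (region φ₀ k d) G ≤
      ENNReal.ofReal (√(2 ^ k * d / 2))⁻¹ * (ENNReal.ofReal (∑ a, ∑ b, ‖c a b‖) * B) := by
  set F : Fin 2 × Fin 2 → SpaceTime → ℂ :=
    fun p z => synth (symb p.1 f) z * synth (symb p.2 g) z with hF
  have hFi : ∀ p, Integrable (F p) := fun p => (hf.symb p.1).synth_mul_integrable (hg.symb p.2)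
  have hG' : G =ᵐ[volume] fun z => ∑ p : Fin 2 × Fin 2, c p.1 p.2 * F p z := by
    filter_upwards [hG] with z hz
    rw [hz, Fintype.sum_prod_type]
    simp only [hF, mul_assoc]
  refine ⟨(integrable_congr hG').2 (integrable_finsetSum _ fun p _ => (hFi p).const_mul _),
    (xNormOn_le hφ hd G).trans ?_⟩
  gcongr
  set A := region φ₀ k d
  have hA : MeasurableSet A := measurableSet_region
  have e1 : A.indicator (hatL1 G) =
      ∑ p : Fin 2 × Fin 2, c p.1 p.2 • A.indicator (hatL1 (F p)) := by
    ext ζ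
    rw [Finset.sum_apply]
    by_cases hζ : ζ ∈ A
    · rw [Set.indicator_of_mem hζ, hatL1_congr hG', hatL1_sum _ _ hFi]
      simp [Set.indicator_of_mem hζ]
    · simp [Set.indicator_of_notMem hζ]
  rw [e1]
  calc _ ≤ ∑ p : Fin 2 × Fin 2, eLpNorm (c p.1 p.2 • A.indicator (hatL1 (F p))) 2 volume :=
        eLpNorm_sum_le (fun p _ => (((continuous_hatL1 (hFi p)).measurable.indicator
          hA).aestronglyMeasurable).const_smul _) one_le_two
    _ ≤ ∑ p : Fin 2 × Fin 2, ENNReal.ofReal ‖c p.1 p.2‖ * B := by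
        refine Finset.sum_le_sum fun p _ => ?_
        rw [eLpNorm_const_smul, ofReal_norm]
        gcongr
        exact hB p.1 p.2
    _ = _ := by
        rw [← Finset.sum_mul, ← ENNReal.ofReal_sum_of_nonneg fun p _ => norm_nonneg _,
          Fintype.sum_prod_type]

theorem bilin_ae (c : Fin 2 → Fin 2 → ℂ) {u v : L2} {f g : SpaceTime → ℂ} (hf : Band f)
    (hg : Band g) (hu : u =ᵐ[volume] synth f) (hv : v =ᵐ[volume] synth g) :
    bilin c u v =ᵐ[volume]
      fun z => ∑ a, ∑ b, c a b * synth (symb a f) z * synth (symb b g) z := by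
  filter_upwards [ae_all_iff.2 (hf.partialDeriv_ae hu), ae_all_iff.2 (hg.partialDeriv_ae hv)]
    with z h1 h2
  simp only [bilin, h1, h2]

theorem eLpNorm_conj_reflect (g : SpaceTime → ℂ) (hg : Measurable g) :
    eLpNorm (fun ζ => star (g (-ζ))) 2 volume = eLpNorm g 2 volume := by
  have h1 : eLpNorm (fun ζ => star (g (-ζ))) 2 volume = eLpNorm (fun ζ => g (-ζ)) 2 volume :=
    eLpNorm_congr_norm_ae (.of_forall fun ζ => norm_star _)
  rw [h1]
  exact eLpNorm_comp_measurePreserving hg.aestronglyMeasurable (Measure.measurePreserving_neg _)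

/-- The output weight cancels `√M₃`, and `√M₁`, `√(M₂/2)` are exactly the weights in the norms of
`u` and `v`. -/
theorem inv_sqrt_mul_sqrt {M₁ M₂ M₃ : ℝ} (h₁ : 0 ≤ M₁) (h₂ : 0 ≤ M₂) (h₃ : 0 < M₃) :
    (√(M₃ / 2))⁻¹ * √(M₁ * M₂ * M₃) = 2 * (√M₁ * √(M₂ / 2)) := by
  have h : 0 < √(M₃ / 2) := Real.sqrt_pos.2 (by positivity)
  rw [inv_mul_eq_div, div_eq_iff h.ne', show M₁ * M₂ * M₃ = 2 ^ 2 * (M₁ * (M₂ / 2) * (M₃ / 2)) by ring,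
    Real.sqrt_mul (x := 2 ^ 2) (by positivity), Real.sqrt_mul (x := M₁ * (M₂ / 2)) (by positivity),
    Real.sqrt_mul h₁, Real.sqrt_sq (by norm_num)]
  ring

/-- The bilinear estimate follows from the estimates for products of localized functions. -/
theorem bilinearEstimate_of_localized {φ₀ : ℝ → ℝ} (hφ : IsCutoff φ₀) (c : Fin 2 → Fin 2 → ℂ)
    {i j k : ℕ} {d₁ d₂ d₃ K K₀ : ℝ} (hd₁ : d₁ ∈ distances i) (hd₂ : d₂ ∈ distances j)
    (hd₃ : d₃ ∈ distances k) (hK₀ : 0 ≤ K₀) (hK : 2 * (∑ a, ∑ b, ‖c a b‖) * K₀ ≤ K)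
    (h : ∀ (f g : SpaceTime → ℂ) (σ₁ σ₂ : ℝ) (u : L2), Localized f (2 ^ i) (2 ^ i * d₁) σ₁ →
      Localized g (2 ^ j) (2 ^ j * d₂) σ₂ → (∀ᵐ z, ‖synth f z‖ ≤ ‖u z‖) → ∀ a b,
      eLpNorm ((region φ₀ k d₃).indicator
        (hatL1 fun z => synth (symb a f) z * synth (symb b g) z)) 2 volume ≤
      ENNReal.ofReal (K₀ * √((2 ^ i * d₁) * (2 ^ j * d₂) * (2 ^ k * d₃))) *
        ((decayNorm i u + eLpNorm u 2 volume) * eLpNorm g 2 volume)) :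
    BilinearEstimate φ₀ c i d₁ j d₂ k d₃ K := by
  intro u v hu hv G hG
  obtain ⟨f, hf, huf, -⟩ := exists_localized hφ hd₁ hu
  obtain ⟨g, hg, hvg, hgv⟩ := exists_localized hφ hd₂ hv
  have hM₁ := one_le_of_distances hd₁
  have hM₂ := one_le_of_distances hd₂
  have hM₃ := one_le_of_distances hd₃
  -- Common to `B(u,v)`, `B(ū,v)` and `B(u,v̄)`: the Fourier side of a conjugated factor keeps its
  -- localization up to sign, the pointwise bound by `u`, and the `L²` norm.
  have key : ∀ (f' g' : SpaceTime → ℂ) (σ₁ σ₂ : ℝ), Localized f' (2 ^ i) (2 ^ i * d₁) σ₁ →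
      Localized g' (2 ^ j) (2 ^ j * d₂) σ₂ → (∀ᵐ z, ‖synth f' z‖ ≤ ‖u z‖) →
      eLpNorm g' 2 volume = eLpNorm g 2 volume →
      (G =ᵐ[volume] fun z => ∑ a, ∑ b, c a b * synth (symb a f') z * synth (symb b g') z) →
      Integrable G ∧ xNormOn 0 (-(1 / 2)) (region φ₀ k d₃) G ≤
          ENNReal.ofReal K * decayXNorm 0 i d₁ u * xNorm 0 (1 / 2) v := by
    intro f' g' σ₁ σ₂ hf' hg' hu' hgg hG'
    obtain ⟨h1, h2⟩ := xNormOn_bilinear_le hφ hd₃ c hf'.band hg'.band hG'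
      (h f' g' σ₁ σ₂ u hf' hg' hu')
    refine ⟨h1, h2.trans ?_⟩
    set S := ∑ a, ∑ b, ‖c a b‖ with hS
    have hS0 : 0 ≤ S := by positivity
    set W := decayNorm i u + eLpNorm u 2 volume
    have hx : decayXNorm 0 i d₁ u = ENNReal.ofReal √(2 ^ i * d₁) * W := by
      rw [decayXNorm, mul_zero, Real.rpow_zero, one_mul, Real.sqrt_eq_rpow]
    rw [hgg, hx]
    have hid := inv_sqrt_mul_sqrt (M₁ := 2 ^ i * d₁) (M₂ := 2 ^ j * d₂) (M₃ := 2 ^ k * d₃)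
      (by linarith) (by linarith) (by linarith)
    calc _ = ENNReal.ofReal ((√(2 ^ k * d₃ / 2))⁻¹ *
          (S * (K₀ * √((2 ^ i * d₁) * (2 ^ j * d₂) * (2 ^ k * d₃))))) *
            (W * eLpNorm g 2 volume) := by
          rw [ENNReal.ofReal_mul (p := (√(2 ^ k * d₃ / 2))⁻¹) (by positivity),
            ENNReal.ofReal_mul (p := S) hS0]
          ring
      _ = ENNReal.ofReal ((2 * S * K₀) * √(2 ^ i * d₁) * √(2 ^ j * d₂ / 2)) *
            (W * eLpNorm g 2 volume) := by
          congr 2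
          linear_combination (S * K₀) * hid
      _ = ENNReal.ofReal (2 * S * K₀) * (ENNReal.ofReal √(2 ^ i * d₁) * W) *
            (ENNReal.ofReal √(2 ^ j * d₂ / 2) * eLpNorm g 2 volume) := by
          rw [ENNReal.ofReal_mul (q := √(2 ^ j * d₂ / 2)) (by positivity),
            ENNReal.ofReal_mul (q := √(2 ^ i * d₁)) (by positivity)]
          ring
      _ ≤ _ := by gcongr
  have hu1 : ∀ᵐ z, ‖synth f z‖ ≤ ‖u z‖ := by
    filter_upwards [huf] with z hz
    rw [hz]
  have hu2 : ∀ᵐ z, ‖synth (fun ζ => star (f (-ζ))) z‖ ≤ ‖u z‖ := by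
    filter_upwards [star_ae huf, Lp.coeFn_star u] with z h1 h2
    rw [← h1, h2, Pi.star_apply, norm_star]
  rcases hG with rfl | rfl | rfl
  · exact key f g 1 1 hf hg hu1 rfl (bilin_ae c hf.band hg.band huf hvg)
  · exact key _ g _ 1 hf.conj hg hu2 rfl (bilin_ae c hf.conj.band hg.band (star_ae huf) hvg)
  · exact key f _ 1 _ hf hg.conj hu1 (eLpNorm_conj_reflect g hg.band.measurable)
      (bilin_ae c hf.band hg.conj.band huf (star_ae hvg))

end DNLS

end

/-! ### Dyadic arithmetic and the conclusion. -/

theorem DNLS.sqrt_two_pow_div (j k : ℕ) :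
    √((2 : ℝ) ^ j / 2 ^ k) = 2 ^ (((j : ℝ) - (k : ℝ)) / 2) := by
  rw [Real.sqrt_eq_rpow, ← Real.rpow_natCast, ← Real.rpow_natCast, ← Real.rpow_sub two_pos,
    ← Real.rpow_mul two_pos.le]
  congr 1
  ring

theorem DNLS.sq_le_of_zpow_le {i : ℕ} {d : ℝ} (h : (2 : ℝ) ^ ((i : ℤ) - 2) ≤ d) :
    ((2 : ℝ) ^ i) ^ 2 ≤ 4 * (2 ^ i * d) := by
  rw [zpow_sub₀ two_ne_zero, zpow_natCast] at h
  have hp : (0 : ℝ) < 2 ^ i := by positivity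
  norm_num at h
  nlinarith

theorem DNLS.thirtytwo_mul_le {i j : ℕ} (h : i + 5 ≤ j) : 32 * (2 : ℝ) ^ i ≤ 2 ^ j := by
  calc 32 * (2 : ℝ) ^ i = 2 ^ (i + 5) := by ring
    _ ≤ 2 ^ j := pow_le_pow_right₀ one_le_two h

theorem mainTheorem8 (φ₀ : ℝ → ℝ) (hφ₀ : DNLS.IsCutoff φ₀) (c : Fin 2 → Fin 2 → ℂ) :
    ∃ C : ℝ, 0 < C ∧
      -- a) low-high interactions, low frequency close to the paraboloid
      (∀ i j : ℕ, i + 5 ≤ j →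
        ∀ d₁ ∈ DNLS.distances i, ∀ d₂ ∈ DNLS.distances j, ∀ d₃ ∈ DNLS.distances j,
          d₁ ≤ 2 ^ ((i : ℤ) - 2) → d₂ ≤ 2 ^ ((i : ℤ) - 5) → d₃ ≤ 2 ^ ((i : ℤ) - 5) →
            DNLS.BilinearEstimate φ₀ c i d₁ j d₂ j d₃ (C * 2 ^ (2 * i))) ∧
      -- b) low-high interactions, low frequency away from the paraboloid
      (∀ i j : ℕ, i + 5 ≤ j →
        ∀ d₁ ∈ DNLS.distances i, ∀ d₂ ∈ DNLS.distances j, ∀ d₃ ∈ DNLS.distances j,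
          2 ^ ((i : ℤ) - 2) ≤ d₁ →
            DNLS.BilinearEstimate φ₀ c i d₁ j d₂ j d₃ (C * 2 ^ (2 * i))) ∧
      -- c) high-high interactions with output at low frequency, away from the paraboloid
      (∀ i j k : ℕ, |(i : ℤ) - (j : ℤ)| ≤ 1 → k + 5 ≤ j →
        ∀ d₁ ∈ DNLS.distances i, ∀ d₂ ∈ DNLS.distances j, ∀ d₃ ∈ DNLS.distances k,
          2 ^ ((k : ℤ) - 2) ≤ d₃ →
            DNLS.BilinearEstimate φ₀ c i d₁ j d₂ k d₃
              (C * (2 ^ (k + j) * 2 ^ (((j : ℝ) - (k : ℝ)) / 2)))) := by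
  obtain ⟨C₁, hC₁, hlow⟩ := DNLS.exists_low_high_bound
  set S := ∑ a, ∑ b, ‖c a b‖ with hS
  have hS0 : 0 ≤ S := by positivity
  -- Parts a) and b) share one estimate; they differ in which alternative holds: output near the
  -- paraboloid in a), low input far from it in b).
  have hlh : ∀ i j : ℕ, i + 5 ≤ j →
      ∀ d₁ ∈ DNLS.distances i, ∀ d₂ ∈ DNLS.distances j, ∀ d₃ ∈ DNLS.distances j,
        (1024 * (2 ^ j * d₃) ≤ ((2 : ℝ) ^ j) ^ 2 ∨ ((2 : ℝ) ^ i) ^ 2 ≤ 4 * (2 ^ i * d₁)) →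
          DNLS.BilinearEstimate φ₀ c i d₁ j d₂ j d₃ (2 * (S + 1) * (C₁ + 6144) * 2 ^ (2 * i)) := by
    intro i j hij d₁ hd₁ d₂ hd₂ d₃ hd₃ hor
    refine DNLS.bilinearEstimate_of_localized hφ₀ c hd₁ hd₂ hd₃ (K₀ := C₁ * (2 ^ i) ^ 2)
      (by positivity) ?_ ?_
    · rw [← hS, pow_mul', mul_assoc _ _ (((2 : ℝ) ^ i) ^ 2)]
      gcongr <;> linarith
    · intro f g σ₁ σ₂ u hf hg hu a b
      exact hlow i (2 ^ j) _ _ _ σ₁ σ₂ (DNLS.thirtytwo_mul_le hij) (DNLS.one_le_of_distances hd₃) hor _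
        DNLS.measurableSet_region (DNLS.isBounded_region hφ₀)
        (fun ζ hζ => DNLS.region_modulation_le hφ₀ hd₃ hζ)
        (fun h ζ hζ => DNLS.le_space_of_region hφ₀ hd₃ h hζ) f g hf hg u hu a b
  -- One constant for all parts: `C₁` serves a) and b), `6144` serves c), and `2 (S + 1)` covers the
  -- coefficients and the weights.
  refine ⟨2 * (S + 1) * (C₁ + 6144), by positivity, ?_, ?_, ?_⟩
  · intro i j hij d₁ hd₁ d₂ hd₂ d₃ hd₃ _ _ h₃
    refine hlh i j hij d₁ hd₁ d₂ hd₂ d₃ hd₃ (.inl ?_)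
    have hp : (0 : ℝ) < 2 ^ j := by positivity
    have h1 := DNLS.thirtytwo_mul_le hij
    rw [zpow_sub₀ two_ne_zero, zpow_natCast] at h₃
    norm_num at h₃
    -- From `d₃ ≤ 2^i / 32` and `32 · 2^i ≤ 2^j` one gets `1024 d₃ ≤ 2^j`.
    nlinarith
  · intro i j hij d₁ hd₁ d₂ hd₂ d₃ hd₃ h₁
    exact hlh i j hij d₁ hd₁ d₂ hd₂ d₃ hd₃ (.inr (DNLS.sq_le_of_zpow_le h₁))
  · intro i j k hij hkj d₁ hd₁ d₂ hd₂ d₃ hd₃ h₃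
    refine DNLS.bilinearEstimate_of_localized hφ₀ c hd₁ hd₂ hd₃
      (K₀ := 6144 * (2 ^ k * 2 ^ j * √(2 ^ j / 2 ^ k))) (by positivity) ?_ ?_
    · rw [← hS, DNLS.sqrt_two_pow_div, pow_add, ← mul_assoc (2 * S)]
      gcongr <;> linarith
    · intro f g σ₁ σ₂ u hf hg hu a b
      have hN : (2 : ℝ) ^ i ≤ 2 * 2 ^ j := by
        rw [← pow_succ']
        exact pow_le_pow_right₀ one_le_two (by have := (abs_le.1 hij).2; omega)
      refine (DNLS.high_high_bound (one_le_pow₀ one_le_two) (DNLS.thirtytwo_mul_le hkj) hN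
        (DNLS.sq_le_of_zpow_le h₃) DNLS.measurableSet_region
        (fun ζ hζ => ⟨DNLS.region_space_le hφ₀ hζ, DNLS.region_time_le hφ₀ hζ⟩) hf hg a b).trans ?_
      -- Only the `L²` part of the norm of `u` is needed here, via Plancherel.
      gcongr
      rw [← hf.band.eLpNorm_synth]
      exact (eLpNorm_mono_ae hu).trans le_add_self
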